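/- Setting. Let $(X,A,Y)$ (features, sensitive attributes, response) have law $P$, where $X$ takes values in a standard Borel space and $A,Y$ in Polish spaces. Let $\nu$ be a $\sigma$-finite measure on the response space, and suppose that $Y$ has a conditional density $p(y\mid x)$ given $X=x$ and a conditional density $q(y\mid a)$ given $A=a$, both with respect to $\nu$, and that the conditional entropy $H(Y\mid X)=\mathbb E[-\log p(Y\mid X)]$ is finite. Let $\{(f_\theta,p_\theta)\}_{\theta\in\Theta_f}$ be a parametric model: $f_\theta$ is a measurable prediction function with values in a Polish space, $\hat Y=f_\theta(X)$, and $p_\theta(\cdot\mid x)$ is the $\nu$-density that the model gives to $Y$ when $X=x$. Let $\{D_{\theta_d}\}_{\theta_d\in\Theta_d}$ be a class of measurable discriminators with values in $[0,1]$. Inverse conditional permutation (ICP). For i.i.d. copies $(X_i,A_i,Y_i)$, $i\le n$, of $(X,A,Y)$, draw a permutation $\Pi$ of $\{1,\dots,n\}$, independently of the features given $(A_i,Y_i)_{i\le n}$, with $$\mathbb P\{\Pi=\pi\mid (A_i,Y_i)_{i\le n}\}=\frac{\prod_{i} q(Y_{\pi^{-1}(i)}\mid A_i)}{\sum_{\pi'}\prod_{i}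 q(Y_{\pi'^{-1}(i)}\mid A_i)},$$ and put $\tilde A_i=A_{\Pi(i)}$. Let $S^{(n)}_\theta$ be the law of $(f_\theta(X_1),\tilde A_1,Y_1)$. Objective. Fix $0<\mu<1$. For a family $S=(S_\theta)_{\theta\in\Theta_f}$ of laws of $(\hat Y,\tilde A,Y)$ put, with values in $[-\infty,\infty]$, $$\mathcal L_f(\theta_f)=\mathbb E[-\log p_{\theta_f}(Y\mid X)],\qquad \mathcal L_d(\theta_f,\theta_d)=\mathbb E[-\log D_{\theta_d}(f_{\theta_f}(X),A,Y)]+\mathbb E_{Z\sim S_{\theta_f}}[-\log(1-D_{\theta_d}(Z))],$$ $$V_\mu=(1-\mu)\mathcal L_f-\mu\mathcal L_d .$$ A minimax solution is a pair $(\hat\theta_f,\hat\theta_d)$ such that $\hat\theta_f$ minimizes $\theta_f\mapsto\sup_{\theta_d}V_\mu(\theta_f,\theta_d)$ and $\hat\theta_d$ maximizes $V_\mu(\hat\theta_f,\cdot)$. The discriminator class is called rich for $S$ if, for every $\theta_f$, the infimum over $\theta_d\in\Theta_d$ of $\mathcal L_d(\theta_f,\theta_d)$ does not exceed the loss obtained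 by replacing $D_{\theta_d}$ by any measurable $[0,1]$-valued function. Theorem. (0) For every $\theta\in\Theta_f$, $S^{(n)}_\theta$ converges in distribution, as $n\to\infty$, to a probability measure $S^{(\infty)}_\theta$. (1) (Population objective.) Let $V_\mu$ be formed with $S^{(\infty)}$, and let the discriminator class be rich for $S^{(\infty)}$. If there is a minimax solution $(\hat\theta_f,\hat\theta_d)$ with $$V_\mu(\hat\theta_f,\hat\theta_d)=(1-\mu)H(Y\mid X)-\mu\log 4,$$ then $\hat\theta_f$ minimizes $\mathcal L_f$ over $\Theta_f$, and $f_{\hat\theta_f}$ satisfies equalized odds: $f_{\hat\theta_f}(X)$ and $A$ are conditionally independent given $Y$. (2) (Finite samples.) For each $n\ge1$ let $V_\mu^{(n)}$ be formed with $S^{(n)}$, let the discriminator class be rich for $S^{(n)}$, and let $(\hat\theta_f^{(n)},\hat\theta_d^{(n)})$ be a minimax solution of $V_\mu^{(n)}$ with value $(1-\mu)H(Y\mid X)-\mu\log4$. Then every $\hat\theta_f^{(n)}$ minimizes $\mathcal L_f$ over $\Theta_f$, and equalized odds holds asymptotically: with $\hat Y_n=f_{\hat\theta_f^{(n)}}(X)$,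 for all measurable $B,C$, $$\mathbb E\bigl|\mathbb P(\hat Y_n\in B,\,A\in C\mid Y)-\mathbb P(\hat Y_n\in B\mid Y)\,\mathbb P(A\in C\mid Y)\bigr|\longrightarrow 0\qquad(n\to\infty).$$ -/

import Mathlib

open MeasureTheory ProbabilityTheory Filter Topology
open scoped ENNReal NNReal

noncomputable section

namespace FairICP

variable {Ω α β 𝒳 𝒜 𝒴 𝒵 Yhat Θf Θd : Type*}

/-! ### Conditional densities, expectations, losses -/

/-- `q a b` is a conditional density, with respect to `ν`, of `V` given `U = a`: the joint law of
`(U, V)` under `P` has density `q` with respect to `(law of U) ⊗ ν`. The measure `ν` is for instance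
Lebesgue measure (continuous `V`) or the counting measure (categorical `V`). -/
def IsCondDensity [MeasurableSpace Ω] [MeasurableSpace α] [MeasurableSpace β]
    (P : Measure Ω) (U : Ω → α) (V : Ω → β) (ν : Measure β) (q : α → β → ℝ≥0) : Prop :=
  Measurable (Function.uncurry q) ∧
    P.map (fun ω => (U ω, V ω)) =
      ((P.map U).prod ν).withDensity (fun z => (q z.1 z.2 : ℝ≥0∞))

/-- Expectation of an extended-real random variable, `E[g⁺] - E[g⁻]`. -/
def eexp [MeasurableSpace Ω] (P : Measure Ω) (g : Ω → EReal) : EReal :=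
  ((∫⁻ ω, (g ω).toENNReal ∂P : ℝ≥0∞) : EReal) - ((∫⁻ ω, (-g ω).toENNReal ∂P : ℝ≥0∞) : EReal)

/-- `-log r`, with `-log 0 = +∞`. -/
def negLog (r : ℝ≥0∞) : EReal := -ENNReal.log r

/-- A parametric prediction model: for each parameter `θ`, the prediction function `f_θ` and the
conditional density `p_θ(y ∣ x)` (with respect to `ν`) that the model gives to the response.
Examples: a softmax classifier, where `f_θ x` is the vector of class probabilities,
`p_θ(y ∣ x)` its `y`-th entry and `ν` is counting measure; a regression network, where `p_θ(· ∣ x)`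
is a Gaussian density centred at `f_θ x` and `ν` is Lebesgue measure. -/
structure PredictionModel (Θf 𝒳 𝒴 Yhat : Type*) [MeasurableSpace 𝒳] [MeasurableSpace 𝒴]
    [MeasurableSpace Yhat] (ν : Measure 𝒴) where
  pred : Θf → 𝒳 → Yhat
  lik : Θf → 𝒳 → 𝒴 → ℝ≥0
  measurable_pred : ∀ θ, Measurable (pred θ)
  measurable_lik : ∀ θ, Measurable (Function.uncurry (lik θ))
  lintegral_lik : ∀ θ x, ∫⁻ y, (lik θ x y : ℝ≥0∞) ∂ν = 1

/-- Negative log-likelihood loss `E[-log p(Y ∣ X)]` of a conditional density `p`, the triple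
`(X, A, Y)` having law `P`. -/
def lossF [MeasurableSpace 𝒳] [MeasurableSpace 𝒜] [MeasurableSpace 𝒴]
    (P : Measure (𝒳 × 𝒜 × 𝒴)) (p : 𝒳 → 𝒴 → ℝ≥0) : EReal :=
  eexp P (fun z => negLog (p z.1 z.2.2))

/-- Conditional entropy `H(Y ∣ X) = E[-log p(Y ∣ X)]`, where `p` is the true conditional density. -/
def condEntropy [MeasurableSpace 𝒳] [MeasurableSpace 𝒜] [MeasurableSpace 𝒴]
    (P : Measure (𝒳 × 𝒜 × 𝒴)) (p : 𝒳 → 𝒴 → ℝ≥0) : ℝ :=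
  ∫ z, -Real.log (p z.1 z.2.2) ∂P

/-- Discriminator loss `E_R[-log D] + E_S[-log (1 - D)]`, where `R` is the law of `(Ŷ, A, Y)` and
`S` the law of `(Ŷ, Ã, Y)`. -/
def lossD [MeasurableSpace 𝒵] (R S : Measure 𝒵) (D : 𝒵 → unitInterval) : EReal :=
  eexp R (fun z => negLog (ENNReal.ofReal (D z))) +
    eexp S (fun z => negLog (ENNReal.ofReal (1 - D z)))

/-- The law of `(Ŷ, A, Y)` with `Ŷ = f X`. -/
def trueLaw [MeasurableSpace 𝒳] [MeasurableSpace 𝒜] [MeasurableSpace 𝒴] [MeasurableSpace Yhat]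
    (P : Measure (𝒳 × 𝒜 × 𝒴)) (f : 𝒳 → Yhat) : Measure (Yhat × 𝒜 × 𝒴) :=
  P.map (fun z => (f z.1, z.2.1, z.2.2))

/-- The objective `V_μ(θ_f, θ_d) = (1 - μ) L_f(θ_f) - μ L_d(θ_f, θ_d)`, where `S θ` is the law of
`(f_θ X, Ã, Y)`. -/
def objective [MeasurableSpace 𝒳] [MeasurableSpace 𝒜] [MeasurableSpace 𝒴] [MeasurableSpace Yhat]
    {ν : Measure 𝒴} (P : Measure (𝒳 × 𝒜 × 𝒴)) (M : PredictionModel Θf 𝒳 𝒴 Yhat ν)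
    (D : Θd → Yhat × 𝒜 × 𝒴 → unitInterval) (S : Θf → Measure (Yhat × 𝒜 × 𝒴)) (μ : ℝ)
    (θf : Θf) (θd : Θd) : EReal :=
  ((1 - μ : ℝ) : EReal) * lossF P (M.lik θf) -
    (μ : EReal) * lossD (trueLaw P (M.pred θf)) (S θf) (D θd)

/-- `(a, b)` solves `min_{a'} max_{b'} V a' b'`: `b` attains the inner maximum at `a`, and `a`
minimizes the inner maximum. -/
def IsMinimaxSolution (V : Θf → Θd → EReal) (a : Θf) (b : Θd) : Prop :=
  (∀ b', V a b' ≤ V a b) ∧ ∀ a', V a b ≤ ⨆ b', V a' b'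

/-- The discriminator class is rich enough to separate `R` from `S` as well as measurable
discriminators do: its infimal loss does not exceed the loss of any measurable discriminator. -/
def IsRich [MeasurableSpace 𝒵] (D : Θd → 𝒵 → unitInterval) (R S : Measure 𝒵) : Prop :=
  ∀ E : 𝒵 → unitInterval, Measurable E → ⨅ θd, lossD R S (D θd) ≤ lossD R S E

/-! ### Inverse conditional permutation -/

/-- `qⁿ(Y_{π⁻¹} ∣ A) = ∏ i, q(Y_{π⁻¹(i)} ∣ A_i)` for a sample `z` of `n` triples `(X_i, A_i, Y_i)`. -/
def icpWeight {n : ℕ} (q : 𝒜 → 𝒴 → ℝ≥0) (z : Fin n → 𝒳 × 𝒜 × 𝒴) (π : Equiv.Perm (Fin n)) : ℝ≥0 :=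
  ∏ i, q (z i).2.1 (z (π⁻¹ i)).2.2

/-- The conditional probability that inverse conditional permutation picks `π`, given the sample. -/
def icpProb {n : ℕ} (q : 𝒜 → 𝒴 → ℝ≥0) (z : Fin n → 𝒳 × 𝒜 × 𝒴) (π : Equiv.Perm (Fin n)) : ℝ≥0 :=
  icpWeight q z π / ∑ π', icpWeight q z π'

/-- The joint law of the sample and its permuted attributes `Ã = A_Π`, `(A_π)_i = A_{π(i)}`, for an
i.i.d. sample of size `n` from `P` and `Π` drawn with the probabilities `icpProb`. -/
def icpSampleLaw [MeasurableSpace 𝒳] [MeasurableSpace 𝒜] [MeasurableSpace 𝒴]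
    (P : Measure (𝒳 × 𝒜 × 𝒴)) (q : 𝒜 → 𝒴 → ℝ≥0) (n : ℕ) :
    Measure ((Fin n → 𝒳 × 𝒜 × 𝒴) × (Fin n → 𝒜)) :=
  ∑ π : Equiv.Perm (Fin n),
    ((Measure.pi (fun _ : Fin n => P)).withDensity (fun z => (icpProb q z π : ℝ≥0∞))).map
      (fun z => (z, fun i => (z (π i)).2.1))

/-- The law of `(Ŷ, Ã, Y)`, read off one row (the first; the rows are exchangeable), when `Ã` is
generated by inverse conditional permutation from `n + 1` observations and `Ŷ = f X`. -/
def icpLaw [MeasurableSpace 𝒳] [MeasurableSpace 𝒜] [MeasurableSpace 𝒴] [MeasurableSpace Yhat]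
    (P : Measure (𝒳 × 𝒜 × 𝒴)) (q : 𝒜 → 𝒴 → ℝ≥0) (n : ℕ) (f : 𝒳 → Yhat) :
    Measure (Yhat × 𝒜 × 𝒴) :=
  (icpSampleLaw P q (n + 1)).map (fun w => (f (w.1 0).1, w.2 0, (w.1 0).2.2))

/-- Convergence in distribution. -/
def ConvergesInLaw [TopologicalSpace 𝒵] [MeasurableSpace 𝒵] (S : ℕ → Measure 𝒵)
    (S' : Measure 𝒵) : Prop :=
  ∀ g : BoundedContinuousFunction 𝒵 ℝ,
    Tendsto (fun n => ∫ z, g z ∂(S n)) atTop (𝓝 (∫ z, g z ∂S'))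

/-- The population law of `(f X, Ã, Y)` under inverse conditional permutation: the limit in
distribution as the sample size tends to infinity. -/
def IsPopulationICPLaw [MeasurableSpace 𝒳] [MeasurableSpace 𝒜] [MeasurableSpace 𝒴]
    [MeasurableSpace Yhat] [TopologicalSpace 𝒜] [TopologicalSpace 𝒴] [TopologicalSpace Yhat]
    (P : Measure (𝒳 × 𝒜 × 𝒴)) (q : 𝒜 → 𝒴 → ℝ≥0) (f : 𝒳 → Yhat)
    (S : Measure (Yhat × 𝒜 × 𝒴)) : Prop :=
  IsProbabilityMeasure S ∧ ConvergesInLaw (fun n => icpLaw P q n f) S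

/-! ### Equalized odds -/

lemma measurable_response [MeasurableSpace 𝒳] [MeasurableSpace 𝒜] [MeasurableSpace 𝒴] :
    Measurable (fun z : 𝒳 × 𝒜 × 𝒴 => z.2.2) := by fun_prop

/-- Equalized odds: `Ŷ = f X` and `A` are conditionally independent given `Y`. -/
def EqualizedOdds [MeasurableSpace 𝒳] [MeasurableSpace 𝒜] [MeasurableSpace 𝒴]
    [MeasurableSpace Yhat] [StandardBorelSpace (𝒳 × 𝒜 × 𝒴)]
    (P : Measure (𝒳 × 𝒜 × 𝒴)) [IsFiniteMeasure P] (f : 𝒳 → Yhat) : Prop :=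
  CondIndepFun (MeasurableSpace.comap (fun z : 𝒳 × 𝒜 × 𝒴 => z.2.2) inferInstance)
    measurable_response.comap_le (fun z => f z.1) (fun z => z.2.1) P

/-- Conditional probability `P(s ∣ Y)`. -/
def condProbY [MeasurableSpace 𝒳] [MeasurableSpace 𝒜] [MeasurableSpace 𝒴]
    (P : Measure (𝒳 × 𝒜 × 𝒴)) (s : Set (𝒳 × 𝒜 × 𝒴)) : 𝒳 × 𝒜 × 𝒴 → ℝ :=
  P[s.indicator (fun _ => (1 : ℝ)) |
    MeasurableSpace.comap (fun z : 𝒳 × 𝒜 × 𝒴 => z.2.2) inferInstance]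

/-- Asymptotic equalized odds of a sequence of predictors: for all measurable `B`, `C`,
`P(Ŷₙ ∈ B, A ∈ C ∣ Y) - P(Ŷₙ ∈ B ∣ Y) P(A ∈ C ∣ Y) → 0` in `L¹`. -/
def AsymptoticEqualizedOdds [MeasurableSpace 𝒳] [MeasurableSpace 𝒜] [MeasurableSpace 𝒴]
    [MeasurableSpace Yhat] (P : Measure (𝒳 × 𝒜 × 𝒴)) (f : ℕ → 𝒳 → Yhat) : Prop :=
  ∀ (B : Set Yhat) (C : Set 𝒜), MeasurableSet B → MeasurableSet C →
    Tendsto (fun n => ∫ z, |condProbY P {z | f n z.1 ∈ B ∧ z.2.1 ∈ C} z -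
      condProbY P {z | f n z.1 ∈ B} z * condProbY P {z | z.2.1 ∈ C} z| ∂P) atTop (𝓝 0)

end FairICP

end

/-! Two independent mechanisms combine.

Minimax side. Gibbs' inequality (`condEntropy_le_lossF`) gives `L_f ≥ H(Y ∣ X)`, and richness
compared with the constant discriminator `1/2` gives `inf L_d ≤ log 4`. The prescribed value of the
objective leaves no slack in either bound. Hence the predictor attains the least possible likelihood
loss, and no measurable discriminator beats `log 4`, which forces the law of `(Ŷ, A, Y)` to equal
that of `(Ŷ, Ã, Y)` (`eq_of_log_four_le_lossD`). It remains to understand the second law.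

Permutation side. Averaging over `Π` turns the event `Ã_1 ∈ C` into `posterior`, which is the
conditional probability of `A_1 ∈ C` given the ordered responses and the unordered attributes. The
claim is that it converges in `L¹` to `P(A ∈ C ∣ Y_1)`, so that `(Ŷ, Ã, Y)` approaches
`resampledLaw`, where the attribute is redrawn given `Y` independently of `X`. Let `g` be the sign
of the difference. It is invariant under permutations of the attributes, and for such `g` the
posterior integrates like the indicator of `A_1 ∈ C` (`lintegral_symm_mul_posterior`). So the `L¹`
distance equals `E[g ξ_1]`, with `ξ_i` the indicator of `A_i ∈ C` centred given `Y_i`.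

This correlation vanishes uniformly in `g` (`exists_abs_integral_symm_mul_centred_le`). If `Y_1` and
`Y_j` have nearly the same conditional law of the attribute, exchanging `A_1` and `A_j` hardly
changes the law of the sample and does not change `g`, so `ξ_1` may be replaced by `ξ_j`. Averaging
over such `j` with kernel weights replaces `ξ_1` by an average of centred terms, which tends to zero
in mean square. No continuity of the densities is needed: the kernel of `exists_smoothing_kernel` is
built from an `L¹` approximation of the density by functions of a finite label of `y`.

The resulting bound on rectangles does not involve the predictor. That uniformity is what allows the
predictor to change with `n` in the finite-sample claim. Finally, `integral_abs_condProbY_sub_le`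
converts closeness to `resampledLaw` on rectangles into closeness to conditional independence; zero
distance gives exact equalized odds. -/

namespace FairICP

variable {α β : Type*} [MeasurableSpace α] [MeasurableSpace β]

/-! ### Approximation of functions on a product by functions of a finite label -/

/-- `f (a, y)` depends on `y` only through a measurable label with finitely many values. -/
def IsFinitelyLabelled (f : α × β → ℝ) : Prop :=
  ∃ (k : ℕ) (l : β → Fin k) (s : α × Fin k → ℝ),
    Measurable l ∧ Measurable s ∧ f = fun z => s (z.1, l z.2)

lemma IsFinitelyLabelled.measurable {f : α × β → ℝ} (hf : IsFinitelyLabelled f) :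
    Measurable f := by
  obtain ⟨k, l, s, hl, hs, rfl⟩ := hf
  exact hs.comp (measurable_fst.prodMk (hl.comp measurable_snd))

/-- The pair of the two labels is again a finite label, encoded in `Fin (k * k')`. -/
lemma IsFinitelyLabelled.map₂ {f g : α × β → ℝ} (hf : IsFinitelyLabelled f)
    (hg : IsFinitelyLabelled g) {F : ℝ × ℝ → ℝ} (hF : Measurable F) :
    IsFinitelyLabelled fun z => F (f z, g z) := by
  obtain ⟨k, l, s, hl, hs, rfl⟩ := hf
  obtain ⟨k', l', s', hl', hs', rfl⟩ := hg
  refine ⟨k * k', fun y => finProdFinEquiv (l y, l' y),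
    fun z => F (s (z.1, (finProdFinEquiv.symm z.2).1), s' (z.1, (finProdFinEquiv.symm z.2).2)),
    (measurable_of_finite _).comp (hl.prodMk hl'), ?_, by simp⟩
  refine hF.comp (Measurable.prodMk ?_ ?_)
  · exact hs.comp (measurable_fst.prodMk ((measurable_of_finite
      fun i : Fin (k * k') => (finProdFinEquiv.symm i).1).comp measurable_snd))
  · exact hs'.comp (measurable_fst.prodMk ((measurable_of_finite
      fun i : Fin (k * k') => (finProdFinEquiv.symm i).2).comp measurable_snd))

lemma IsFinitelyLabelled.rectangle {s : Set α} {t : Set β} (hs : MeasurableSet s)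
    (ht : MeasurableSet t) : IsFinitelyLabelled ((s ×ˢ t).indicator fun _ => (1 : ℝ)) := by
  classical
  refine ⟨2, fun y => if y ∈ t then 1 else 0,
    (s ×ˢ {(1 : Fin 2)}).indicator fun _ => (1 : ℝ),
    Measurable.ite ht measurable_const measurable_const,
    measurable_const.indicator (hs.prod (measurableSet_singleton _)), ?_⟩
  ext ⟨a, y⟩
  by_cases ha : a ∈ s <;> by_cases hy : y ∈ t <;> simp [Set.indicator, ha, hy]

/-- The sets whose indicator depends on the second coordinate through a finite label. -/
def labelledSets (α β : Type*) [MeasurableSpace α] [MeasurableSpace β] : Set (Set (α × β)) :=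
  {S | IsFinitelyLabelled (S.indicator fun _ => (1 : ℝ))}

/-- The ring structure makes these sets dense, in measure, in the σ-algebra they generate. Unions
and differences act on indicators as `max p q` and `p * (1 - q)`. -/
lemma isSetRing_labelledSets : IsSetRing (labelledSets α β) where
  empty_mem := by
    have := IsFinitelyLabelled.rectangle (α := α) (β := β) MeasurableSet.empty MeasurableSet.empty
    simpa [labelledSets] using this
  union_mem := by
    intro S T hS hT
    have := IsFinitelyLabelled.map₂ hS hT (F := fun p => max p.1 p.2) (by fun_prop)
    simp only [labelledSets, Set.mem_ofPred_eq]
    convert this using 2 with z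
    by_cases h1 : z ∈ S <;> by_cases h2 : z ∈ T <;> simp [h1, h2]
  sdiff_mem := by
    intro S T hS hT
    have := IsFinitelyLabelled.map₂ hS hT (F := fun p => p.1 * (1 - p.2)) (by fun_prop)
    simp only [labelledSets, Set.mem_ofPred_eq]
    convert this using 2 with z
    by_cases h1 : z ∈ S <;> by_cases h2 : z ∈ T <;> simp [h1, h2]

lemma measurableSet_of_mem_labelledSets {S : Set (α × β)} (hS : S ∈ labelledSets α β) :
    MeasurableSet S := by
  have := IsFinitelyLabelled.measurable hS (measurableSet_singleton 1)
  convert this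
  ext z
  by_cases h : z ∈ S <;> simp [h]

lemma generateFrom_labelledSets :
    (inferInstance : MeasurableSpace (α × β)) = MeasurableSpace.generateFrom (labelledSets α β) := by
  apply le_antisymm
  · rw [← generateFrom_prod]
    apply MeasurableSpace.generateFrom_mono
    rintro _ ⟨s, hs, t, ht, rfl⟩
    exact IsFinitelyLabelled.rectangle hs ht
  · exact MeasurableSpace.generateFrom_le fun S hS => measurableSet_of_mem_labelledSets hS

/-- Density in `L¹`: a measurable set is approximated in measure by members of the generating ring,
and the property passes to sums, `L¹` limits and a.e. equal functions. -/
lemma exists_isFinitelyLabelled_lintegral_le {ρ : Measure (α × β)} [IsFiniteMeasure ρ]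
    {f : α × β → ℝ} (hf : Integrable f ρ) :
    ∀ ε : ℝ≥0∞, 0 < ε → ∃ g, IsFinitelyLabelled g ∧ ∫⁻ z, ‖f z - g z‖ₑ ∂ρ ≤ ε := by
  refine Integrable.induction
    (fun f => ∀ ε : ℝ≥0∞, 0 < ε → ∃ g, IsFinitelyLabelled g ∧ ∫⁻ z, ‖f z - g z‖ₑ ∂ρ ≤ ε)
    ?_ ?_ ?_ ?_ hf
  · intro c S hS _ ε hε
    obtain ⟨δ, hδ, hcδ⟩ : ∃ δ : ℝ≥0∞, 0 < δ ∧ ‖c‖ₑ * δ ≤ ε := by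
      by_cases hc : c = 0
      · exact ⟨1, one_pos, by simp [hc]⟩
      · refine ⟨ε / ‖c‖ₑ, ENNReal.div_pos hε.ne' (by simp), ?_⟩
        rw [ENNReal.mul_div_cancel (by simpa using hc) (by simp)]
    obtain ⟨T, hT, hTS⟩ := exists_measure_symmDiff_lt_of_generateFrom_isSetRing (μ := ρ)
      isSetRing_labelledSets ⟨{Set.univ}, by simp, by
        have := IsFinitelyLabelled.rectangle (α := α) (β := β) MeasurableSet.univ MeasurableSet.univ
        simpa [labelledSets] using this, by simp⟩ generateFrom_labelledSets hS hδ
    refine ⟨fun z => c * T.indicator (fun _ => (1 : ℝ)) z,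
      hT.map₂ hT (F := fun p => c * p.1) (by fun_prop), ?_⟩
    have hTm : MeasurableSet T := measurableSet_of_mem_labelledSets hT
    calc ∫⁻ z, ‖S.indicator (fun _ => c) z - c * T.indicator (fun _ => (1 : ℝ)) z‖ₑ ∂ρ
        = ∫⁻ z, (symmDiff T S).indicator (fun _ => ‖c‖ₑ) z ∂ρ := by
          congr 1; ext z
          by_cases h1 : z ∈ S <;> by_cases h2 : z ∈ T <;>
            simp [Set.indicator, h1, h2, Set.mem_symmDiff]
      _ = ‖c‖ₑ * ρ (symmDiff T S) := by rw [lintegral_indicator_const (hTm.symmDiff hS)]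
      _ ≤ ‖c‖ₑ * δ := by gcongr
      _ ≤ ε := hcδ
  · intro f g _ hf hg ihf ihg ε hε
    obtain ⟨f', hf', h1⟩ := ihf (ε / 2) (ENNReal.half_pos hε.ne')
    obtain ⟨g', hg', h2⟩ := ihg (ε / 2) (ENNReal.half_pos hε.ne')
    refine ⟨fun z => f' z + g' z, hf'.map₂ hg' (F := fun p => p.1 + p.2) (by fun_prop), ?_⟩
    calc ∫⁻ z, ‖(f + g) z - (f' z + g' z)‖ₑ ∂ρ
        ≤ ∫⁻ z, (‖f z - f' z‖ₑ + ‖g z - g' z‖ₑ) ∂ρ := by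
          apply lintegral_mono
          intro z
          have : (f + g) z - (f' z + g' z) = (f z - f' z) + (g z - g' z) := by simp; ring
          simp only [this]
          exact enorm_add_le _ _
      _ = ∫⁻ z, ‖f z - f' z‖ₑ ∂ρ + ∫⁻ z, ‖g z - g' z‖ₑ ∂ρ := by
          apply lintegral_add_left'
          exact (hf.aestronglyMeasurable.aemeasurable.sub hf'.measurable.aemeasurable).enorm
      _ ≤ ε / 2 + ε / 2 := by gcongr
      _ = ε := ENNReal.add_halves ε
  · apply isClosed_of_closure_subset
    intro f hf ε hε
    rw [EMetric.mem_closure_iff] at hf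
    obtain ⟨g, hg, hfg⟩ := hf (ε / 2) (ENNReal.half_pos hε.ne')
    obtain ⟨g', hg', h2⟩ := hg (ε / 2) (ENNReal.half_pos hε.ne')
    refine ⟨g', hg', ?_⟩
    rw [Lp.edist_def, eLpNorm_one_eq_lintegral_enorm] at hfg
    calc ∫⁻ z, ‖f z - g' z‖ₑ ∂ρ
        ≤ ∫⁻ z, (‖f z - g z‖ₑ + ‖g z - g' z‖ₑ) ∂ρ := by
          apply lintegral_mono
          intro z
          have : f z - g' z = (f z - g z) + (g z - g' z) := by ring
          simp only [this]
          exact enorm_add_le _ _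
      _ = ∫⁻ z, ‖f z - g z‖ₑ ∂ρ + ∫⁻ z, ‖g z - g' z‖ₑ ∂ρ := by
          apply lintegral_add_left'
          exact ((Lp.aestronglyMeasurable f).aemeasurable.sub
            (Lp.aestronglyMeasurable g).aemeasurable).enorm
      _ ≤ ε / 2 + ε / 2 := by gcongr; exact hfg.le
      _ = ε := ENNReal.add_halves ε
  · intro f g hfg _ ih ε hε
    obtain ⟨f', hf', h⟩ := ih ε hε
    refine ⟨f', hf', le_of_eq_of_le (lintegral_congr_ae ?_) h⟩
    filter_upwards [hfg] with z hz
    rw [hz]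

/-- For a family of probability densities `r(·, y)` there is a bounded Markov density `κ` that moves
`y` only to points `y'` such that `r(·, y')` is close to `r(·, y)`. -/
theorem exists_smoothing_kernel (μ : Measure α) (ν : Measure β) [IsProbabilityMeasure μ]
    [IsProbabilityMeasure ν] {r : α → β → ℝ≥0} (hr : Measurable (Function.uncurry r))
    (hr1 : ∀ y, ∫⁻ a, r a y ∂μ = 1) {ε : ℝ≥0∞} (hε : 0 < ε) :
    ∃ (M : ℝ) (κ : β → β → ℝ), Measurable (Function.uncurry κ) ∧ (∀ y y', 0 ≤ κ y y') ∧
      (∀ y y', κ y y' ≤ M) ∧ (∀ y, ∫ y', κ y y' ∂ν = 1) ∧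
      ∫⁻ y, ∫⁻ y', ENNReal.ofReal (κ y y') *
        ∫⁻ a, ‖(r a y : ℝ) - r a y'‖ₑ ∂μ ∂ν ∂ν ≤ ε := by
  classical
  have hint : Integrable (fun z : α × β => (r z.1 z.2 : ℝ)) (μ.prod ν) := by
    refine ⟨(measurable_coe_nnreal_real.comp hr).aestronglyMeasurable, ?_⟩
    rw [hasFiniteIntegral_iff_enorm, lintegral_prod_symm' _ (by exact
      (measurable_coe_nnreal_real.comp hr).enorm)]
    simp [Real.enorm_eq_ofReal, hr1]
  obtain ⟨g, ⟨k, l, s, hl, hs, rfl⟩, hg⟩ :=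
    exists_isFinitelyLabelled_lintegral_le hint (ε / 2) (ENNReal.half_pos hε.ne')
  set p : Fin k → ℝ := fun i => ν.real (l ⁻¹' {i}) with hp
  have hp0 : ∀ i, 0 ≤ p i := fun i => measureReal_nonneg
  -- From `y` the kernel moves to a `ν`-random point of the label cell of `y`. On null cells the
  -- default density `1` keeps every row integral equal to one.
  let K : Fin k → Fin k → ℝ := fun i j => if p i = 0 then 1 else if i = j then (p i)⁻¹ else 0
  have hlm : ∀ i, MeasurableSet (l ⁻¹' {i}) := fun i => hl (measurableSet_singleton i)
  have hK0 : ∀ i j, 0 ≤ K i j := by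
    intro i j
    simp only [K]
    split_ifs
    · exact zero_le_one
    · exact inv_nonneg.2 (hp0 i)
    · exact le_rfl
  have hKm : Measurable fun z : β × β => K (l z.1) (l z.2) :=
    (measurable_of_finite fun q : Fin k × Fin k => K q.1 q.2).comp
      ((hl.comp measurable_fst).prodMk (hl.comp measurable_snd))
  have hK1 : ∀ y, ∫ y', K (l y) (l y') ∂ν = 1 := by
    intro y
    by_cases h : p (l y) = 0
    · simp [K, h]
    · have : (fun y' => K (l y) (l y')) = (l ⁻¹' {l y}).indicator fun _ => (p (l y))⁻¹ := by
        ext y'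
        by_cases h' : l y = l y'
        · rw [Set.indicator_of_mem (by exact h'.symm)]
          simp only [K, if_neg h, if_pos h']
        · have hy' : y' ∉ l ⁻¹' {l y} := fun h'' => h' (Eq.symm h'')
          rw [Set.indicator_of_notMem hy']
          simp only [K, if_neg h, if_neg h']
      rw [this, integral_indicator_const _ (hlm _)]
      exact mul_inv_cancel₀ h
  have hae : ∀ᵐ y ∂ν, p (l y) ≠ 0 := by
    have : {y | ¬ p (l y) ≠ 0} ⊆ ⋃ i ∈ {i | p i = 0}, l ⁻¹' {i} := by
      intro y hy
      simp only [ne_eq, not_not, Set.mem_ofPred_eq] at hy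
      simp [hy]
    refine measure_mono_null this ((measure_biUnion_null_iff (Set.to_countable _)).2 ?_)
    intro i hi
    exact (measureReal_eq_zero_iff).1 hi
  have hKM : ∀ i j, K i j ≤ 1 + ∑ i, (p i)⁻¹ := by
    intro i j
    have h1 : (p i)⁻¹ ≤ ∑ i, (p i)⁻¹ :=
      Finset.single_le_sum (f := fun i => (p i)⁻¹) (fun i _ => inv_nonneg.2 (hp0 i))
        (Finset.mem_univ _)
    have h0 := inv_nonneg.2 (hp0 i)
    simp only [K]
    split_ifs <;> linarith
  have hKself : ∀ i, p i ≠ 0 → K i i = (p i)⁻¹ := by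
    intro i hi
    simp only [K, if_neg hi, if_true]
  have hKne : ∀ i j, p i ≠ 0 → i ≠ j → K i j = 0 := by
    intro i j hi hij
    simp only [K, if_neg hi, if_neg hij]
  clear_value K
  refine ⟨1 + ∑ i, (p i)⁻¹, fun y y' => K (l y) (l y'), hKm, fun _ _ => hK0 _ _,
    fun _ _ => hKM _ _, hK1, ?_⟩
  · set e : β → ℝ≥0∞ := fun y => ∫⁻ a, ‖(r a y : ℝ) - s (a, l y)‖ₑ ∂μ with he
    have hdm : Measurable fun z : α × β => ‖(r z.1 z.2 : ℝ) - s (z.1, l z.2)‖ₑ :=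
      ((measurable_coe_nnreal_real.comp hr).sub
        (hs.comp (measurable_fst.prodMk (hl.comp measurable_snd)))).enorm
    have hem : Measurable e := hdm.lintegral_prod_left'
    have hee : ∫⁻ y, e y ∂ν ≤ ε / 2 := by
      rw [lintegral_prod_symm' _ hdm] at hg
      exact hg
    have hKE : Measurable fun z : β × β => ENNReal.ofReal (K (l z.1) (l z.2)) := hKm.ennreal_ofReal
    have hKl : ∀ y, Measurable fun y' => ENNReal.ofReal (K (l y) (l y')) :=
      fun y => hKE.comp measurable_prodMk_left
    have hKr : ∀ y', Measurable fun y => ENNReal.ofReal (K (l y) (l y')) :=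
      fun y' => hKE.comp measurable_prodMk_right
    have hKe : Measurable
        (Function.uncurry fun y y' => ENNReal.ofReal (K (l y) (l y')) * e y') :=
      hKE.mul (hem.comp measurable_snd)
    have hrow : ∀ y, ∫⁻ y', ENNReal.ofReal (K (l y) (l y')) ∂ν = 1 := by
      intro y
      have hi : Integrable (fun y' => K (l y) (l y')) ν := by
        by_contra h
        simpa [integral_undef h] using hK1 y
      rw [← ofReal_integral_eq_lintegral_ofReal hi (ae_of_all _ fun _ => hK0 _ _), hK1,
        ENNReal.ofReal_one]
    -- Off the null cells the kernel is symmetric, so its columns also have mass at most one. Hence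
    -- the approximation error at the moved point `y'` averages to no more than the error at `y`.
    have hcol : ∀ y', ∫⁻ y, ENNReal.ofReal (K (l y) (l y')) ∂ν ≤ 1 := by
      intro y'
      calc ∫⁻ y, ENNReal.ofReal (K (l y) (l y')) ∂ν
          ≤ ∫⁻ y, (l ⁻¹' {l y'}).indicator (fun _ => ENNReal.ofReal (p (l y'))⁻¹) y ∂ν := by
            apply lintegral_mono_ae
            filter_upwards [hae] with y hy
            by_cases h' : l y = l y'
            · have : p (l y') ≠ 0 := h' ▸ hy
              simp [h', hKself _ this]
            · simp [hKne _ _ hy h']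
        _ = ENNReal.ofReal (p (l y'))⁻¹ * ENNReal.ofReal (p (l y')) := by
            rw [lintegral_indicator_const (hlm _), hp]
            simp
        _ ≤ 1 := by
            rw [← ENNReal.ofReal_mul (inv_nonneg.2 (hp0 _)), ← ENNReal.ofReal_one]
            exact ENNReal.ofReal_le_ofReal inv_mul_le_one
    -- Within one cell `s (a, l y) = s (a, l y')`, so the triangle inequality through this common
    -- value bounds the distance by `e y + e y'`.
    calc ∫⁻ y, ∫⁻ y', ENNReal.ofReal (K (l y) (l y')) * ∫⁻ a, ‖(r a y : ℝ) - r a y'‖ₑ ∂μ ∂ν ∂ν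
        ≤ ∫⁻ y, ∫⁻ y', (ENNReal.ofReal (K (l y) (l y')) * e y +
            ENNReal.ofReal (K (l y) (l y')) * e y') ∂ν ∂ν := by
          apply lintegral_mono_ae
          filter_upwards [hae] with y hy
          apply lintegral_mono
          intro y'
          by_cases h' : l y = l y'
          · simp only [← mul_add]
            gcongr
            rw [he, ← lintegral_add_left (by exact hdm.comp measurable_prodMk_right)]
            apply lintegral_mono
            intro a
            have : (r a y : ℝ) - r a y' =
                ((r a y : ℝ) - s (a, l y)) - (r a y' - s (a, l y')) := by rw [h']; ring
            simp only [this]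
            exact enorm_sub_le
          · simp [hKne _ _ hy h']
      _ = ∫⁻ y, (e y + ∫⁻ y', ENNReal.ofReal (K (l y) (l y')) * e y' ∂ν) ∂ν := by
          apply lintegral_congr
          intro y
          rw [lintegral_add_left ((hKl y).mul_const (e y)),
            lintegral_mul_const _ (hKl y), hrow, one_mul]
      _ = ∫⁻ y, e y ∂ν + ∫⁻ y', ∫⁻ y, ENNReal.ofReal (K (l y) (l y')) * e y' ∂ν ∂ν := by
          rw [lintegral_add_left hem, lintegral_lintegral_swap hKe.aemeasurable]
      _ ≤ ε / 2 + ∫⁻ y', e y' ∂ν := by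
          gcongr with y'
          rw [lintegral_mul_const _ (hKr y')]
          exact mul_le_of_le_one_left' (hcol y')
      _ ≤ ε / 2 + ε / 2 := by gcongr
      _ = ε := ENNReal.add_halves ε

/-! ### Exchanging two coordinates -/

/-- The probability of `C` under the density `r(·, y)`. -/
noncomputable def condMass (μ : Measure α) (r : α → β → ℝ≥0) (C : Set α) (y : β) : ℝ :=
  ∫ a in C, (r a y : ℝ) ∂μ

section condMass

variable {μ : Measure α} {ν : Measure β} {r : α → β → ℝ≥0} {C : Set α}

lemma integrable_density (hr : Measurable (Function.uncurry r)) {y : β}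
    (hr1 : ∫⁻ a, r a y ∂μ = 1) : Integrable (fun a => (r a y : ℝ)) μ := by
  refine ⟨(measurable_coe_nnreal_real.comp
    (hr.comp measurable_prodMk_right)).aestronglyMeasurable, ?_⟩
  rw [hasFiniteIntegral_iff_enorm]
  simp [Real.enorm_eq_ofReal, hr1]

lemma integral_density (hr : Measurable (Function.uncurry r)) {y : β}
    (hr1 : ∫⁻ a, r a y ∂μ = 1) : ∫ a, (r a y : ℝ) ∂μ = 1 := by
  have h := ofReal_integral_eq_lintegral_ofReal (integrable_density hr hr1)
    (ae_of_all _ fun a => NNReal.coe_nonneg _)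
  simp only [ENNReal.ofReal_coe_nnreal, hr1] at h
  exact ENNReal.ofReal_eq_one.1 h

lemma measurable_condMass [SFinite μ] (hr : Measurable (Function.uncurry r)) :
    Measurable (condMass μ r C) :=
  (StronglyMeasurable.integral_prod_left (μ := μ.restrict C)
    (f := fun a y => (r a y : ℝ)) (measurable_coe_nnreal_real.comp hr).stronglyMeasurable).measurable

lemma condMass_nonneg (y : β) : 0 ≤ condMass μ r C y :=
  integral_nonneg fun _ => NNReal.coe_nonneg _

lemma condMass_le_one (hr : Measurable (Function.uncurry r)) {y : β}
    (hr1 : ∫⁻ a, r a y ∂μ = 1) : condMass μ r C y ≤ 1 :=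
  (setIntegral_le_integral (integrable_density hr hr1)
    (ae_of_all _ fun _ => NNReal.coe_nonneg _)).trans_eq (integral_density hr hr1)

lemma enorm_condMass_sub_le (hr : Measurable (Function.uncurry r))
    (hr1 : ∀ y, ∫⁻ a, r a y ∂μ = 1) (y y' : β) :
    ‖condMass μ r C y - condMass μ r C y'‖ₑ ≤ ∫⁻ a, ‖(r a y : ℝ) - r a y'‖ₑ ∂μ := by
  rw [condMass, condMass, ← integral_sub (integrable_density hr (hr1 y)).integrableOn
    (integrable_density hr (hr1 y')).integrableOn]
  exact (enorm_integral_le_lintegral_enorm _).trans (setLIntegral_le_lintegral _ _)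

/-- The indicator of `C` at `a`, centred given `y`. -/
noncomputable def centred (μ : Measure α) (r : α → β → ℝ≥0) (C : Set α) (z : α × β) : ℝ :=
  C.indicator (fun _ => (1 : ℝ)) z.1 - condMass μ r C z.2

lemma measurable_centred [SFinite μ] (hr : Measurable (Function.uncurry r))
    (hC : MeasurableSet C) : Measurable (centred μ r C) :=
  ((measurable_const.indicator hC).comp measurable_fst).sub
    ((measurable_condMass hr).comp measurable_snd)

lemma abs_centred_le_one (hr : Measurable (Function.uncurry r))
    (hr1 : ∀ y, ∫⁻ a, r a y ∂μ = 1) (z : α × β) : |centred μ r C z| ≤ 1 := by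
  have h0 : 0 ≤ condMass μ r C z.2 := condMass_nonneg _
  have h1 : condMass μ r C z.2 ≤ 1 := condMass_le_one hr (hr1 _)
  rw [centred, abs_le]
  by_cases h : z.1 ∈ C
  · simp only [Set.indicator_of_mem h]; constructor <;> linarith
  · simp only [Set.indicator_of_notMem h]; constructor <;> linarith

variable [IsProbabilityMeasure μ] [IsProbabilityMeasure ν]

lemma lintegral_withDensity_snd (hr : Measurable (Function.uncurry r))
    (hr1 : ∀ y, ∫⁻ a, r a y ∂μ = 1) {f : β → ℝ≥0∞} (hf : Measurable f) :
    ∫⁻ z, f z.2 ∂(μ.prod ν).withDensity (fun z => (r z.1 z.2 : ℝ≥0∞)) = ∫⁻ y, f y ∂ν := by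
  have hr' : Measurable fun z : α × β => (r z.1 z.2 : ℝ≥0∞) := hr.coe_nnreal_ennreal
  rw [lintegral_withDensity_eq_lintegral_mul _ hr'
      (show Measurable fun z : α × β => f z.2 from hf.comp measurable_snd),
    lintegral_prod_symm' _ (hr'.mul
      (show Measurable fun z : α × β => f z.2 from hf.comp measurable_snd))]
  refine lintegral_congr fun y => ?_
  simp only [Pi.mul_apply]
  rw [lintegral_mul_const _ (show Measurable fun a => (r a y : ℝ≥0∞) from
    hr'.comp measurable_prodMk_right), hr1, one_mul]

/-- With `y` fixed, `centred` has mean zero under the density `r(·, y)`; Fubini with the first entry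
innermost gives the result. -/
lemma integral_mul_centred (hr : Measurable (Function.uncurry r))
    (hr1 : ∀ y, ∫⁻ a, r a y ∂μ = 1) (hC : MeasurableSet C) {f : β → ℝ} (hf : Measurable f)
    {M : ℝ} (hfM : ∀ y, |f y| ≤ M)
    [IsProbabilityMeasure ((μ.prod ν).withDensity (fun z => (r z.1 z.2 : ℝ≥0∞)))] :
    ∫ z, f z.2 * centred μ r C z ∂(μ.prod ν).withDensity (fun z => (r z.1 z.2 : ℝ≥0∞)) = 0 := by
  have hr' : Measurable fun z : α × β => r z.1 z.2 := hr
  have hmeas : Measurable fun z : α × β => f z.2 * centred μ r C z :=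
    (hf.comp measurable_snd).mul (measurable_centred hr hC)
  have hint : Integrable (fun z : α × β => f z.2 * centred μ r C z)
      ((μ.prod ν).withDensity (fun z => (r z.1 z.2 : ℝ≥0∞))) := by
    refine Integrable.of_bound hmeas.aestronglyMeasurable M (ae_of_all _ fun z => ?_)
    rw [Real.norm_eq_abs, abs_mul]
    have := abs_centred_le_one (C := C) hr hr1 z
    nlinarith [hfM z.2, abs_nonneg (f z.2), abs_nonneg (centred μ r C z)]
  rw [integral_withDensity_eq_integral_smul hr', integral_prod_symm _
    ((integrable_withDensity_iff_integrable_smul hr').1 hint)]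
  refine (integral_congr_ae (ae_of_all _ fun y => ?_)).trans (integral_zero _ _)
  have h1 : ∀ a, r a y • (f y * centred μ r C (a, y)) =
      f y * (C.indicator (fun a => (r a y : ℝ)) a - condMass μ r C y * r a y) := by
    intro a
    rw [NNReal.smul_def, smul_eq_mul, centred]
    by_cases h : a ∈ C <;> simp [h] <;> ring
  simp only [h1]
  have hi := integrable_density hr (hr1 y)
  rw [integral_const_mul, integral_sub (hi.indicator hC) (hi.const_mul _), integral_const_mul,
    integral_density hr (hr1 y), integral_indicator hC, condMass]
  ring

end condMass

/-- With both second entries outermost, exchanging the first entries is a plain Tonelli swap of the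
two inner integrals. -/
lemma lintegral_prod_prod {μ : Measure α} {ν : Measure β} [SFinite μ] [SFinite ν]
    {F : (α × β) × (α × β) → ℝ≥0∞} (hF : Measurable F) :
    ∫⁻ q, F q ∂(μ.prod ν).prod (μ.prod ν) =
      ∫⁻ y, ∫⁻ y', ∫⁻ a, ∫⁻ a', F ((a, y), (a', y')) ∂μ ∂μ ∂ν ∂ν := by
  rw [lintegral_prod _ hF.aemeasurable, lintegral_prod_symm' _ hF.lintegral_prod_right']
  refine lintegral_congr fun y => ?_
  have h1 : ∀ a, ∫⁻ z, F ((a, y), z) ∂μ.prod ν = ∫⁻ y', ∫⁻ a', F ((a, y), (a', y')) ∂μ ∂ν :=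
    fun a => lintegral_prod_symm' _ (hF.comp measurable_prodMk_left)
  simp only [h1]
  apply lintegral_lintegral_swap
  · have h : Measurable fun t : (α × β) × α => F ((t.1.1, y), (t.2, t.1.2)) :=
      hF.comp (by fun_prop)
    exact h.lintegral_prod_right'.aemeasurable

lemma measurePreserving_swap_fst (μ : Measure α) (ν : Measure β) [IsProbabilityMeasure μ]
    [IsProbabilityMeasure ν] :
    MeasurePreserving (fun q : (α × β) × (α × β) => ((q.2.1, q.1.2), (q.1.1, q.2.2)))
      ((μ.prod ν).prod (μ.prod ν)) ((μ.prod ν).prod (μ.prod ν)) := by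
  have hm : Measurable (fun q : (α × β) × (α × β) => ((q.2.1, q.1.2), (q.1.1, q.2.2))) := by
    fun_prop
  refine ⟨hm, ?_⟩
  ext s hs
  rw [Measure.map_apply hm hs, ← lintegral_indicator_one hs, ← lintegral_indicator_one (hm hs),
    lintegral_prod_prod (measurable_one.indicator hs),
    lintegral_prod_prod (measurable_one.indicator (hm hs))]
  refine lintegral_congr fun y => lintegral_congr fun y' => ?_
  rw [lintegral_lintegral_swap]
  · rfl
  · exact ((measurable_one.indicator (hm hs)).comp (by fun_prop :
      Measurable fun t : α × α => ((t.1, y), (t.2, y')))).aemeasurable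

section pair

variable {μ : Measure α} {ν : Measure β} [IsProbabilityMeasure μ] [IsProbabilityMeasure ν]
  {r : α → β → ℝ≥0} {C : Set α}

/-- Bounds the change in the density of two rows when their first entries are exchanged. The cross
difference telescopes into two terms, each a difference of `r(·, y)` and `r(·, y')` times a density
in the other variable. That density integrates to one, and the two terms give the factor `2`. -/
lemma lintegral_cross_density_le (hr : Measurable (Function.uncurry r))
    (hr1 : ∀ y, ∫⁻ a, r a y ∂μ = 1) {κ : β → β → ℝ≥0∞} (hκ : Measurable (Function.uncurry κ)) :
    ∫⁻ q, κ q.1.2 q.2.2 * ‖(r q.1.1 q.1.2 : ℝ) * r q.2.1 q.2.2 - r q.2.1 q.1.2 * r q.1.1 q.2.2‖ₑ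
      ∂(μ.prod ν).prod (μ.prod ν) ≤
    2 * ∫⁻ y, ∫⁻ y', κ y y' * ∫⁻ a, ‖(r a y : ℝ) - r a y'‖ₑ ∂μ ∂ν ∂ν := by
  have hr' : ∀ y, Measurable fun a => (r a y : ℝ) := fun y =>
    measurable_coe_nnreal_real.comp (hr.comp measurable_prodMk_right)
  have hr2 : Measurable fun z : α × β => (r z.1 z.2 : ℝ) := measurable_coe_nnreal_real.comp hr
  have hκ2 : Measurable fun z : β × β => κ z.1 z.2 := hκ
  have hm : Measurable fun q : (α × β) × (α × β) => κ q.1.2 q.2.2 *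
      ‖(r q.1.1 q.1.2 : ℝ) * r q.2.1 q.2.2 - r q.2.1 q.1.2 * r q.1.1 q.2.2‖ₑ := by
    have h1 : Measurable fun q : (α × β) × (α × β) => κ q.1.2 q.2.2 :=
      hκ2.comp (by fun_prop : Measurable fun q : (α × β) × (α × β) => (q.1.2, q.2.2))
    have h2 : Measurable fun q : (α × β) × (α × β) => (r q.2.1 q.1.2 : ℝ) :=
      hr2.comp (by fun_prop : Measurable fun q : (α × β) × (α × β) => (q.2.1, q.1.2))
    have h3 : Measurable fun q : (α × β) × (α × β) => (r q.1.1 q.2.2 : ℝ) :=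
      hr2.comp (by fun_prop : Measurable fun q : (α × β) × (α × β) => (q.1.1, q.2.2))
    exact h1.mul (((hr2.comp measurable_fst).mul (hr2.comp measurable_snd)).sub (h2.mul h3)).enorm
  have hd : Measurable fun z : β × β => ∫⁻ a, ‖(r a z.1 : ℝ) - r a z.2‖ₑ ∂μ := by
    have : Measurable fun t : (β × β) × α => ‖(r t.2 t.1.1 : ℝ) - r t.2 t.1.2‖ₑ :=
      ((hr2.comp (by fun_prop : Measurable fun t : (β × β) × α => (t.2, t.1.1))).sub
        (hr2.comp (by fun_prop : Measurable fun t : (β × β) × α => (t.2, t.1.2)))).enorm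
    exact this.lintegral_prod_right'
  rw [lintegral_prod_prod hm]
  have h : ∀ y y', ∫⁻ a, ∫⁻ a', κ y y' *
      ‖(r a y : ℝ) * r a' y' - r a' y * r a y'‖ₑ ∂μ ∂μ ≤
      2 * (κ y y' * ∫⁻ a, ‖(r a y : ℝ) - r a y'‖ₑ ∂μ) := by
    intro y y'
    have he : ∀ y (a : α), ‖(r a y : ℝ)‖ₑ = r a y := by
      intro y a; simp [Real.enorm_eq_ofReal]
    have hs : Measurable fun a => ‖(r a y : ℝ) - r a y'‖ₑ := ((hr' y).sub (hr' y')).enorm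
    have hre : ∀ y, Measurable fun a => (r a y : ℝ≥0∞) := fun y => (hr.comp
      measurable_prodMk_right).coe_nnreal_ennreal
    calc ∫⁻ a, ∫⁻ a', κ y y' * ‖(r a y : ℝ) * r a' y' - r a' y * r a y'‖ₑ ∂μ ∂μ
        ≤ ∫⁻ a, ∫⁻ a', κ y y' * (‖(r a y : ℝ) - r a y'‖ₑ * r a' y' +
            r a y' * ‖(r a' y : ℝ) - r a' y'‖ₑ) ∂μ ∂μ := by
          gcongr with a a'
          have : (r a y : ℝ) * r a' y' - r a' y * r a y' =
            (r a y - r a y') * r a' y' - r a y' * (r a' y - r a' y') := by ring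
          rw [this]
          refine enorm_sub_le.trans ?_
          rw [enorm_mul, enorm_mul, he, he]
      _ = ∫⁻ a, κ y y' * (‖(r a y : ℝ) - r a y'‖ₑ +
            r a y' * ∫⁻ a', ‖(r a' y : ℝ) - r a' y'‖ₑ ∂μ) ∂μ := by
          refine lintegral_congr fun a => ?_
          rw [lintegral_const_mul _ (by fun_prop), lintegral_add_left (by fun_prop),
            lintegral_const_mul _ (hre _), lintegral_const_mul _ hs, hr1, mul_one]
      _ = 2 * (κ y y' * ∫⁻ a, ‖(r a y : ℝ) - r a y'‖ₑ ∂μ) := by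
          rw [lintegral_const_mul _ (by fun_prop), lintegral_add_left hs,
            lintegral_mul_const _ (hre _), hr1]
          ring
  calc _ ≤ ∫⁻ y, ∫⁻ y', 2 * (κ y y' * ∫⁻ a, ‖(r a y : ℝ) - r a y'‖ₑ ∂μ) ∂ν ∂ν := by
        gcongr with y y'; exact h y y'
    _ = _ := by
        have hκd := hκ2.mul hd
        rw [← lintegral_const_mul _ (by exact hκd.lintegral_prod_right')]
        refine lintegral_congr fun y => ?_
        rw [lintegral_const_mul _ (by exact hκd.comp measurable_prodMk_left)]

/-- If `G` is invariant under exchanging the first entries of a pair of independent rows, then it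
hardly correlates with the difference of the centred indicators of the rows, provided the rows are
weighted by a kernel concentrated near the diagonal. -/
lemma enorm_integral_pair_le (hr : Measurable (Function.uncurry r))
    (hr1 : ∀ y, ∫⁻ a, r a y ∂μ = 1) (hC : MeasurableSet C)
    {R : Measure (α × β)} [IsProbabilityMeasure R]
    (hR : R = (μ.prod ν).withDensity (fun z => (r z.1 z.2 : ℝ≥0∞)))
    {κ : β → β → ℝ} (hκ : Measurable (Function.uncurry κ)) (hκ0 : ∀ y y', 0 ≤ κ y y')
    {M : ℝ} (hκM : ∀ y y', κ y y' ≤ M)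
    {G : (α × β) × (α × β) → ℝ} (hG : Measurable G) (hG1 : ∀ q, |G q| ≤ 1)
    (hGs : ∀ q, G ((q.2.1, q.1.2), (q.1.1, q.2.2)) = G q) :
    ‖∫ q, G q * κ q.1.2 q.2.2 * (centred μ r C q.1 - centred μ r C q.2) ∂(R.prod R)‖ₑ ≤
      2 * ∫⁻ y, ∫⁻ y', ENNReal.ofReal (κ y y') * ∫⁻ a, ‖(r a y : ℝ) - r a y'‖ₑ ∂μ ∂ν ∂ν := by
  set δ := ∫⁻ y, ∫⁻ y', ENNReal.ofReal (κ y y') * ∫⁻ a, ‖(r a y : ℝ) - r a y'‖ₑ ∂μ ∂ν ∂ν with hδ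
  have hκ2 : Measurable fun z : β × β => κ z.1 z.2 := hκ
  have hκq : Measurable fun q : (α × β) × (α × β) => κ q.1.2 q.2.2 :=
    hκ2.comp (by fun_prop : Measurable fun q : (α × β) × (α × β) => (q.1.2, q.2.2))
  have hr2 : Measurable fun z : α × β => (r z.1 z.2 : ℝ) := measurable_coe_nnreal_real.comp hr
  have hr' : Measurable fun z : α × β => (r z.1 z.2 : ℝ≥0∞) := hr.coe_nnreal_ennreal
  have hcm : Measurable (condMass μ r C) := measurable_condMass hr
  have hi : Measurable (C.indicator fun _ => (1 : ℝ)) := measurable_const.indicator hC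
  set f1 : (α × β) × (α × β) → ℝ := fun q => G q * κ q.1.2 q.2.2 *
    (C.indicator (fun _ => (1 : ℝ)) q.1.1 - C.indicator (fun _ => (1 : ℝ)) q.2.1) with hf1
  set f2 : (α × β) × (α × β) → ℝ := fun q => G q * κ q.1.2 q.2.2 *
    (condMass μ r C q.1.2 - condMass μ r C q.2.2) with hf2
  have hf1m : Measurable f1 := (hG.mul hκq).mul
    ((hi.comp (measurable_fst.comp measurable_fst)).sub
      (hi.comp (measurable_fst.comp measurable_snd)))
  have hf2m : Measurable f2 := (hG.mul hκq).mul
    ((hcm.comp (measurable_snd.comp measurable_fst)).sub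
      (hcm.comp (measurable_snd.comp measurable_snd)))
  have hGκ : ∀ q (x : ℝ), |x| ≤ 1 → |G q * κ q.1.2 q.2.2 * x| ≤ M := by
    intro q x hx
    have h0 := hκ0 q.1.2 q.2.2
    rw [abs_mul, abs_mul, abs_of_nonneg h0]
    calc |G q| * κ q.1.2 q.2.2 * |x| ≤ 1 * κ q.1.2 q.2.2 * 1 := by
          gcongr; exact hG1 q
      _ ≤ M := by simpa using hκM _ _
  have hind : ∀ a a' : α,
      |C.indicator (fun _ => (1 : ℝ)) a - C.indicator (fun _ => (1 : ℝ)) a'| ≤ 1 := by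
    intro a a'
    by_cases h : a ∈ C <;> by_cases h' : a' ∈ C <;> simp [h, h']
  have hcd : ∀ y y', |condMass μ r C y - condMass μ r C y'| ≤ 1 := by
    intro y y'
    have h1 : condMass μ r C y ≤ 1 := condMass_le_one hr (hr1 y)
    have h2 : condMass μ r C y' ≤ 1 := condMass_le_one hr (hr1 y')
    have h3 : 0 ≤ condMass μ r C y := condMass_nonneg y
    have h4 : 0 ≤ condMass μ r C y' := condMass_nonneg y'
    rw [abs_le]; constructor <;> linarith
  have hf1i : Integrable f1 (R.prod R) :=
    Integrable.of_bound hf1m.aestronglyMeasurable M (ae_of_all _ fun q => hGκ q _ (hind _ _))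
  have hf2i : Integrable f2 (R.prod R) :=
    Integrable.of_bound hf2m.aestronglyMeasurable M (ae_of_all _ fun q => hGκ q _ (hcd _ _))
  -- The indicator part `f1` is handled by the exchange of first entries. The conditional-mass part
  -- `f2` is small directly, being bounded by the `L¹` distance of the densities. Each contributes
  -- `δ`.
  have hsplit : ∫ q, G q * κ q.1.2 q.2.2 * (centred μ r C q.1 - centred μ r C q.2) ∂(R.prod R) =
      ∫ q, f1 q ∂(R.prod R) - ∫ q, f2 q ∂(R.prod R) := by
    rw [← integral_sub hf1i hf2i]
    refine integral_congr_ae (ae_of_all _ fun q => ?_)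
    simp only [centred, hf1, hf2]
    ring
  have hI2 : ‖∫ q, f2 q ∂(R.prod R)‖ₑ ≤ δ := by
    have hh : Measurable fun z : β × β => ENNReal.ofReal (κ z.1 z.2) *
        ‖condMass μ r C z.1 - condMass μ r C z.2‖ₑ :=
      hκ2.ennreal_ofReal.mul ((hcm.comp measurable_fst).sub (hcm.comp measurable_snd)).enorm
    calc ‖∫ q, f2 q ∂(R.prod R)‖ₑ ≤ ∫⁻ q, ‖f2 q‖ₑ ∂(R.prod R) := enorm_integral_le_lintegral_enorm _
      _ ≤ ∫⁻ q, ENNReal.ofReal (κ q.1.2 q.2.2) *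
          ‖condMass μ r C q.1.2 - condMass μ r C q.2.2‖ₑ ∂(R.prod R) := by
        refine lintegral_mono fun q => ?_
        simp only [hf2, enorm_mul]
        gcongr
        rw [← Real.enorm_of_nonneg (hκ0 _ _)]
        refine mul_le_of_le_one_left' ?_
        rw [Real.enorm_eq_ofReal_abs]
        exact ENNReal.ofReal_le_one.2 (hG1 q)
      _ = ∫⁻ y, ∫⁻ y', ENNReal.ofReal (κ y y') *
          ‖condMass μ r C y - condMass μ r C y'‖ₑ ∂ν ∂ν := by
        rw [lintegral_prod _ (by
          exact (hh.comp (by fun_prop : Measurable fun q : (α × β) × (α × β) =>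
            (q.1.2, q.2.2))).aemeasurable), hR]
        rw [← lintegral_withDensity_snd hr hr1 (by exact hh.lintegral_prod_right')]
        refine lintegral_congr fun z => ?_
        exact lintegral_withDensity_snd hr hr1 (f := fun y' => ENNReal.ofReal (κ z.2 y') *
          ‖condMass μ r C z.2 - condMass μ r C y'‖ₑ) (hh.comp measurable_prodMk_left)
      _ ≤ δ := by
        rw [hδ]
        gcongr with y y'
        exact enorm_condMass_sub_le hr hr1 y y'
  have hI1 : ‖∫ q, f1 q ∂(R.prod R)‖ₑ ≤ δ := by
    set ρ := (μ.prod ν).prod (μ.prod ν) with hρ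
    have hRR : R.prod R = ρ.withDensity
        fun q => ((r q.1.1 q.1.2 * r q.2.1 q.2.2 : ℝ≥0) : ℝ≥0∞) := by
      rw [hR]
      have : SFinite ((μ.prod ν).withDensity (fun z => (r z.1 z.2 : ℝ≥0∞))) := inferInstance
      rw [prod_withDensity hr' hr']
      simp only [ENNReal.coe_mul, hρ]
    have hrr : Measurable fun q : (α × β) × (α × β) => r q.1.1 q.1.2 * r q.2.1 q.2.2 :=
      (hr.comp measurable_fst).mul (hr.comp measurable_snd)
    have hT := measurePreserving_swap_fst μ ν
    set T := fun q : (α × β) × (α × β) => ((q.2.1, q.1.2), (q.1.1, q.2.2)) with hTdef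
    have hTe : MeasurableEmbedding T := by
      let e : (α × β) × (α × β) ≃ᵐ (α × β) × (α × β) :=
        { toFun := T, invFun := T, left_inv := fun _ => rfl, right_inv := fun _ => rfl
          measurable_toFun := hT.measurable, measurable_invFun := hT.measurable }
      exact e.measurableEmbedding
    have hint : Integrable (fun q => (r q.1.1 q.1.2 * r q.2.1 q.2.2) • f1 q) ρ := by
      rw [hRR] at hf1i
      exact (integrable_withDensity_iff_integrable_smul hrr).1 hf1i
    have hintT := (hT.integrable_comp_emb hTe).2 hint
    have heq : ∫ q, f1 q ∂(R.prod R) = ∫ q, (r q.1.1 q.1.2 * r q.2.1 q.2.2) • f1 q ∂ρ := by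
      rw [hRR, integral_withDensity_eq_integral_smul hrr]
    have heqT := hT.integral_comp hTe (fun q => (r q.1.1 q.1.2 * r q.2.1 q.2.2) • f1 q)
    -- `f1` is antisymmetric under `T`: `G` and the kernel weight are invariant and the indicator
    -- difference changes sign. Adding the integral to its image under `T` therefore leaves only the
    -- difference of the two densities.
    have htwo : 2 * ∫ q, f1 q ∂(R.prod R) = ∫ q, f1 q *
        ((r q.1.1 q.1.2 : ℝ) * r q.2.1 q.2.2 - r q.2.1 q.1.2 * r q.1.1 q.2.2) ∂ρ := by
      rw [two_mul, heq]
      nth_rewrite 2 [← heqT]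
      rw [← integral_add hint (by exact hintT)]
      refine integral_congr_ae (ae_of_all _ fun q => ?_)
      simp only [hf1, hTdef, NNReal.smul_def, smul_eq_mul, NNReal.coe_mul, hGs]
      ring
    have h2 : ‖(2 : ℝ) * ∫ q, f1 q ∂(R.prod R)‖ₑ ≤ 2 * δ := by
      rw [htwo]
      refine (enorm_integral_le_lintegral_enorm _).trans (le_trans ?_
        (lintegral_cross_density_le hr hr1 (κ := fun y y' => ENNReal.ofReal (κ y y'))
          hκ.ennreal_ofReal))
      refine lintegral_mono fun q => ?_
      rw [enorm_mul]
      gcongr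
      rw [Real.enorm_eq_ofReal_abs]
      refine ENNReal.ofReal_le_ofReal ?_
      simp only [hf1]
      rw [abs_mul, abs_mul, abs_of_nonneg (hκ0 _ _)]
      calc |G q| * κ q.1.2 q.2.2 * |_| ≤ 1 * κ q.1.2 q.2.2 * 1 := by
            have := hκ0 q.1.2 q.2.2
            gcongr
            · exact hG1 q
            · exact hind _ _
        _ = κ q.1.2 q.2.2 := by ring
    rw [enorm_mul] at h2
    have h22 : ‖(2 : ℝ)‖ₑ = 2 := by simp [Real.enorm_eq_ofReal]
    rw [h22] at h2
    exact (ENNReal.mul_le_mul_iff_right (by simp) (by simp)).1 h2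
  rw [hsplit, two_mul]
  exact enorm_sub_le.trans (add_le_add hI1 hI2)

end pair

/-! ### Symmetric functions of a sample -/

section resample

variable {ι Z : Type*} [Fintype ι] [DecidableEq ι] [MeasurableSpace Z] (R : Measure Z)
  [IsProbabilityMeasure R]

/-- In an i.i.d. sample, overwriting one row by a fresh independent copy does not change the law. -/
lemma measurePreserving_update (i : ι) :
    MeasurePreserving (fun t : (ι → Z) × Z => Function.update t.1 i t.2)
      ((Measure.pi fun _ => R).prod R) (Measure.pi fun _ => R) := by
  have hm : Measurable (fun t : (ι → Z) × Z => Function.update t.1 i t.2) := by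
    refine measurable_pi_iff.2 fun j => ?_
    by_cases h : j = i
    · subst h; simpa using measurable_snd
    · simp only [Function.update_of_ne h]; fun_prop
  refine ⟨hm, (Measure.pi_eq fun s hs => ?_).symm⟩
  rw [Measure.map_apply hm (MeasurableSet.univ_pi hs)]
  have : (fun t : (ι → Z) × Z => Function.update t.1 i t.2) ⁻¹' Set.univ.pi s =
      (Set.univ.pi (Function.update s i Set.univ)) ×ˢ s i := by
    ext ⟨z, u⟩
    simp only [Set.mem_preimage, Set.mem_pi, Set.mem_univ, true_imp_iff, Set.mem_prod]
    constructor
    · intro h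
      refine ⟨fun j => ?_, by simpa using h i⟩
      by_cases hj : j = i
      · subst hj; simp
      · simpa [Function.update_of_ne hj] using h j
    · rintro ⟨h, hu⟩ j
      by_cases hj : j = i
      · subst hj; simpa using hu
      · simpa [Function.update_of_ne hj] using h j
  rw [this, Measure.prod_prod, Measure.pi_pi, ← Finset.prod_erase_mul _ _ (Finset.mem_univ i),
    ← Finset.prod_erase_mul Finset.univ (fun i => R (s i)) (Finset.mem_univ i)]
  congr 1
  simp only [Function.update_self, measure_univ, mul_one]
  refine Finset.prod_congr rfl fun j hj => ?_
  rw [Function.update_of_ne (Finset.ne_of_mem_erase hj)]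

/-- Lets a two-row estimate be applied with all other rows frozen. -/
lemma integral_pi_resample_pair (i j : ι) {F : (ι → Z) → ℝ} (hF : Measurable F) {M : ℝ}
    (hFM : ∀ z, |F z| ≤ M) :
    ∫ z, F z ∂(Measure.pi fun _ => R) =
      ∫ z, ∫ q, F (Function.update (Function.update z i q.1) j q.2) ∂(R.prod R)
        ∂(Measure.pi fun _ => R) := by
  have h1 := measurePreserving_update R i
  have h2 := measurePreserving_update R j
  have h3 := (h2.comp (h1.prod (MeasurePreserving.id R))).comp
    ((measurePreserving_prodAssoc (Measure.pi fun _ : ι => R) R R).symm)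
  have h4 := integral_map (f := F) (μ := (Measure.pi fun _ : ι => R).prod (R.prod R)) h3.measurable.aemeasurable hF.aestronglyMeasurable
  rw [h3.map_eq] at h4
  rw [h4, integral_prod]
  · rfl
  · exact Integrable.of_bound (hF.comp h3.measurable).aestronglyMeasurable M
      (ae_of_all _ fun z => hFM _)

end resample

/-! ### Moment bounds for averages over the sample -/

/-- Given row `0`, the summands are i.i.d., centred and bounded by `B`, so the variance of their sum
is at most `n * B ^ 2`. -/
lemma integral_sq_average_le {Z : Type*} [MeasurableSpace Z] (R : Measure Z)
    [IsProbabilityMeasure R] {φ : Z → Z → ℝ} (hφ : Measurable (Function.uncurry φ)) {B : ℝ}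
    (hφB : ∀ u v, |φ u v| ≤ B) (hφ0 : ∀ u, ∫ v, φ u v ∂ R = 0) {n : ℕ} (hn : 0 < n) :
    ∫ z : Fin (n + 1) → Z, ((∑ j : Fin n, φ (z 0) (z j.succ)) / n) ^ 2 ∂(Measure.pi fun _ => R) ≤
      B ^ 2 / n := by
  have hφ2 : Measurable fun z : Z × Z => φ z.1 z.2 := hφ
  have hφu : ∀ u, Measurable (φ u) := fun u => hφ2.comp measurable_prodMk_left
  have hB : 0 ≤ B := by
    obtain ⟨z⟩ : Nonempty Z := (inferInstance : NeZero R).1 |> fun h => by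
      by_contra h'
      rw [not_nonempty_iff] at h'
      exact h (Measure.eq_zero_of_isEmpty R)
    exact (abs_nonneg _).trans (hφB z z)
  have hn' : (0 : ℝ) < n := by exact_mod_cast hn
  set F : Z × (Fin n → Z) → ℝ := fun t => ((∑ j : Fin n, φ t.1 (t.2 j)) / n) ^ 2 with hF
  have hFm : Measurable F := by
    refine ((Finset.measurable_sum _ fun j _ => ?_).div_const _).pow_const 2
    exact hφ2.comp (by fun_prop : Measurable fun t : Z × (Fin n → Z) => (t.1, t.2 j))
  have hFB : ∀ t, |F t| ≤ B ^ 2 := by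
    intro t
    simp only [hF, abs_pow]
    gcongr
    rw [abs_div, Nat.abs_cast, div_le_iff₀ hn']
    calc |∑ j : Fin n, φ t.1 (t.2 j)| ≤ ∑ j : Fin n, |φ t.1 (t.2 j)| :=
          Finset.abs_sum_le_sum_abs _ _
      _ ≤ ∑ _j : Fin n, B := Finset.sum_le_sum fun j _ => hφB _ _
      _ = B * n := by simp [mul_comm]
  have hmp := measurePreserving_piFinSuccAbove (fun _ : Fin (n + 1) => R) 0
  have h1 : ∫ z : Fin (n + 1) → Z, ((∑ j : Fin n, φ (z 0) (z j.succ)) / n) ^ 2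
      ∂(Measure.pi fun _ => R) = ∫ t, F t ∂(R.prod (Measure.pi fun _ => R)) := by
    rw [← hmp.integral_comp']
    rfl
  rw [h1, integral_prod _ (Integrable.of_bound hFm.aestronglyMeasurable (B ^ 2)
    (ae_of_all _ fun t => hFB t))]
  have h2 : ∀ u, ∫ w, F (u, w) ∂(Measure.pi fun _ : Fin n => R) ≤ B ^ 2 / n := by
    intro u
    have hL : ∀ _ : Fin n, MemLp (φ u) 2 R := fun _ =>
      MemLp.of_bound (hφu u).aestronglyMeasurable B (ae_of_all _ fun v => hφB u v)
    have hL1 : Integrable (φ u) R := Integrable.of_bound (hφu u).aestronglyMeasurable B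
      (ae_of_all _ fun v => hφB u v)
    have hvar := variance_sum_pi (μ := fun _ : Fin n => R) (X := fun _ => φ u) hL
    have hzero : ∫ w : Fin n → Z, (∑ j, fun w : Fin n → Z => φ u (w j)) w
        ∂(Measure.pi fun _ => R) = 0 := by
      simp only [Finset.sum_apply]
      rw [integral_finsetSum]
      · refine Finset.sum_eq_zero fun j _ => ?_
        rw [integral_comp_eval (μ := fun _ : Fin n => R) (i := j) (f := φ u)
          (hφu u).aestronglyMeasurable, hφ0]
      · intro j _
        exact Integrable.of_bound ((hφu u).comp (measurable_pi_apply j)).aestronglyMeasurable B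
          (ae_of_all _ fun v => hφB u _)
    rw [variance_of_integral_eq_zero _ hzero] at hvar
    · have hv1 : ∀ _ : Fin n, Var[φ u; R] ≤ B ^ 2 := by
        intro _
        rw [variance_of_integral_eq_zero (hφu u).aemeasurable (hφ0 u)]
        calc ∫ v, φ u v ^ 2 ∂ R ≤ ∫ _v, B ^ 2 ∂ R := by
              refine integral_mono_of_nonneg (ae_of_all _ fun v => sq_nonneg _)
                (integrable_const _) (ae_of_all _ fun v => ?_)
              exact sq_le_sq' (by have := neg_le_of_abs_le (hφB u v); linarith)
                (le_of_abs_le (hφB u v))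
          _ = B ^ 2 := by simp
      have hF2 : ∀ w, F (u, w) = ((n : ℝ) ^ 2)⁻¹ *
          ((∑ j, fun w : Fin n → Z => φ u (w j)) w) ^ 2 := by
        intro w
        simp only [hF, Finset.sum_apply, div_pow]
        ring
      simp only [hF2]
      rw [integral_const_mul, hvar]
      calc ((n : ℝ) ^ 2)⁻¹ * ∑ _i : Fin n, Var[φ u; R] ≤ ((n : ℝ) ^ 2)⁻¹ * ∑ _i : Fin n, B ^ 2 := by
            gcongr with i; exact hv1 i
        _ = B ^ 2 / n := by
            simp only [Finset.sum_const, Finset.card_univ, Fintype.card_fin, nsmul_eq_mul]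
            field_simp
    · simp only [Finset.sum_fn]
      exact (Finset.measurable_sum _ fun j _ =>
        (hφu u).comp (measurable_pi_apply j)).aemeasurable
  calc ∫ u, ∫ w, F (u, w) ∂(Measure.pi fun _ : Fin n => R) ∂ R ≤ ∫ _u, B ^ 2 / n ∂ R := by
        refine integral_mono_of_nonneg (ae_of_all _ fun u => ?_) (integrable_const _)
          (ae_of_all _ h2)
        exact integral_nonneg fun w => sq_nonneg _
    _ = B ^ 2 / n := by simp

/-- Integrates the pointwise bound `|x| ≤ t + x ^ 2 / t`. The free parameter `t` replaces the square
root of the Cauchy–Schwarz bound. -/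
lemma integral_abs_le_of_integral_sq_le {Ω : Type*} [MeasurableSpace Ω] {P : Measure Ω}
    [IsProbabilityMeasure P] {f : Ω → ℝ} (hf : Integrable (fun ω => f ω ^ 2) P) {t V : ℝ}
    (ht : 0 < t) (hV : ∫ ω, f ω ^ 2 ∂P ≤ V) : ∫ ω, |f ω| ∂P ≤ t + V / t := by
  calc ∫ ω, |f ω| ∂P ≤ ∫ ω, (t + f ω ^ 2 / t) ∂P := by
        refine integral_mono_of_nonneg (ae_of_all _ fun ω => abs_nonneg _)
          ((integrable_const t).add (hf.div_const t)) (ae_of_all _ fun ω => ?_)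
        simp only
        rw [← sq_abs (f ω), ← sub_nonneg]
        have h1 : t + |f ω| ^ 2 / t - |f ω| = ((|f ω| - t / 2) ^ 2 + 3 * t ^ 2 / 4) / t := by
          field_simp; ring
        rw [h1]; positivity
    _ = t + (∫ ω, f ω ^ 2 ∂P) / t := by
        rw [integral_add (integrable_const t) (hf.div_const t), integral_div]; simp
    _ ≤ t + V / t := by gcongr

/-! ### Invariance under permutations of the first entries -/

/-- Permute the first entries of a sample of pairs. -/
def permFst {n : ℕ} (σ : Equiv.Perm (Fin n)) (z : Fin n → α × β) : Fin n → α × β :=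
  fun i => ((z (σ i)).1, (z i).2)

/-- Translates invariance under `permFst` into the two-row symmetry that `enorm_integral_pair_le`
requires of `G`. -/
lemma permFst_swap_update {n : ℕ} {i j : Fin n} (hij : i ≠ j) (z : Fin n → α × β)
    (u v : α × β) :
    permFst (Equiv.swap i j) (Function.update (Function.update z i u) j v) =
      Function.update (Function.update z i (v.1, u.2)) j (u.1, v.2) := by
  ext k : 1
  by_cases hk : k = i
  · subst hk; simp [permFst, hij]
  · by_cases hk' : k = j
    · subst hk'; simp [permFst, hij]
    · simp [permFst, Equiv.swap_apply_of_ne_of_ne hk hk', hk, hk']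

/-- In large samples, functions of the sample that are invariant under permutations of the first
entries are asymptotically uncorrelated, uniformly, with the centred indicator of one row. -/
theorem exists_abs_integral_symm_mul_centred_le {μ : Measure α} {ν : Measure β}
    [IsProbabilityMeasure μ] [IsProbabilityMeasure ν] {r : α → β → ℝ≥0} {C : Set α}
    (hr : Measurable (Function.uncurry r)) (hr1 : ∀ y, ∫⁻ a, r a y ∂μ = 1)
    (hC : MeasurableSet C) {R : Measure (α × β)} [IsProbabilityMeasure R]
    (hR : R = (μ.prod ν).withDensity (fun z => (r z.1 z.2 : ℝ≥0∞))) {ε : ℝ} (hε : 0 < ε) :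
    ∃ N : ℕ, ∀ n ≥ N, ∀ g : (Fin (n + 1) → α × β) → ℝ, Measurable g → (∀ z, |g z| ≤ 1) →
      (∀ σ z, g (permFst σ z) = g z) →
      |∫ z, g z * centred μ r C (z 0) ∂(Measure.pi fun _ => R)| ≤ ε := by
  -- Error budget: `ε / 4` for the kernel becomes `ε / 2` after the factor `2` of the exchange. The
  -- two averages `ψ₁` and `ψ₂` cost `ε / 4` each.
  obtain ⟨M, κ, hκ, hκ0, hκM, hκ1, hδ⟩ := exists_smoothing_kernel μ ν hr hr1
    (ε := ENNReal.ofReal (ε / 4)) (ENNReal.ofReal_pos.2 (by positivity))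
  have hM : 0 ≤ M := by
    have hne : Nonempty β := by
      by_contra h'
      rw [not_nonempty_iff] at h'
      exact (inferInstance : NeZero ν).1 (Measure.eq_zero_of_isEmpty ν)
    obtain ⟨y⟩ := hne
    exact (hκ0 y y).trans (hκM y y)
  -- This makes `V / t ≤ t` for `t = ε / 8` and `V = (M + 1) ^ 2 / n`, so each average has mean
  -- absolute value at most `ε / 4`. Starting at `N + 1` ensures `n > 0`.
  obtain ⟨N, hN⟩ := exists_nat_gt ((M + 1) ^ 2 / (ε / 8) ^ 2)
  refine ⟨N + 1, fun n hn g hg hg1 hgs => ?_⟩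
  have hn0 : 0 < n := by omega
  have hn' : (0 : ℝ) < n := by exact_mod_cast hn0
  have hnV : (M + 1) ^ 2 / n / (ε / 8) ≤ ε / 8 := by
    have h1 : (M + 1) ^ 2 / (ε / 8) ^ 2 ≤ n :=
      hN.le.trans (by exact_mod_cast (Nat.le_succ N).trans hn)
    rw [div_le_iff₀ (by positivity)] at h1
    rw [div_div, div_le_iff₀ (by positivity)]
    nlinarith
  set P := Measure.pi fun _ : Fin (n + 1) => R with hP
  set ξ := centred μ r C with hξ
  have hξm : Measurable ξ := measurable_centred hr hC
  have hξ1 : ∀ z, |ξ z| ≤ 1 := abs_centred_le_one hr hr1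
  have hκ2 : Measurable fun z : β × β => κ z.1 z.2 := hκ
  have hκabs : ∀ y y', |κ y y'| ≤ M := fun y y' => (abs_of_nonneg (hκ0 y y')).trans_le (hκM y y')
  have hκq : Measurable fun q : (α × β) × (α × β) => κ q.1.2 q.2.2 :=
    hκ2.comp (by fun_prop : Measurable fun q : (α × β) × (α × β) => (q.1.2, q.2.2))
  -- the two averages
  set φ₁ : α × β → α × β → ℝ := fun u v => 1 - κ u.2 v.2 with hφ₁
  set φ₂ : α × β → α × β → ℝ := fun u v => κ u.2 v.2 * ξ v with hφ₂
  have hφ₁m : Measurable (Function.uncurry φ₁) := measurable_const.sub hκq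
  have hφ₂m : Measurable (Function.uncurry φ₂) := hκq.mul (hξm.comp measurable_snd)
  have hφ₁B : ∀ u v, |φ₁ u v| ≤ M + 1 := by
    intro u v
    rw [hφ₁, abs_le]
    constructor <;> linarith [hκ0 u.2 v.2, hκM u.2 v.2]
  have hφ₂B : ∀ u v, |φ₂ u v| ≤ M + 1 := by
    intro u v
    rw [hφ₂, abs_mul]
    nlinarith [hκabs u.2 v.2, hξ1 v, abs_nonneg (κ u.2 v.2), abs_nonneg (ξ v)]
  have hκsnd : ∀ y, Measurable (κ y) := fun y => hκ2.comp measurable_prodMk_left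
  have hκint : ∀ y, Integrable (fun v : α × β => κ y v.2) R := fun y =>
    Integrable.of_bound ((hκsnd y).comp measurable_snd).aestronglyMeasurable M
      (ae_of_all _ fun v => hκabs _ _)
  have hφ₁0 : ∀ u, ∫ v, φ₁ u v ∂ R = 0 := by
    intro u
    have hmap : R.map Prod.snd = ν := by
      ext s hs
      rw [Measure.map_apply measurable_snd hs, ← lintegral_indicator_one hs,
        ← lintegral_indicator_one (measurable_snd hs), hR,
        ← lintegral_withDensity_snd hr hr1 (measurable_one.indicator hs)]
      rfl
    have h1 : ∫ v, κ u.2 v.2 ∂ R = 1 := by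
      rw [← hκ1 u.2, ← hmap, integral_map measurable_snd.aemeasurable
        (hκsnd _).aestronglyMeasurable]
    simp only [hφ₁]
    rw [integral_sub (integrable_const _) (hκint _), h1]
    simp
  have hφ₂0 : ∀ u, ∫ v, φ₂ u v ∂ R = 0 := by
    intro u
    subst hR
    exact integral_mul_centred hr hr1 hC (hκsnd u.2) (hκabs u.2)
  set ψ₁ : (Fin (n + 1) → α × β) → ℝ := fun z => (∑ j : Fin n, φ₁ (z 0) (z j.succ)) / n with hψ₁
  set ψ₂ : (Fin (n + 1) → α × β) → ℝ := fun z => (∑ j : Fin n, φ₂ (z 0) (z j.succ)) / n with hψ₂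
  have hψm : ∀ φ : α × β → α × β → ℝ, Measurable (Function.uncurry φ) →
      Measurable fun z : Fin (n + 1) → α × β => (∑ j : Fin n, φ (z 0) (z j.succ)) / n := by
    intro φ hφ
    refine (Finset.measurable_sum _ fun j _ => ?_).div_const _
    exact hφ.comp (by fun_prop : Measurable fun z : Fin (n + 1) → α × β => (z 0, z j.succ))
  have hψB : ∀ φ : α × β → α × β → ℝ, (∀ u v, |φ u v| ≤ M + 1) → ∀ z : Fin (n + 1) → α × β,
      |(∑ j : Fin n, φ (z 0) (z j.succ)) / n| ≤ M + 1 := by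
    intro φ hφ z
    rw [abs_div, Nat.abs_cast, div_le_iff₀ hn']
    calc |∑ j : Fin n, φ (z 0) (z j.succ)| ≤ ∑ j : Fin n, |φ (z 0) (z j.succ)| :=
          Finset.abs_sum_le_sum_abs _ _
      _ ≤ ∑ _j : Fin n, (M + 1) := Finset.sum_le_sum fun j _ => hφ _ _
      _ = (M + 1) * n := by simp; ring
  have hψabs : ∀ φ : α × β → α × β → ℝ, Measurable (Function.uncurry φ) →
      (∀ u v, |φ u v| ≤ M + 1) → (∀ u, ∫ v, φ u v ∂ R = 0) →
      ∫ z : Fin (n + 1) → α × β, |(∑ j : Fin n, φ (z 0) (z j.succ)) / n| ∂P ≤ ε / 4 := by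
    intro φ hφ hφB hφ0
    have := integral_abs_le_of_integral_sq_le (P := P)
      (f := fun z : Fin (n + 1) → α × β => (∑ j : Fin n, φ (z 0) (z j.succ)) / n)
      (Integrable.of_bound ((hψm φ hφ).pow_const 2).aestronglyMeasurable ((M + 1) ^ 2)
        (ae_of_all _ fun z => by
          rw [Real.norm_eq_abs, abs_pow]
          exact pow_le_pow_left₀ (abs_nonneg _) (hψB φ hφB z) 2))
      (t := ε / 8) (by positivity) (integral_sq_average_le R hφ hφB hφ0 hn0)
    linarith
  have hψ₁i : Integrable ψ₁ P := Integrable.of_bound (hψm φ₁ hφ₁m).aestronglyMeasurable (M + 1)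
    (ae_of_all _ fun z => hψB φ₁ hφ₁B z)
  have hψ₂i : Integrable ψ₂ P := Integrable.of_bound (hψm φ₂ hφ₂m).aestronglyMeasurable (M + 1)
    (ae_of_all _ fun z => hψB φ₂ hφ₂B z)
  have hb : ∀ {f : (Fin (n + 1) → α × β) → ℝ} {h : (Fin (n + 1) → α × β) → ℝ}, Integrable f P →
      Measurable h → (∀ z, |h z| ≤ 1) → Integrable (fun z => h z * f z) P := by
    intro f h hf hh hh1
    exact hf.bdd_mul hh.aestronglyMeasurable (ae_of_all _ hh1)
  have hbound : ∀ {f h : (Fin (n + 1) → α × β) → ℝ}, Integrable f P → (∀ z, |h z| ≤ 1) →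
      |∫ z, h z * f z ∂P| ≤ ∫ z, |f z| ∂P := by
    intro f h hf hh1
    refine (abs_integral_le_integral_abs).trans (integral_mono_of_nonneg
      (ae_of_all _ fun z => abs_nonneg _) hf.abs (ae_of_all _ fun z => ?_))
    simp only [abs_mul]
    exact mul_le_of_le_one_left (abs_nonneg _) (hh1 z)
  have hz0 : Measurable fun z : Fin (n + 1) → α × β => ξ (z 0) :=
    hξm.comp (measurable_pi_apply 0)
  have hgξ1 : ∀ z : Fin (n + 1) → α × β, |g z * ξ (z 0)| ≤ 1 := by
    intro z
    rw [abs_mul]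
    exact mul_le_one₀ (hg1 z) (abs_nonneg _) (hξ1 _)
  -- one exchange
  set H : Fin n → (Fin (n + 1) → α × β) → ℝ := fun j z =>
    g z * κ (z 0).2 (z j.succ).2 * (ξ (z 0) - ξ (z j.succ)) with hH
  have hHm : ∀ j, Measurable (H j) := by
    intro j
    refine (hg.mul (hκ2.comp (by fun_prop :
      Measurable fun z : Fin (n + 1) → α × β => ((z 0).2, (z j.succ).2)))).mul
      (hz0.sub (hξm.comp (measurable_pi_apply _)))
  have hHB : ∀ j z, |H j z| ≤ M * 2 := by
    intro j z
    simp only [hH, abs_mul]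
    have h1 := hκabs (z 0).2 (z j.succ).2
    have h2 : |ξ (z 0) - ξ (z j.succ)| ≤ 2 := by
      have h3 := abs_le.1 (hξ1 (z 0)); have h4 := abs_le.1 (hξ1 (z j.succ))
      rw [abs_le]; constructor <;> linarith
    calc |g z| * |κ (z 0).2 (z j.succ).2| * |ξ (z 0) - ξ (z j.succ)| ≤ 1 * M * 2 := by
          gcongr; exact hg1 z
      _ = M * 2 := by ring
  have hHi : ∀ j, Integrable (H j) P := fun j =>
    Integrable.of_bound (hHm j).aestronglyMeasurable (M * 2) (ae_of_all _ fun z => hHB j z)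
  have hHle : ∀ j, |∫ z, H j z ∂P| ≤ ε / 2 := by
    intro j
    have h0j : (0 : Fin (n + 1)) ≠ j.succ := (Fin.succ_ne_zero j).symm
    rw [hP, integral_pi_resample_pair R 0 j.succ (hHm j) (hHB j), ← Real.norm_eq_abs]
    refine (norm_integral_le_of_norm_le_const (C := ε / 2) (ae_of_all _ fun z => ?_)).trans
      (by simp)
    have hup : Measurable fun q : (α × β) × (α × β) =>
        Function.update (Function.update z 0 q.1) j.succ q.2 := by
      refine measurable_pi_iff.2 fun k => ?_
      by_cases hk : k = j.succ
      · subst hk; simpa using measurable_snd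
      · simp only [Function.update_of_ne hk]
        by_cases hk0 : k = 0
        · subst hk0; simpa using measurable_fst
        · simp only [Function.update_of_ne hk0]; fun_prop
    have hpair := enorm_integral_pair_le hr hr1 hC hR hκ hκ0 hκM
      (G := fun q => g (Function.update (Function.update z 0 q.1) j.succ q.2))
      (hg.comp hup) (fun q => hg1 _) (fun q => by
        rw [← hgs (Equiv.swap 0 j.succ) (Function.update (Function.update z 0 q.1) j.succ q.2),
          permFst_swap_update h0j])
    have hle : ‖∫ q, H j (Function.update (Function.update z 0 q.1) j.succ q.2) ∂(R.prod R)‖ₑ ≤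
        ENNReal.ofReal (ε / 2) := by
      refine le_trans (le_of_eq ?_) (hpair.trans ((mul_le_mul_right hδ 2).trans_eq ?_))
      · congr 1
        refine integral_congr_ae (ae_of_all _ fun q => ?_)
        simp only [hH, Function.update_self, Function.update_of_ne h0j]
        rfl
      · rw [← ENNReal.ofReal_ofNat, ← ENNReal.ofReal_mul (by norm_num)]
        congr 1; ring
    rw [← ofReal_norm] at hle
    exact (ENNReal.ofReal_le_ofReal_iff (by positivity)).1 hle
  -- The three terms are the deviation of the average kernel weight from `1`, the averaged cost of
  -- exchanging row `0` with another row, and a kernel average of centred terms.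
  have hdecomp : ∀ z, g z * ξ (z 0) =
      (g z * ξ (z 0)) * ψ₁ z + ((∑ j, H j z) / n + g z * ψ₂ z) := by
    intro z
    have h1 : ψ₁ z = 1 - (∑ j : Fin n, κ (z 0).2 (z j.succ).2) / n := by
      simp only [hψ₁, hφ₁, Finset.sum_sub_distrib, Finset.sum_const, Finset.card_univ,
        Fintype.card_fin, nsmul_eq_mul, mul_one]
      field_simp
    have h2 : ∑ j, H j z = g z * ξ (z 0) * (∑ j : Fin n, κ (z 0).2 (z j.succ).2) -
        g z * ∑ j : Fin n, κ (z 0).2 (z j.succ).2 * ξ (z j.succ) := by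
      rw [Finset.mul_sum, Finset.mul_sum, ← Finset.sum_sub_distrib]
      refine Finset.sum_congr rfl fun j _ => ?_
      simp only [hH]; ring
    rw [h1, h2]
    simp only [hψ₂, hφ₂]
    ring
  have hHsum : |∫ z, (∑ j, H j z) / n ∂P| ≤ ε / 2 := by
    rw [integral_div, integral_finsetSum _ fun j _ => hHi j, abs_div, Nat.abs_cast,
      div_le_iff₀ hn']
    calc |∑ j, ∫ z, H j z ∂P| ≤ ∑ j, |∫ z, H j z ∂P| := Finset.abs_sum_le_sum_abs _ _
      _ ≤ ∑ _j : Fin n, ε / 2 := Finset.sum_le_sum fun j _ => hHle j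
      _ = ε / 2 * n := by simp [mul_comm]
  have hi1 : Integrable (fun z => (g z * ξ (z 0)) * ψ₁ z) P := hb hψ₁i (hg.mul hz0) hgξ1
  have hi2 : Integrable (fun z => (∑ j, H j z) / n) P :=
    (integrable_finsetSum _ fun j _ => hHi j).div_const _
  have hi3 : Integrable (fun z => g z * ψ₂ z) P := hb hψ₂i hg hg1
  have hi23 : Integrable (fun z => (∑ j, H j z) / n + g z * ψ₂ z) P := hi2.add hi3
  have heq : ∫ z, g z * ξ (z 0) ∂P = ∫ z, (g z * ξ (z 0)) * ψ₁ z ∂P +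
      (∫ z, (∑ j, H j z) / n ∂P + ∫ z, g z * ψ₂ z ∂P) := by
    rw [← integral_add hi2 hi3, ← integral_add hi1 hi23]
    exact integral_congr_ae (ae_of_all _ hdecomp)
  have e1 := (hbound hψ₁i hgξ1).trans (hψabs φ₁ hφ₁m hφ₁B hφ₁0)
  have e3 := (hbound hψ₂i hg1).trans (hψabs φ₂ hφ₂m hφ₂B hφ₂0)
  rw [heq]
  rw [abs_le] at *
  constructor <;> linarith [e1.1, e1.2, e3.1, e3.2, hHsum.1, hHsum.2]

/-! ### Densities with respect to the product of the marginals -/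

lemma snd_withDensity_prod {μ : Measure α} {ν : Measure β} [SFinite μ] [SFinite ν]
    {f : α × β → ℝ≥0∞} (hf : Measurable f) :
    ((μ.prod ν).withDensity f).snd = ν.withDensity fun y => ∫⁻ a, f (a, y) ∂μ := by
  ext t ht
  rw [Measure.snd_apply ht, withDensity_apply _ (measurable_snd ht), withDensity_apply _ ht,
    ← lintegral_indicator (measurable_snd ht), ← lintegral_indicator ht,
    lintegral_prod_symm' _ (hf.indicator (measurable_snd ht))]
  refine lintegral_congr fun y => ?_
  by_cases hy : y ∈ t
  · simp only [Set.indicator_of_mem hy]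
    exact lintegral_congr fun a => Set.indicator_of_mem (by exact hy) _
  · simp only [Set.indicator_of_notMem hy]
    exact (lintegral_congr fun a => Set.indicator_of_notMem (by exact hy) _).trans lintegral_zero

/-- Passes from the reference measure `ν` to the law of the second entry. That law has `ν`-density
`p y = ∫ q(a, y) dμ(a)`, and where `p` vanishes so does `q(·, y)` almost everywhere; changing the
reference measure therefore loses no mass of `R`. -/
lemma absolutelyContinuous_prod_marginals {μ : Measure α} {ν : Measure β} [SFinite μ] [SigmaFinite ν]
    {q : α → β → ℝ≥0} (hq : Measurable (Function.uncurry q)) {R : Measure (α × β)}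
    [IsFiniteMeasure R] (hR : R = (μ.prod ν).withDensity fun z => (q z.1 z.2 : ℝ≥0∞)) :
    R ≪ μ.prod R.snd := by
  have hq' : Measurable fun z : α × β => (q z.1 z.2 : ℝ≥0∞) := hq.coe_nnreal_ennreal
  set p : β → ℝ≥0∞ := fun y => ∫⁻ a, q a y ∂μ with hp
  have hpm : Measurable p := hq'.lintegral_prod_left'
  have hsnd : R.snd = ν.withDensity p := by rw [hR, snd_withDensity_prod hq']
  have hfin : IsFiniteMeasure (ν.withDensity p) := hsnd ▸ inferInstance
  have hnull : (μ.prod ν) {z : α × β | p z.2 = 0 ∧ (q z.1 z.2 : ℝ≥0∞) ≠ 0} = 0 := by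
    have hs : MeasurableSet {z : α × β | p z.2 = 0} :=
      (hpm.comp measurable_snd) (measurableSet_singleton 0)
    have h0 : ∫⁻ z, {z : α × β | p z.2 = 0}.indicator (fun z => (q z.1 z.2 : ℝ≥0∞)) z
        ∂μ.prod ν = 0 := by
      rw [lintegral_prod_symm' _ (hq'.indicator hs)]
      refine (lintegral_congr fun y => ?_).trans lintegral_zero
      by_cases hy : p y = 0
      · refine le_antisymm (le_trans (lintegral_mono fun a => ?_) hy.le) zero_le
        exact Set.indicator_le_self _ _ _
      · exact (lintegral_congr fun a => Set.indicator_of_notMem (by exact hy) _).trans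
          lintegral_zero
    rw [lintegral_eq_zero_iff (hq'.indicator hs)] at h0
    refine measure_mono_null ?_ h0
    rintro z ⟨hz1, hz2⟩ hz
    have hz' : {z : α × β | p z.2 = 0}.indicator (fun z => (q z.1 z.2 : ℝ≥0∞)) z = 0 := hz
    rw [Set.indicator_of_mem (by exact hz1)] at hz'
    exact hz2 hz'
  intro s hs
  rw [hsnd, prod_withDensity_right hpm, withDensity_apply_eq_zero
    (show Measurable fun z : α × β => p z.2 from hpm.comp measurable_snd)] at hs
  rw [hR, withDensity_apply_eq_zero hq']
  refine measure_mono_null ?_ (measure_union_null hs hnull)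
  rintro z ⟨hz1, hz2⟩
  by_cases h : p z.2 = 0
  · exact Or.inr ⟨h, hz1⟩
  · exact Or.inl ⟨h, hz2⟩

/-- The column masses `m y` of the Radon–Nikodym density are a.e. one, because they are the density
of the second marginal with respect to itself. Replacing the exceptional columns by the constant `1`
gives exact normalization at every `y`. -/
lemma exists_normalized_density {R : Measure (α × β)} [IsProbabilityMeasure R]
    (hR : R ≪ R.fst.prod R.snd) :
    ∃ r : α → β → ℝ≥0, Measurable (Function.uncurry r) ∧ (∀ y, ∫⁻ a, r a y ∂(R.fst) = 1) ∧
      R = (R.fst.prod R.snd).withDensity fun z => (r z.1 z.2 : ℝ≥0∞) := by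
  classical
  set ρ := R.fst.prod R.snd with hρ
  set r₁ : α × β → ℝ≥0 := fun z => (R.rnDeriv ρ z).toNNReal with hr₁
  have hr₁m : Measurable r₁ := (Measure.measurable_rnDeriv R ρ).ennreal_toNNReal
  have hr₁' : Measurable fun z => (r₁ z : ℝ≥0∞) := hr₁m.coe_nnreal_ennreal
  have hR₁ : R = ρ.withDensity fun z => (r₁ z : ℝ≥0∞) := by
    conv_lhs => rw [← Measure.withDensity_rnDeriv_eq R ρ hR]
    refine withDensity_congr_ae ?_
    filter_upwards [Measure.rnDeriv_lt_top R ρ] with z hz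
    rw [hr₁, ENNReal.coe_toNNReal hz.ne]
  set m : β → ℝ≥0∞ := fun y => ∫⁻ a, r₁ (a, y) ∂(R.fst) with hm
  have hmm : Measurable m := hr₁'.lintegral_prod_left'
  have hm1 : m =ᵐ[R.snd] 1 := by
    have h1 : R.snd.withDensity m = R.snd.withDensity 1 := by
      rw [← snd_withDensity_prod hr₁', withDensity_one, ← hρ, ← hR₁]
    exact (withDensity_eq_iff_of_sigmaFinite hmm.aemeasurable measurable_one.aemeasurable).1 h1
  have hset : MeasurableSet {z : α × β | m z.2 = 1} :=
    (hmm.comp measurable_snd) (measurableSet_singleton 1)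
  refine ⟨fun a y => if m y = 1 then r₁ (a, y) else 1, ?_, fun y => ?_, ?_⟩
  · exact Measurable.ite hset hr₁m measurable_const
  · by_cases hy : m y = 1
    · simp only [hy, if_true]; exact hy
    · simp [hy]
  · conv_lhs => rw [hR₁]
    refine withDensity_congr_ae ?_
    have hae : ∀ᵐ z ∂ρ, m z.2 = 1 := Measure.quasiMeasurePreserving_snd.ae hm1
    filter_upwards [hae] with z hz
    simp [hz]

/-! ### Product densities -/

lemma lintegral_pi_prod_eq_prod {Z : Type*} [MeasurableSpace Z] {n : ℕ} (ρ : Fin n → Measure Z)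
    [∀ i, SigmaFinite (ρ i)] {f : Fin n → Z → ℝ≥0∞} (hf : ∀ i, Measurable (f i)) :
    ∫⁻ z, ∏ i, f i (z i) ∂Measure.pi ρ = ∏ i, ∫⁻ x, f i x ∂ρ i := by
  induction n with
  | zero => simp
  | succ n ih =>
    have hmp := measurePreserving_piFinSuccAbove ρ 0
    have hm : Measurable fun w : Fin n → Z => ∏ i, f (Fin.succ i) (w i) :=
      Finset.measurable_prod _ fun i _ => (hf _).comp (measurable_pi_apply i)
    calc ∫⁻ z, ∏ i, f i (z i) ∂Measure.pi ρ
        = ∫⁻ t, f 0 t.1 * ∏ i, f (Fin.succ i) (t.2 i)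
            ∂(ρ 0).prod (Measure.pi fun i => ρ (Fin.succ i)) := by
          refine (lintegral_congr fun z => ?_).trans (hmp.lintegral_comp
            (f := fun t => f 0 t.1 * ∏ i, f (Fin.succ i) (t.2 i))
            (((hf 0).comp measurable_fst).mul (hm.comp measurable_snd)))
          rw [Fin.prod_univ_succ]
          rfl
      _ = ∏ i, ∫⁻ x, f i x ∂ρ i := by
          rw [lintegral_prod_mul (hf 0).aemeasurable hm.aemeasurable, ih _ fun i => hf _,
            Fin.prod_univ_succ]

lemma pi_withDensity {Z : Type*} [MeasurableSpace Z] (n : ℕ) (ρ : Measure Z) [SigmaFinite ρ]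
    {f : Z → ℝ≥0∞} (hf : Measurable f) [SigmaFinite (ρ.withDensity f)] :
    (Measure.pi fun _ : Fin n => ρ.withDensity f) =
      (Measure.pi fun _ : Fin n => ρ).withDensity fun z => ∏ i, f (z i) := by
  refine Measure.pi_eq fun s hs => ?_
  rw [withDensity_apply _ (MeasurableSet.univ_pi hs), Measure.restrict_pi_pi,
    lintegral_pi_prod_eq_prod _ fun _ => hf]
  exact Finset.prod_congr rfl fun i _ => (withDensity_apply _ (hs i)).symm

/-- Under the reference measure the first entries are independent of the second and exchangeable
among themselves: it is `μⁿ ⊗ νⁿ` after regrouping. -/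
lemma measurePreserving_permFst {n : ℕ} (σ : Equiv.Perm (Fin n)) (μ : Measure α) (ν : Measure β)
    [SigmaFinite μ] [SigmaFinite ν] :
    MeasurePreserving (permFst σ) (Measure.pi fun _ : Fin n => μ.prod ν)
      (Measure.pi fun _ : Fin n => μ.prod ν) := by
  have h1 := measurePreserving_arrowProdEquivProdArrow α β (Fin n) (fun _ => μ) (fun _ => ν)
  -- `piCongrLeft` carries coordinate `i` to position `σ⁻¹ i`, so position `i` receives coordinate
  -- `σ i`.
  have h2 := measurePreserving_piCongrLeft (fun _ : Fin n => μ) σ⁻¹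
  have h3 := (h1.symm.comp (h2.prod (MeasurePreserving.id _))).comp h1
  convert h3 using 1
  ext z i : 2
  simp only [permFst, Function.comp]
  refine Prod.ext ?_ rfl
  change (z (σ i)).1 = (Equiv.piCongrLeft (fun _ => α) σ⁻¹) (fun i => (z i).1) i
  have := Equiv.piCongrLeft_apply_apply (fun _ : Fin n => α) σ⁻¹ (fun i => (z i).1) (σ i)
  simpa using this.symm

/-! ### The posterior law of the permutation -/

section posterior

variable {n : ℕ} (q : α → β → ℝ≥0)

/-- The likelihood of the sample after undoing the permutation `π` of the first entries. -/
def pairWeight (z : Fin n → α × β) (π : Equiv.Perm (Fin n)) : ℝ≥0 :=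
  ∏ i, q (z i).1 (z (π⁻¹ i)).2

/-- The normalized likelihood of `π`. -/
noncomputable def pairProb (z : Fin n → α × β) (π : Equiv.Perm (Fin n)) : ℝ≥0 :=
  pairWeight q z π / ∑ π', pairWeight q z π'

/-- The conditional probability, given the sample, that the permuted first entry of the first row
lies in `C`. -/
noncomputable def posterior (C : Set α) (z : Fin (n + 1) → α × β) : ℝ≥0∞ :=
  ∑ π, (pairProb q z π : ℝ≥0∞) * C.indicator 1 (z (π 0)).1

lemma pairWeight_eq (z : Fin n → α × β) (π : Equiv.Perm (Fin n)) :
    pairWeight q z π = ∏ i, q (z (π i)).1 (z i).2 := by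
  rw [pairWeight, ← Equiv.prod_comp π]
  simp

lemma pairWeight_permFst (σ π : Equiv.Perm (Fin n)) (z : Fin n → α × β) :
    pairWeight q (permFst σ z) π = pairWeight q z (σ * π) := by
  simp [pairWeight_eq, permFst]

lemma sum_pairWeight_permFst (σ : Equiv.Perm (Fin n)) (z : Fin n → α × β) :
    ∑ π, pairWeight q (permFst σ z) π = ∑ π, pairWeight q z π := by
  simp only [pairWeight_permFst]
  exact Equiv.sum_comp (Equiv.mulLeft σ) (pairWeight q z)

lemma pairProb_permFst (σ π : Equiv.Perm (Fin n)) (z : Fin n → α × β) :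
    pairProb q (permFst σ z) π = pairProb q z (σ * π) := by
  rw [pairProb, pairProb, pairWeight_permFst, sum_pairWeight_permFst]

/-- Permuting the first entries left-translates the summation variable in the symmetric group. Thus
the posterior sees the first entries only as an unordered collection. -/
lemma posterior_permFst (C : Set α) (σ : Equiv.Perm (Fin (n + 1))) (z : Fin (n + 1) → α × β) :
    posterior q C (permFst σ z) = posterior q C z := by
  simp only [posterior, pairProb_permFst]
  exact Equiv.sum_comp (Equiv.mulLeft σ)
    fun π => (pairProb q z π : ℝ≥0∞) * C.indicator 1 (z (π 0)).1

/-- Only an inequality: when every weight vanishes, the convention `0 / 0 = 0` makes the sum zero.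
-/
lemma sum_pairProb_le_one (z : Fin n → α × β) : ∑ π, pairProb q z π ≤ 1 := by
  simp only [pairProb, ← Finset.sum_div]
  exact div_self_le_one _

lemma sum_pairProb_eq_one {z : Fin n → α × β} (hz : pairWeight q z 1 ≠ 0) :
    ∑ π, pairProb q z π = 1 := by
  simp only [pairProb, ← Finset.sum_div]
  refine div_self fun h => hz ?_
  exact (Finset.sum_eq_zero_iff.1 h) 1 (Finset.mem_univ _)

lemma posterior_le_one (C : Set α) (z : Fin (n + 1) → α × β) : posterior q C z ≤ 1 := by
  calc posterior q C z ≤ ∑ π, (pairProb q z π : ℝ≥0∞) := by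
        refine Finset.sum_le_sum fun π _ => mul_le_of_le_one_right' ?_
        exact Set.indicator_le_self' (fun _ _ => zero_le_one) _
    _ ≤ 1 := by exact_mod_cast sum_pairProb_le_one q z

variable {q}

lemma measurable_pairWeight (hq : Measurable (Function.uncurry q)) (π : Equiv.Perm (Fin n)) :
    Measurable fun z : Fin n → α × β => pairWeight q z π := by
  unfold pairWeight
  refine Finset.measurable_prod _ fun i _ => ?_
  exact hq.comp (by fun_prop : Measurable fun z : Fin n → α × β => ((z i).1, (z (π⁻¹ i)).2))

lemma measurable_pairProb (hq : Measurable (Function.uncurry q)) (π : Equiv.Perm (Fin n)) :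
    Measurable fun z : Fin n → α × β => pairProb q z π :=
  (measurable_pairWeight hq π).div
    (Finset.measurable_sum _ fun π' _ => measurable_pairWeight hq π')

lemma measurable_posterior (hq : Measurable (Function.uncurry q)) {C : Set α}
    (hC : MeasurableSet C) : Measurable (posterior (n := n) q C) := by
  unfold posterior
  refine Finset.measurable_sum _ fun π _ => (measurable_pairProb hq π).coe_nnreal_ennreal.mul ?_
  exact (measurable_one.indicator hC).comp
    (by fun_prop : Measurable fun z : Fin (n + 1) → α × β => (z (π 0)).1)

/-- Against functions that are invariant under permutations of the first entries, the posterior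
probability of `C` integrates like the indicator of `C`. -/
lemma lintegral_symm_mul_posterior {μ : Measure α} {ν : Measure β} [SigmaFinite μ] [SigmaFinite ν]
    (hq : Measurable (Function.uncurry q)) {R : Measure (α × β)} [IsProbabilityMeasure R]
    (hR : R = (μ.prod ν).withDensity fun z => (q z.1 z.2 : ℝ≥0∞)) {C : Set α}
    (hC : MeasurableSet C) {g : (Fin (n + 1) → α × β) → ℝ≥0∞} (hg : Measurable g)
    (hgs : ∀ σ z, g (permFst σ z) = g z) :
    ∫⁻ z, g z * posterior q C z ∂(Measure.pi fun _ => R) =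
      ∫⁻ z, g z * C.indicator 1 (z 0).1 ∂(Measure.pi fun _ => R) := by
  set ρ := Measure.pi fun _ : Fin (n + 1) => μ.prod ν with hρ
  have hq' : Measurable fun z : α × β => (q z.1 z.2 : ℝ≥0∞) := hq.coe_nnreal_ennreal
  have hπ : (Measure.pi fun _ : Fin (n + 1) => R) =
      ρ.withDensity fun z => (pairWeight q z 1 : ℝ≥0∞) := by
    subst hR
    rw [pi_withDensity _ _ hq']
    simp [pairWeight, hρ]
  have hWm : ∀ π, Measurable fun z : Fin (n + 1) → α × β => (pairWeight q z π : ℝ≥0∞) :=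
    fun π => (measurable_pairWeight hq π).coe_nnreal_ennreal
  have hPm : ∀ π, Measurable fun z : Fin (n + 1) → α × β => (pairProb q z π : ℝ≥0∞) :=
    fun π => (measurable_pairProb hq π).coe_nnreal_ennreal
  have hCm : ∀ i, Measurable fun z : Fin (n + 1) → α × β =>
      C.indicator (1 : α → ℝ≥0∞) (z i).1 := fun i => (measurable_one.indicator hC).comp
    (by fun_prop : Measurable fun z : Fin (n + 1) → α × β => (z i).1)
  rw [hπ, lintegral_withDensity_eq_lintegral_mul _ (hWm 1)
      (show Measurable fun z => g z * posterior q C z from hg.mul (measurable_posterior hq hC)),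
    lintegral_withDensity_eq_lintegral_mul _ (hWm 1)
      (show Measurable fun z => g z * C.indicator 1 (z 0).1 from hg.mul (hCm 0))]
  simp only [Pi.mul_apply]
  have hm1 : ∀ π : Equiv.Perm (Fin (n + 1)), Measurable fun z => (pairWeight q z 1 : ℝ≥0∞) *
      (g z * ((pairProb q z π : ℝ≥0∞) * C.indicator 1 (z (π 0)).1)) := fun π =>
    (hWm 1).mul (hg.mul ((hPm π).mul (hCm (π 0))))
  have hm2 : ∀ π : Equiv.Perm (Fin (n + 1)), Measurable fun z => (pairProb q z π⁻¹ : ℝ≥0∞) *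
      ((pairWeight q z 1 : ℝ≥0∞) * (g z * C.indicator 1 (z 0).1)) := fun π =>
    (hPm π⁻¹).mul ((hWm 1).mul (hg.mul (hCm 0)))
  -- Changing variables by `permFst π⁻¹` brings the indicator back to row `0` and turns weight `1`
  -- and probability `π` into weight `π⁻¹` and probability `1`. Since probabilities are weights over
  -- a common normalizer, the two roles can be interchanged (`h3`).
  have h1 : ∀ π : Equiv.Perm (Fin (n + 1)),
      ∫⁻ z, (pairWeight q z 1 : ℝ≥0∞) *
        (g z * ((pairProb q z π : ℝ≥0∞) * C.indicator 1 (z (π 0)).1)) ∂ρ =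
      ∫⁻ z, (pairProb q z π⁻¹ : ℝ≥0∞) *
        ((pairWeight q z 1 : ℝ≥0∞) * (g z * C.indicator 1 (z 0).1)) ∂ρ := by
    intro π
    rw [← (measurePreserving_permFst π⁻¹ μ ν).lintegral_comp (hm1 π)]
    refine lintegral_congr fun z => ?_
    rw [hgs, pairWeight_permFst, pairProb_permFst, mul_one, inv_mul_cancel]
    have h2 : (permFst π⁻¹ z (π 0)).1 = (z 0).1 := by simp [permFst]
    rw [h2]
    have h3 : (pairWeight q z π⁻¹ : ℝ≥0∞) * pairProb q z 1 =
        pairProb q z π⁻¹ * pairWeight q z 1 := by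
      rw [pairProb, pairProb]
      exact_mod_cast by rw [mul_div_assoc', div_mul_eq_mul_div]
    calc _ = ((pairWeight q z π⁻¹ : ℝ≥0∞) * pairProb q z 1) *
          (g z * C.indicator 1 (z 0).1) := by ring
      _ = _ := by rw [h3]; ring
  calc ∫⁻ z, (pairWeight q z 1 : ℝ≥0∞) * (g z * posterior q C z) ∂ρ
      = ∑ π, ∫⁻ z, (pairWeight q z 1 : ℝ≥0∞) *
        (g z * ((pairProb q z π : ℝ≥0∞) * C.indicator 1 (z (π 0)).1)) ∂ρ := by
        rw [← lintegral_finsetSum _ fun π _ => hm1 π]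
        refine lintegral_congr fun z => ?_
        rw [posterior, Finset.mul_sum, Finset.mul_sum]
    _ = ∫⁻ z, ∑ π : Equiv.Perm (Fin (n + 1)), (pairProb q z π⁻¹ : ℝ≥0∞) *
        ((pairWeight q z 1 : ℝ≥0∞) * (g z * C.indicator 1 (z 0).1)) ∂ρ := by
        rw [lintegral_finsetSum _ fun π _ => hm2 π]
        exact Finset.sum_congr rfl fun π _ => h1 π
    _ = ∫⁻ z, (pairWeight q z 1 : ℝ≥0∞) * (g z * C.indicator 1 (z 0).1) ∂ρ := by
        refine lintegral_congr fun z => ?_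
        rw [← Finset.sum_mul]
        -- The probabilities may fail to sum to one only where the density of the sample is zero,
        -- and there both sides vanish.
        by_cases hz : pairWeight q z 1 = 0
        · simp [hz]
        · have hs := sum_pairProb_eq_one q hz
          rw [← Equiv.sum_comp (Equiv.inv (Equiv.Perm (Fin (n + 1))))] at hs
          simp only [Equiv.inv_apply] at hs
          rw [← ENNReal.ofNNReal_finsetSum, hs, ENNReal.coe_one, one_mul]

lemma integral_symm_mul_posterior {μ : Measure α} {ν : Measure β} [SigmaFinite μ] [SigmaFinite ν]
    (hq : Measurable (Function.uncurry q)) {R : Measure (α × β)} [IsProbabilityMeasure R]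
    (hR : R = (μ.prod ν).withDensity fun z => (q z.1 z.2 : ℝ≥0∞)) {C : Set α}
    (hC : MeasurableSet C) {g : (Fin (n + 1) → α × β) → ℝ} (hg : Measurable g)
    (hg1 : ∀ z, |g z| ≤ 1) (hgs : ∀ σ z, g (permFst σ z) = g z) :
    ∫ z, g z * (posterior q C z).toReal ∂(Measure.pi fun _ => R) =
      ∫ z, g z * C.indicator (fun _ => (1 : ℝ)) (z 0).1 ∂(Measure.pi fun _ => R) := by
  have hwm : Measurable fun z : Fin (n + 1) → α × β => (posterior q C z).toReal :=
    (measurable_posterior hq hC).ennreal_toReal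
  have hCm : Measurable fun z : Fin (n + 1) → α × β => C.indicator (fun _ => (1 : ℝ)) (z 0).1 :=
    (measurable_const.indicator hC).comp
      (by fun_prop : Measurable fun z : Fin (n + 1) → α × β => (z 0).1)
  have hw1 : ∀ z : Fin (n + 1) → α × β, (posterior q C z).toReal ≤ 1 := fun z =>
    ENNReal.toReal_le_of_le_ofReal zero_le_one (by simpa using posterior_le_one q C z)
  have hC0 : ∀ a, 0 ≤ C.indicator (fun _ => (1 : ℝ)) a := fun a =>
    Set.indicator_nonneg (fun _ _ => zero_le_one) _
  have hC1 : ∀ a, C.indicator (fun _ => (1 : ℝ)) a ≤ 1 := fun a =>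
    Set.indicator_le_self' (fun _ _ => zero_le_one) _
  have key : ∀ h : (Fin (n + 1) → α × β) → ℝ, Measurable h → (∀ z, 0 ≤ h z) →
      (∀ σ z, h (permFst σ z) = h z) →
      ∫ z, h z * (posterior q C z).toReal ∂(Measure.pi fun _ => R) =
        ∫ z, h z * C.indicator (fun _ => (1 : ℝ)) (z 0).1 ∂(Measure.pi fun _ => R) := by
    intro h hh h0 hs
    rw [integral_eq_lintegral_of_nonneg_ae
        (ae_of_all _ fun z => mul_nonneg (h0 z) ENNReal.toReal_nonneg)
        (hh.mul hwm).aestronglyMeasurable,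
      integral_eq_lintegral_of_nonneg_ae (ae_of_all _ fun z => mul_nonneg (h0 z) (hC0 _))
        (hh.mul hCm).aestronglyMeasurable]
    congr 1
    have := lintegral_symm_mul_posterior hq hR hC hh.ennreal_ofReal
      (fun σ z => by simp only [hs])
    convert this using 1
    · refine lintegral_congr fun z => ?_
      rw [ENNReal.ofReal_mul (h0 z), ENNReal.ofReal_toReal
        ((posterior_le_one q C z).trans_lt ENNReal.one_lt_top).ne]
    · refine lintegral_congr fun z => ?_
      rw [ENNReal.ofReal_mul (h0 z)]
      by_cases hz : (z 0).1 ∈ C <;> simp [hz]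
  -- A signed `g` is reduced to the nonnegative functions `g + 1` and `1`, both still invariant.
  have k1 := key (fun z => g z + 1) (hg.add_const 1)
    (fun z => by linarith [neg_le_of_abs_le (hg1 z)]) (fun σ z => by simp only [hgs])
  have k2 := key (fun _ => 1) measurable_const (fun _ => zero_le_one) (fun _ _ => rfl)
  have hi : ∀ {f h : (Fin (n + 1) → α × β) → ℝ}, Measurable f → Measurable h → (∀ z, |f z| ≤ 1) →
      (∀ z, 0 ≤ h z) → (∀ z, h z ≤ 1) →
      Integrable (fun z => f z * h z) (Measure.pi fun _ => R) := by
    intro f h hf hh hf1 hh0 hh1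
    refine Integrable.of_bound (hf.mul hh).aestronglyMeasurable 1 (ae_of_all _ fun z => ?_)
    rw [Real.norm_eq_abs, abs_mul, abs_of_nonneg (hh0 z)]
    exact mul_le_one₀ (hf1 z) (hh0 z) (hh1 z)
  simp only [add_mul] at k1
  rw [integral_add (hi hg hwm hg1 (fun _ => ENNReal.toReal_nonneg) hw1)
      (hi measurable_const hwm (fun _ => by simp) (fun _ => ENNReal.toReal_nonneg) hw1),
    integral_add (hi hg hCm hg1 (fun _ => hC0 _) fun _ => hC1 _)
      (hi measurable_const hCm (fun _ => by simp) (fun _ => hC0 _) fun _ => hC1 _), k2] at k1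
  exact add_right_cancel k1

/-- In large samples the posterior probability of `C` is close, in mean, to the conditional
probability of `C` given the second entry of the row. -/
theorem exists_integral_abs_posterior_sub_le {μ : Measure α} {ν' : Measure β} [SigmaFinite ν']
    {ν : Measure β} [IsProbabilityMeasure μ] [IsProbabilityMeasure ν]
    (hq : Measurable (Function.uncurry q)) {r : α → β → ℝ≥0}
    (hr : Measurable (Function.uncurry r)) (hr1 : ∀ y, ∫⁻ a, r a y ∂μ = 1)
    {C : Set α} (hC : MeasurableSet C) {R : Measure (α × β)} [IsProbabilityMeasure R]
    (hRq : R = (μ.prod ν').withDensity fun z => (q z.1 z.2 : ℝ≥0∞))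
    (hR : R = (μ.prod ν).withDensity fun z => (r z.1 z.2 : ℝ≥0∞)) {ε : ℝ} (hε : 0 < ε) :
    ∃ N : ℕ, ∀ n ≥ N, ∫ z : Fin (n + 1) → α × β,
      |(posterior q C z).toReal - condMass μ r C (z 0).2| ∂(Measure.pi fun _ => R) ≤ ε := by
  classical
  obtain ⟨N, hN⟩ := exists_abs_integral_symm_mul_centred_le hr hr1 hC hR hε
  refine ⟨N, fun n hn => ?_⟩
  have hwm : Measurable fun z : Fin (n + 1) → α × β => (posterior q C z).toReal :=
    (measurable_posterior hq hC).ennreal_toReal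
  have hcm : Measurable fun z : Fin (n + 1) → α × β => condMass μ r C (z 0).2 :=
    (measurable_condMass hr).comp
      (by fun_prop : Measurable fun z : Fin (n + 1) → α × β => (z 0).2)
  -- The sign of the difference is invariant: the posterior is, and the conditional mass involves
  -- only second entries. So `g` turns the `L¹` distance into a correlation to which the uniform
  -- bound applies.
  set g : (Fin (n + 1) → α × β) → ℝ := fun z =>
    if condMass μ r C (z 0).2 ≤ (posterior q C z).toReal then 1 else -1 with hg
  have hgm : Measurable g :=
    Measurable.ite (measurableSet_le hcm hwm) measurable_const measurable_const
  have hg1 : ∀ z, |g z| ≤ 1 := by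
    intro z; simp only [hg]; split_ifs <;> simp
  have hgs : ∀ σ z, g (permFst σ z) = g z := by
    intro σ z
    simp only [hg, posterior_permFst]
    rfl
  have h1 := hN n hn g hgm hg1 hgs
  have hi : ∀ {h : (Fin (n + 1) → α × β) → ℝ}, Measurable h → (∀ z, |h z| ≤ 1) →
      Integrable (fun z => g z * h z) (Measure.pi fun _ => R) := by
    intro h hh hh1
    refine Integrable.of_bound (hgm.mul hh).aestronglyMeasurable 1 (ae_of_all _ fun z => ?_)
    rw [Real.norm_eq_abs, abs_mul]
    exact mul_le_one₀ (hg1 z) (abs_nonneg _) (hh1 z)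
  have hiw := hi hwm fun z => by
    rw [abs_of_nonneg ENNReal.toReal_nonneg]
    exact ENNReal.toReal_le_of_le_ofReal zero_le_one (by simpa using posterior_le_one q C z)
  have hic := hi hcm fun z => by
    rw [abs_of_nonneg (condMass_nonneg _)]
    exact condMass_le_one hr (hr1 _)
  have hiC := hi (h := fun z => C.indicator (fun _ => (1 : ℝ)) (z 0).1)
    ((measurable_const.indicator hC).comp
      (by fun_prop : Measurable fun z : Fin (n + 1) → α × β => (z 0).1)) fun z => by
    by_cases hz : (z 0).1 ∈ C <;> simp [hz]
  calc ∫ z : Fin (n + 1) → α × β, |(posterior q C z).toReal - condMass μ r C (z 0).2|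
        ∂(Measure.pi fun _ => R)
      = ∫ z, (g z * (posterior q C z).toReal - g z * condMass μ r C (z 0).2)
          ∂(Measure.pi fun _ => R) := by
        refine integral_congr_ae (ae_of_all _ fun z => ?_)
        simp only [hg]
        split_ifs with h
        · rw [abs_of_nonneg (by linarith)]; ring
        · rw [abs_of_neg (by linarith)]; ring
    _ = ∫ z, g z * centred μ r C (z 0) ∂(Measure.pi fun _ => R) := by
        rw [integral_sub hiw hic, integral_symm_mul_posterior hq hRq hC hgm hg1 hgs,
          ← integral_sub hiC hic]
        refine integral_congr_ae (ae_of_all _ fun z => ?_)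
        simp only [centred]; ring
    _ ≤ ε := le_of_abs_le h1

end posterior

section laws

variable {𝒳 𝒜 𝒴 Yhat : Type*} [MeasurableSpace 𝒳] [MeasurableSpace 𝒜] [MeasurableSpace 𝒴]
  [MeasurableSpace Yhat]

/-! ### Laws of rectangles -/

/-- The law of `(f X, A', Y)`, where `A'` is drawn from the conditional law of `A` given `Y`,
independently of `X`. Here `μ` is the law of `A` and `r(·, y)` is the density, with respect to `μ`,
of the conditional law of `A` given `Y = y`. -/
noncomputable def resampledLaw (P : Measure (𝒳 × 𝒜 × 𝒴)) (μ : Measure 𝒜) (r : 𝒜 → 𝒴 → ℝ≥0)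
    (f : 𝒳 → Yhat) : Measure (Yhat × 𝒜 × 𝒴) :=
  ((P.prod μ).withDensity fun t => (r t.2 t.1.2.2 : ℝ≥0∞)).map
    fun t => (f t.1.1, t.2, t.1.2.2)

/-- The event that the prediction lies in `B` and the response in `E`. -/
def predEvent (f : 𝒳 → Yhat) (B : Set Yhat) (E : Set 𝒴) : Set (𝒳 × 𝒜 × 𝒴) :=
  {z | f z.1 ∈ B ∧ z.2.2 ∈ E}

lemma measurableSet_predEvent {f : 𝒳 → Yhat} (hf : Measurable f) {B : Set Yhat} {E : Set 𝒴}
    (hB : MeasurableSet B) (hE : MeasurableSet E) :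
    MeasurableSet (predEvent f B E : Set (𝒳 × 𝒜 × 𝒴)) :=
  ((hf.comp measurable_fst) hB).inter ((measurable_snd.comp measurable_snd) hE)

/-- Given the sample, summing over the permutation replaces the indicator of `Ã ∈ C` by its
conditional probability, which does not involve the features. -/
lemma icpLaw_prod_prod (P : Measure (𝒳 × 𝒜 × 𝒴)) [IsProbabilityMeasure P] {q : 𝒜 → 𝒴 → ℝ≥0}
    (hq : Measurable (Function.uncurry q)) (n : ℕ) {f : 𝒳 → Yhat} (hf : Measurable f)
    {B : Set Yhat} {C : Set 𝒜} {E : Set 𝒴} (hB : MeasurableSet B) (hC : MeasurableSet C)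
    (hE : MeasurableSet E) :
    icpLaw P q n f (B ×ˢ C ×ˢ E) = ∫⁻ z : Fin (n + 1) → 𝒳 × 𝒜 × 𝒴,
      (predEvent f B E).indicator 1 (z 0) * posterior q C (fun i => (z i).2)
        ∂(Measure.pi fun _ => P) := by
  have hm : Measurable fun w : (Fin (n + 1) → 𝒳 × 𝒜 × 𝒴) × (Fin (n + 1) → 𝒜) =>
      (f (w.1 0).1, w.2 0, (w.1 0).2.2) := by fun_prop
  have hrect : MeasurableSet (B ×ˢ C ×ˢ E) := hB.prod (hC.prod hE)
  have hproj : Measurable fun z : Fin (n + 1) → 𝒳 × 𝒜 × 𝒴 => fun i => (z i).2 := by fun_prop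
  have hprob : ∀ π, Measurable fun z : Fin (n + 1) → 𝒳 × 𝒜 × 𝒴 => (icpProb q z π : ℝ≥0∞) :=
    fun π => ((measurable_pairProb hq π).comp hproj).coe_nnreal_ennreal
  have hpe : Measurable fun z : Fin (n + 1) → 𝒳 × 𝒜 × 𝒴 =>
      (predEvent f B E).indicator (1 : 𝒳 × 𝒜 × 𝒴 → ℝ≥0∞) (z 0) :=
    (measurable_one.indicator (measurableSet_predEvent hf hB hE)).comp (measurable_pi_apply 0)
  have hterm : ∀ π : Equiv.Perm (Fin (n + 1)),
      Measurable fun z : Fin (n + 1) → 𝒳 × 𝒜 × 𝒴 => (predEvent f B E).indicator 1 (z 0) *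
        ((icpProb q z π : ℝ≥0∞) * C.indicator 1 (z (π 0)).2.1) := fun π =>
    hpe.mul ((hprob π).mul ((measurable_one.indicator hC).comp
      (by fun_prop : Measurable fun z : Fin (n + 1) → 𝒳 × 𝒜 × 𝒴 => (z (π 0)).2.1)))
  rw [icpLaw, Measure.map_apply hm hrect, icpSampleLaw, Measure.finsetSum_apply]
  calc _ = ∑ π : Equiv.Perm (Fin (n + 1)), ∫⁻ z, (predEvent f B E).indicator 1 (z 0) *
        ((icpProb q z π : ℝ≥0∞) * C.indicator 1 (z (π 0)).2.1) ∂(Measure.pi fun _ => P) := by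
        refine Finset.sum_congr rfl fun π _ => ?_
        have hg : Measurable fun z : Fin (n + 1) → 𝒳 × 𝒜 × 𝒴 =>
            (z, fun i => (z (π i)).2.1) := by fun_prop
        rw [Measure.map_apply hg (hm hrect), withDensity_apply _ (hg (hm hrect)),
          ← lintegral_indicator (hg (hm hrect))]
        refine lintegral_congr fun z => ?_
        by_cases h1 : f (z 0).1 ∈ B <;> by_cases h2 : (z (π 0)).2.1 ∈ C <;>
          by_cases h3 : (z 0).2.2 ∈ E <;> simp [Set.indicator, predEvent, h1, h2, h3]
    _ = _ := by
        rw [← lintegral_finsetSum _ fun π _ => hterm π]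
        refine lintegral_congr fun z => ?_
        rw [posterior, Finset.mul_sum]
        rfl

lemma resampledLaw_prod_prod (P : Measure (𝒳 × 𝒜 × 𝒴)) [IsProbabilityMeasure P] {μ : Measure 𝒜}
    [IsProbabilityMeasure μ] {r : 𝒜 → 𝒴 → ℝ≥0} (hr : Measurable (Function.uncurry r))
    (hr1 : ∀ y, ∫⁻ a, r a y ∂μ = 1) {f : 𝒳 → Yhat} (hf : Measurable f)
    {B : Set Yhat} {C : Set 𝒜} {E : Set 𝒴} (hB : MeasurableSet B) (hC : MeasurableSet C)
    (hE : MeasurableSet E) :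
    resampledLaw P μ r f (B ×ˢ C ×ˢ E) = ∫⁻ z,
      (predEvent f B E).indicator 1 z * ENNReal.ofReal (condMass μ r C z.2.2) ∂P := by
  have hm : Measurable fun t : (𝒳 × 𝒜 × 𝒴) × 𝒜 => (f t.1.1, t.2, t.1.2.2) := by fun_prop
  have hrect : MeasurableSet (B ×ˢ C ×ˢ E) := hB.prod (hC.prod hE)
  have hr' : Measurable fun t : (𝒳 × 𝒜 × 𝒴) × 𝒜 => (r t.2 t.1.2.2 : ℝ≥0∞) :=
    (hr.comp (by fun_prop : Measurable fun t : (𝒳 × 𝒜 × 𝒴) × 𝒜 =>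
      (t.2, t.1.2.2))).coe_nnreal_ennreal
  rw [resampledLaw, Measure.map_apply hm hrect, withDensity_apply _ (hm hrect),
    ← lintegral_indicator (hm hrect), lintegral_prod _ (hr'.indicator (hm hrect)).aemeasurable]
  refine lintegral_congr fun z => ?_
  rw [condMass, ofReal_integral_eq_lintegral_ofReal (integrable_density hr (hr1 _)).integrableOn
    (ae_of_all _ fun _ => NNReal.coe_nonneg _), ← lintegral_indicator hC]
  simp only [ENNReal.ofReal_coe_nnreal]
  have hrz : Measurable fun a => (r a z.2.2 : ℝ≥0∞) :=
    (hr.comp measurable_prodMk_right).coe_nnreal_ennreal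
  rw [← lintegral_const_mul _ (hrz.indicator hC)]
  refine lintegral_congr fun a => ?_
  by_cases h1 : f z.1 ∈ B <;> by_cases h2 : a ∈ C <;>
    by_cases h3 : z.2.2 ∈ E <;> simp [Set.indicator, predEvent, h1, h2, h3]

lemma map_snd_eq_of_isCondDensity {P : Measure (𝒳 × 𝒜 × 𝒴)} [IsProbabilityMeasure P]
    {ν : Measure 𝒴} {q : 𝒜 → 𝒴 → ℝ≥0}
    (hq : IsCondDensity P (fun z => z.2.1) (fun z => z.2.2) ν q) :
    P.map Prod.snd = ((P.map Prod.snd).fst.prod ν).withDensity fun z => (q z.1 z.2 : ℝ≥0∞) := by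
  have h := hq.2
  have h1 : (P.map Prod.snd).fst = P.map fun z => z.2.1 := by
    rw [Measure.fst, Measure.map_map measurable_fst measurable_snd]
    rfl
  rw [h1]
  exact h

section approximation

variable {P : Measure (𝒳 × 𝒜 × 𝒴)} [IsProbabilityMeasure P] {ν : Measure 𝒴} [SigmaFinite ν]
  {q r : 𝒜 → 𝒴 → ℝ≥0}

lemma measurePreserving_pi_snd (P : Measure (𝒳 × 𝒜 × 𝒴)) [IsProbabilityMeasure P] (n : ℕ) :
    MeasurePreserving (fun z : Fin n → 𝒳 × 𝒜 × 𝒴 => fun i => (z i).2)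
      (Measure.pi fun _ => P) (Measure.pi fun _ => P.map Prod.snd) := by
  have : IsProbabilityMeasure (P.map Prod.snd) :=
    Measure.isProbabilityMeasure_map measurable_snd.aemeasurable
  refine ⟨by fun_prop, ?_⟩
  exact Measure.pi_map_pi (μ := fun _ : Fin n => P) (f := fun _ => Prod.snd)
    fun _ => measurable_snd.aemeasurable

/-- The selection probabilities need not sum to one at every sample. The total mass is nevertheless
one, by the posterior identity with `C = univ` and `g = 1`. -/
lemma isProbabilityMeasure_icpLaw
    (hq : IsCondDensity P (fun z => z.2.1) (fun z => z.2.2) ν q) (n : ℕ) {f : 𝒳 → Yhat}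
    (hf : Measurable f) : IsProbabilityMeasure (icpLaw P q n f) := by
  have hR : IsProbabilityMeasure (P.map Prod.snd) :=
    Measure.isProbabilityMeasure_map measurable_snd.aemeasurable
  constructor
  rw [← Set.univ_prod_univ, ← Set.univ_prod_univ,
    icpLaw_prod_prod P hq.1 n hf .univ .univ .univ]
  have h := lintegral_symm_mul_posterior (n := n) hq.1 (map_snd_eq_of_isCondDensity hq)
    (C := Set.univ) .univ (g := fun _ => 1) measurable_const fun _ _ => rfl
  rw [← (measurePreserving_pi_snd P (n + 1)).lintegral_comp (by
    exact measurable_const.mul (measurable_posterior hq.1 .univ))] at h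
  simpa [predEvent] using h

lemma isProbabilityMeasure_resampledLaw {μ : Measure 𝒜} [IsProbabilityMeasure μ]
    (hr : Measurable (Function.uncurry r)) (hr1 : ∀ y, ∫⁻ a, r a y ∂μ = 1) {f : 𝒳 → Yhat}
    (hf : Measurable f) : IsProbabilityMeasure (resampledLaw P μ r f) := by
  constructor
  rw [← Set.univ_prod_univ, ← Set.univ_prod_univ,
    resampledLaw_prod_prod P hr hr1 hf .univ .univ .univ]
  have h : ∀ y, condMass μ r Set.univ y = 1 := fun y => by
    rw [condMass, setIntegral_univ, integral_density hr (hr1 y)]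
  simp [predEvent, h]

lemma measureReal_resampledLaw_prod_prod {μ : Measure 𝒜}
    [IsProbabilityMeasure μ] (hr : Measurable (Function.uncurry r))
    (hr1 : ∀ y, ∫⁻ a, r a y ∂μ = 1) {f : 𝒳 → Yhat} (hf : Measurable f)
    {B : Set Yhat} {C : Set 𝒜} {E : Set 𝒴} (hB : MeasurableSet B) (hC : MeasurableSet C)
    (hE : MeasurableSet E) :
    (resampledLaw P μ r f).real (B ×ˢ C ×ˢ E) =
      ∫ z, (predEvent f B E).indicator (fun _ => (1 : ℝ)) z * condMass μ r C z.2.2 ∂P := by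
  have hm : Measurable fun z : 𝒳 × 𝒜 × 𝒴 =>
      (predEvent f B E).indicator (fun _ => (1 : ℝ)) z * condMass μ r C z.2.2 :=
    (measurable_const.indicator (measurableSet_predEvent hf hB hE)).mul
      ((measurable_condMass hr).comp (measurable_snd.comp measurable_snd))
  rw [Measure.real, resampledLaw_prod_prod P hr hr1 hf hB hC hE,
    integral_eq_lintegral_of_nonneg_ae (ae_of_all _ fun z => mul_nonneg
      (Set.indicator_nonneg (fun _ _ => zero_le_one) _) (condMass_nonneg _))
      hm.aestronglyMeasurable]
  congr 1
  refine lintegral_congr fun z => ?_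
  by_cases h : z ∈ (predEvent f B E : Set (𝒳 × 𝒜 × 𝒴)) <;> simp [h]

lemma measureReal_icpLaw_prod_prod
    (hq : Measurable (Function.uncurry q)) (n : ℕ) {f : 𝒳 → Yhat} (hf : Measurable f)
    {B : Set Yhat} {C : Set 𝒜} {E : Set 𝒴} (hB : MeasurableSet B) (hC : MeasurableSet C)
    (hE : MeasurableSet E) :
    (icpLaw P q n f).real (B ×ˢ C ×ˢ E) = ∫ z : Fin (n + 1) → 𝒳 × 𝒜 × 𝒴,
      (predEvent f B E).indicator (fun _ => (1 : ℝ)) (z 0) *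
        (posterior q C (fun i => (z i).2)).toReal ∂(Measure.pi fun _ => P) := by
  have hm : Measurable fun z : Fin (n + 1) → 𝒳 × 𝒜 × 𝒴 =>
      (predEvent f B E).indicator (fun _ => (1 : ℝ)) (z 0) *
        (posterior q C (fun i => (z i).2)).toReal :=
    ((measurable_const.indicator (measurableSet_predEvent hf hB hE)).comp
      (measurable_pi_apply 0)).mul ((measurable_posterior hq hC).comp (by fun_prop)).ennreal_toReal
  rw [Measure.real, icpLaw_prod_prod P hq n hf hB hC hE,
    integral_eq_lintegral_of_nonneg_ae (ae_of_all _ fun z => mul_nonneg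
      (Set.indicator_nonneg (fun _ _ => zero_le_one) _) ENNReal.toReal_nonneg)
      hm.aestronglyMeasurable]
  congr 1
  refine lintegral_congr fun z => ?_
  by_cases h : z 0 ∈ (predEvent f B E : Set (𝒳 × 𝒜 × 𝒴))
  · simp [h, ENNReal.ofReal_toReal ((posterior_le_one q C _).trans_lt ENNReal.one_lt_top).ne]
  · simp [h]

/-- Rectangles have almost the same probability under inverse conditional permutation of a large
sample and under resampling of the attribute, uniformly in the predictor. -/
theorem exists_abs_icpLaw_sub_resampledLaw_le
    (hq : IsCondDensity P (fun z => z.2.1) (fun z => z.2.2) ν q)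
    (hr : Measurable (Function.uncurry r))
    (hr1 : ∀ y, ∫⁻ a, r a y ∂(P.map Prod.snd).fst = 1)
    (hR : P.map Prod.snd = ((P.map Prod.snd).fst.prod (P.map Prod.snd).snd).withDensity
      fun z => (r z.1 z.2 : ℝ≥0∞)) {C : Set 𝒜} (hC : MeasurableSet C) {ε : ℝ} (hε : 0 < ε) :
    ∃ N : ℕ, ∀ n ≥ N, ∀ f : 𝒳 → Yhat, Measurable f → ∀ (B : Set Yhat) (E : Set 𝒴),
      MeasurableSet B → MeasurableSet E →
      |(icpLaw P q n f).real (B ×ˢ C ×ˢ E) -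
        (resampledLaw P (P.map Prod.snd).fst r f).real (B ×ˢ C ×ˢ E)| ≤ ε := by
  have hRp : IsProbabilityMeasure (P.map Prod.snd) :=
    Measure.isProbabilityMeasure_map measurable_snd.aemeasurable
  set μ := (P.map Prod.snd).fst with hμ
  obtain ⟨N, hN⟩ := exists_integral_abs_posterior_sub_le hq.1 hr hr1 hC
    (map_snd_eq_of_isCondDensity hq) hR hε
  refine ⟨N, fun n hn f hf B E hB hE => ?_⟩
  have hwm : Measurable fun z : Fin (n + 1) → 𝒜 × 𝒴 => (posterior q C z).toReal :=
    (measurable_posterior hq.1 hC).ennreal_toReal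
  have hcm : Measurable fun z : Fin (n + 1) → 𝒜 × 𝒴 => condMass μ r C (z 0).2 :=
    (measurable_condMass hr).comp (by fun_prop : Measurable fun z : Fin (n + 1) → 𝒜 × 𝒴 => (z 0).2)
  have hmp := measurePreserving_pi_snd P (n + 1)
  have hd : Integrable (fun z : Fin (n + 1) → 𝒜 × 𝒴 =>
      |(posterior q C z).toReal - condMass μ r C (z 0).2|)
      (Measure.pi fun _ => P.map Prod.snd) := by
    refine Integrable.of_bound (hwm.sub hcm).abs.aestronglyMeasurable 1 (ae_of_all _ fun z => ?_)
    have h1 : (posterior q C z).toReal ≤ 1 :=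
      ENNReal.toReal_le_of_le_ofReal zero_le_one (by simpa using posterior_le_one q C z)
    have h2 : condMass μ r C (z 0).2 ≤ 1 := condMass_le_one hr (hr1 _)
    have h3 : 0 ≤ condMass μ r C (z 0).2 := condMass_nonneg _
    have h4 : 0 ≤ (posterior q C z).toReal := ENNReal.toReal_nonneg
    rw [Real.norm_eq_abs, abs_abs, abs_le]
    constructor <;> linarith
  have hi : ∀ h : (Fin (n + 1) → 𝒜 × 𝒴) → ℝ, Measurable h → (∀ z, 0 ≤ h z) → (∀ z, h z ≤ 1) →
      Integrable (fun z : Fin (n + 1) → 𝒳 × 𝒜 × 𝒴 =>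
        (predEvent f B E).indicator (fun _ => (1 : ℝ)) (z 0) * h fun i => (z i).2)
        (Measure.pi fun _ => P) := by
    intro h hh h0 h1
    refine Integrable.of_bound (((measurable_const.indicator
      (measurableSet_predEvent hf hB hE)).comp (measurable_pi_apply 0)).mul
      (hh.comp (by fun_prop))).aestronglyMeasurable 1 (ae_of_all _ fun z => ?_)
    rw [Real.norm_eq_abs, abs_mul, abs_of_nonneg (h0 _)]
    refine mul_le_one₀ ?_ (h0 _) (h1 _)
    by_cases hz : z 0 ∈ (predEvent f B E : Set (𝒳 × 𝒜 × 𝒴)) <;> simp [hz]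
  have hpop : (resampledLaw P μ r f).real (B ×ˢ C ×ˢ E) = ∫ z : Fin (n + 1) → 𝒳 × 𝒜 × 𝒴,
      (predEvent f B E).indicator (fun _ => (1 : ℝ)) (z 0) * condMass μ r C (z 0).2.2
        ∂(Measure.pi fun _ => P) := by
    rw [measureReal_resampledLaw_prod_prod hr hr1 hf hB hC hE]
    exact (integral_comp_eval (μ := fun _ : Fin (n + 1) => P) (i := 0)
      (f := fun z => (predEvent f B E).indicator (fun _ => (1 : ℝ)) z * condMass μ r C z.2.2)
      ((measurable_const.indicator (measurableSet_predEvent hf hB hE)).mul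
        ((measurable_condMass hr).comp
          (measurable_snd.comp measurable_snd))).aestronglyMeasurable).symm
  rw [hpop, measureReal_icpLaw_prod_prod hq.1 n hf hB hC hE, ← integral_sub
    (hi _ hwm (fun _ => ENNReal.toReal_nonneg) fun z =>
      ENNReal.toReal_le_of_le_ofReal zero_le_one (by simpa using posterior_le_one q C z))
    (hi _ hcm (fun _ => condMass_nonneg _) fun z => condMass_le_one hr (hr1 _))]
  -- Bounding the indicator of the prediction event by one removes `f`, `B` and `E`, whence the
  -- uniformity in all three.
  refine (abs_integral_le_integral_abs).trans (le_trans ?_ (hN n hn))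
  rw [← hmp.map_eq] at hd ⊢
  rw [integral_map hmp.measurable.aemeasurable hd.aestronglyMeasurable]
  refine integral_mono_of_nonneg (ae_of_all _ fun z => abs_nonneg _)
    ((integrable_map_measure hd.aestronglyMeasurable hmp.measurable.aemeasurable).1 hd)
    (ae_of_all _ fun z => ?_)
  simp only [← mul_sub, abs_mul]
  refine mul_le_of_le_one_left (abs_nonneg _) ?_
  by_cases hz : z 0 ∈ (predEvent f B E : Set (𝒳 × 𝒜 × 𝒴)) <;> simp [hz]

end approximation

end laws

/-! ### The population law -/

section population

variable {𝒳 𝒜 𝒴 Yhat : Type*} [MeasurableSpace 𝒳] [TopologicalSpace 𝒜] [PolishSpace 𝒜]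
  [MeasurableSpace 𝒜] [BorelSpace 𝒜] [TopologicalSpace 𝒴] [PolishSpace 𝒴] [MeasurableSpace 𝒴]
  [BorelSpace 𝒴] [TopologicalSpace Yhat] [PolishSpace Yhat] [MeasurableSpace Yhat]
  [BorelSpace Yhat]

/-- Convergence on measurable rectangles implies convergence in distribution. -/
lemma convergesInLaw_of_tendsto_prod_prod {S : ℕ → Measure (Yhat × 𝒜 × 𝒴)}
    {S' : Measure (Yhat × 𝒜 × 𝒴)} [∀ n, IsProbabilityMeasure (S n)] [IsProbabilityMeasure S']
    (h : ∀ B C E, MeasurableSet B → MeasurableSet C → MeasurableSet E →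
      Tendsto (fun n => (S n).real (B ×ˢ C ×ˢ E)) atTop (𝓝 (S'.real (B ×ˢ C ×ˢ E)))) :
    ConvergesInLaw S S' := by
  let T : ℕ → ProbabilityMeasure (Yhat × 𝒜 × 𝒴) := fun n => ⟨S n, inferInstance⟩
  let T' : ProbabilityMeasure (Yhat × 𝒜 × 𝒴) := ⟨S', inferInstance⟩
  let Q : Set (Set (Yhat × 𝒜 × 𝒴)) := {s | ∃ (B : Set Yhat) (C : Set 𝒜) (E : Set 𝒴),
    MeasurableSet B ∧ MeasurableSet C ∧ MeasurableSet E ∧ s = B ×ˢ C ×ˢ E}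
  have hT : Tendsto T atTop (𝓝 T') := by
    -- Measurable rectangles form a π-system and contain a neighbourhood of each point inside any
    -- open set around it, which is the criterion for weak convergence.
    refine IsPiSystem.tendsto_probabilityMeasure_of_tendsto_of_mem (S := Q) ?_ ?_ ?_ ?_
    · rintro _ ⟨B, C, E, hB, hC, hE, rfl⟩ _ ⟨B', C', E', hB', hC', hE', rfl⟩ _
      refine ⟨B ∩ B', C ∩ C', E ∩ E', hB.inter hB', hC.inter hC', hE.inter hE', ?_⟩
      rw [Set.prod_inter_prod, Set.prod_inter_prod]
    · rintro _ ⟨B, C, E, hB, hC, hE, rfl⟩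
      exact hB.prod (hC.prod hE)
    · intro u hu x hx
      obtain ⟨B, V, hB, hV, hxB, hxV, hBV⟩ := isOpen_prod_iff.1 hu x.1 x.2 hx
      obtain ⟨C, E, hC, hE, hxC, hxE, hCE⟩ := isOpen_prod_iff.1 hV x.2.1 x.2.2 hxV
      refine ⟨B ×ˢ C ×ˢ E, ⟨B, C, E, hB.measurableSet, hC.measurableSet, hE.measurableSet, rfl⟩,
        (hB.prod (hC.prod hE)).mem_nhds ⟨hxB, hxC, hxE⟩, ?_⟩
      exact (Set.prod_mono_right hCE).trans hBV
    · rintro _ ⟨B, C, E, hB, hC, hE, rfl⟩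
      rw [← NNReal.tendsto_coe]
      exact h B C E hB hC hE
  exact ProbabilityMeasure.tendsto_iff_forall_integral_tendsto.1 hT

lemma ConvergesInLaw.unique {S : ℕ → Measure (Yhat × 𝒜 × 𝒴)}
    {S₁ S₂ : Measure (Yhat × 𝒜 × 𝒴)} [IsProbabilityMeasure S₁] [IsProbabilityMeasure S₂]
    (h₁ : ConvergesInLaw S S₁) (h₂ : ConvergesInLaw S S₂) : S₁ = S₂ :=
  ext_of_forall_integral_eq_of_IsFiniteMeasure fun g => tendsto_nhds_unique (h₁ g) (h₂ g)

variable {P : Measure (𝒳 × 𝒜 × 𝒴)} [IsProbabilityMeasure P] {ν : Measure 𝒴} [SigmaFinite ν]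
  {q r : 𝒜 → 𝒴 → ℝ≥0}

lemma isPopulationICPLaw_resampledLaw
    (hq : IsCondDensity P (fun z => z.2.1) (fun z => z.2.2) ν q)
    (hr : Measurable (Function.uncurry r))
    (hr1 : ∀ y, ∫⁻ a, r a y ∂(P.map Prod.snd).fst = 1)
    (hR : P.map Prod.snd = ((P.map Prod.snd).fst.prod (P.map Prod.snd).snd).withDensity
      fun z => (r z.1 z.2 : ℝ≥0∞)) {f : 𝒳 → Yhat} (hf : Measurable f) :
    IsPopulationICPLaw P q f (resampledLaw P (P.map Prod.snd).fst r f) := by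
  have hRp : IsProbabilityMeasure (P.map Prod.snd) :=
    Measure.isProbabilityMeasure_map measurable_snd.aemeasurable
  have hS' := isProbabilityMeasure_resampledLaw (P := P) hr hr1 hf
  have hS := fun n => isProbabilityMeasure_icpLaw hq n hf
  refine ⟨hS', convergesInLaw_of_tendsto_prod_prod fun B C E hB hC hE => ?_⟩
  rw [Metric.tendsto_atTop]
  intro ε hε
  obtain ⟨N, hN⟩ := exists_abs_icpLaw_sub_resampledLaw_le (Yhat := Yhat) hq hr hr1 hR hC
    (half_pos hε)
  exact ⟨N, fun n hn => (hN n hn f hf B E hB hE).trans_lt (half_lt_self hε)⟩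

end population

/-! ### Equalized odds from the laws of rectangles -/

section odds

variable {𝒳 𝒜 𝒴 Yhat : Type*} [MeasurableSpace 𝒳] [MeasurableSpace 𝒜] [MeasurableSpace 𝒴]
  [MeasurableSpace Yhat] {P : Measure (𝒳 × 𝒜 × 𝒴)} [IsProbabilityMeasure P] {r : 𝒜 → 𝒴 → ℝ≥0}

/-- The `σ`-algebra generated by the response. -/
abbrev responseAlgebra (𝒳 𝒜 𝒴 : Type*) [MeasurableSpace 𝒴] : MeasurableSpace (𝒳 × 𝒜 × 𝒴) :=
  MeasurableSpace.comap (fun z : 𝒳 × 𝒜 × 𝒴 => z.2.2) inferInstance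

lemma responseAlgebra_le :
    responseAlgebra 𝒳 𝒜 𝒴 ≤ (inferInstance : MeasurableSpace (𝒳 × 𝒜 × 𝒴)) :=
  measurable_response.comap_le

lemma measureReal_trueLaw_prod_prod {f : 𝒳 → Yhat} (hf : Measurable f) {B : Set Yhat} {C : Set 𝒜}
    {E : Set 𝒴} (hB : MeasurableSet B) (hC : MeasurableSet C) (hE : MeasurableSet E) :
    (trueLaw P f).real (B ×ˢ C ×ˢ E) = ∫ z in (fun z : 𝒳 × 𝒜 × 𝒴 => z.2.2) ⁻¹' E,
      {z : 𝒳 × 𝒜 × 𝒴 | f z.1 ∈ B ∧ z.2.1 ∈ C}.indicator (fun _ => (1 : ℝ)) z ∂P := by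
  have hm : Measurable fun z : 𝒳 × 𝒜 × 𝒴 => (f z.1, z.2.1, z.2.2) := by fun_prop
  have hBC : MeasurableSet {z : 𝒳 × 𝒜 × 𝒴 | f z.1 ∈ B ∧ z.2.1 ∈ C} :=
    ((hf.comp measurable_fst) hB).inter ((measurable_fst.comp measurable_snd) hC)
  rw [Measure.real, trueLaw, Measure.map_apply hm (hB.prod (hC.prod hE)),
    integral_indicator_const _ hBC, Measure.real, Measure.restrict_apply hBC, smul_eq_mul, mul_one]
  congr 2
  ext z
  simp [and_assoc]

/-- Tested on an event `Y ∈ E`, the identity says that `centred` integrates to zero against a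
function of `y`, which is `integral_mul_centred`. -/
lemma condProbY_attribute_ae_eq (hr : Measurable (Function.uncurry r))
    (hr1 : ∀ y, ∫⁻ a, r a y ∂(P.map Prod.snd).fst = 1)
    (hR : P.map Prod.snd = ((P.map Prod.snd).fst.prod (P.map Prod.snd).snd).withDensity
      fun z => (r z.1 z.2 : ℝ≥0∞)) {C : Set 𝒜} (hC : MeasurableSet C) :
    condProbY P {z | z.2.1 ∈ C} =ᵐ[P] fun z => condMass (P.map Prod.snd).fst r C z.2.2 := by
  have hRp : IsProbabilityMeasure (P.map Prod.snd) :=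
    Measure.isProbabilityMeasure_map measurable_snd.aemeasurable
  set μ := (P.map Prod.snd).fst with hμ
  have hcm : Measurable (condMass μ r C) := measurable_condMass hr
  have hCm : MeasurableSet {z : 𝒳 × 𝒜 × 𝒴 | z.2.1 ∈ C} :=
    (measurable_fst.comp measurable_snd) hC
  have hi1 : Integrable ({z : 𝒳 × 𝒜 × 𝒴 | z.2.1 ∈ C}.indicator fun _ => (1 : ℝ)) P :=
    (integrable_const _).indicator hCm
  have hi2 : Integrable (fun z : 𝒳 × 𝒜 × 𝒴 => condMass μ r C z.2.2) P :=
    Integrable.of_bound (hcm.comp measurable_response).aestronglyMeasurable 1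
      (ae_of_all _ fun z => by
        rw [Real.norm_eq_abs, abs_of_nonneg (condMass_nonneg _)]
        exact condMass_le_one hr (hr1 _))
  refine (ae_eq_condExp_of_forall_setIntegral_eq responseAlgebra_le hi1
    (fun _ _ _ => hi2.integrableOn) ?_ ?_).symm
  · rintro _ ⟨E, hE, rfl⟩ -
    have hEm : MeasurableSet ((fun z : 𝒳 × 𝒜 × 𝒴 => z.2.2) ⁻¹' E) := measurable_response hE
    have h0 : ∫ z, E.indicator (fun _ => (1 : ℝ)) z.2 * centred μ r C z ∂(P.map Prod.snd) = 0 := by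
      have hRp' : IsProbabilityMeasure ((μ.prod (P.map Prod.snd).snd).withDensity
          fun z => (r z.1 z.2 : ℝ≥0∞)) := hR ▸ hRp
      rw [hR]
      exact integral_mul_centred hr hr1 hC (measurable_const.indicator hE) (M := 1) fun y => by
        by_cases h : y ∈ E <;> simp [h]
    have hm : Measurable fun z : 𝒜 × 𝒴 =>
        E.indicator (fun _ => (1 : ℝ)) z.2 * centred μ r C z :=
      ((measurable_const.indicator hE).comp measurable_snd).mul (measurable_centred hr hC)
    rw [integral_map measurable_snd.aemeasurable hm.aestronglyMeasurable] at h0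
    rw [eq_comm, ← sub_eq_zero, ← integral_sub hi1.integrableOn hi2.integrableOn,
      ← integral_indicator hEm, ← h0]
    refine integral_congr_ae (ae_of_all _ fun z => ?_)
    by_cases h1 : z.2.2 ∈ E <;> by_cases h2 : z.2.1 ∈ C <;>
      simp [Set.indicator, h1, h2, centred]
  · refine (StronglyMeasurable.aestronglyMeasurable ?_)
    exact (hcm.comp (comap_measurable _)).stronglyMeasurable

/-- The distance of `(f X, A, Y)` from conditional independence is controlled by the distance of its
law from the resampled law on rectangles. -/
theorem integral_abs_condProbY_sub_le (hr : Measurable (Function.uncurry r))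
    (hr1 : ∀ y, ∫⁻ a, r a y ∂(P.map Prod.snd).fst = 1)
    (hR : P.map Prod.snd = ((P.map Prod.snd).fst.prod (P.map Prod.snd).snd).withDensity
      fun z => (r z.1 z.2 : ℝ≥0∞)) {f : 𝒳 → Yhat} (hf : Measurable f) {B : Set Yhat} {C : Set 𝒜}
    (hB : MeasurableSet B) (hC : MeasurableSet C) {ε : ℝ}
    (h : ∀ E : Set 𝒴, MeasurableSet E → |(trueLaw P f).real (B ×ˢ C ×ˢ E) -
      (resampledLaw P (P.map Prod.snd).fst r f).real (B ×ˢ C ×ˢ E)| ≤ ε) :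
    Integrable (fun z => condProbY P {z | f z.1 ∈ B ∧ z.2.1 ∈ C} z -
      condProbY P {z | f z.1 ∈ B} z * condProbY P {z | z.2.1 ∈ C} z) P ∧
    ∫ z, |condProbY P {z | f z.1 ∈ B ∧ z.2.1 ∈ C} z -
      condProbY P {z | f z.1 ∈ B} z * condProbY P {z | z.2.1 ∈ C} z| ∂P ≤ 2 * ε := by
  have hRp : IsProbabilityMeasure (P.map Prod.snd) :=
    Measure.isProbabilityMeasure_map measurable_snd.aemeasurable
  set μ := (P.map Prod.snd).fst with hμ
  have hcm : Measurable (condMass μ r C) := measurable_condMass hr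
  have hBm : MeasurableSet {z : 𝒳 × 𝒜 × 𝒴 | f z.1 ∈ B} := (hf.comp measurable_fst) hB
  have hBCm : MeasurableSet {z : 𝒳 × 𝒜 × 𝒴 | f z.1 ∈ B ∧ z.2.1 ∈ C} :=
    hBm.inter ((measurable_fst.comp measurable_snd) hC)
  set iB : 𝒳 × 𝒜 × 𝒴 → ℝ := {z : 𝒳 × 𝒜 × 𝒴 | f z.1 ∈ B}.indicator fun _ => (1 : ℝ) with hiB
  set iBC : 𝒳 × 𝒜 × 𝒴 → ℝ :=
    {z : 𝒳 × 𝒜 × 𝒴 | f z.1 ∈ B ∧ z.2.1 ∈ C}.indicator fun _ => (1 : ℝ) with hiBC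
  set c : 𝒳 × 𝒜 × 𝒴 → ℝ := fun z => condMass μ r C z.2.2 with hc
  have hcm' : Measurable c := hcm.comp measurable_response
  have hcsm : StronglyMeasurable[responseAlgebra 𝒳 𝒜 𝒴] c :=
    (hcm.comp (comap_measurable _)).stronglyMeasurable
  have hc1 : ∀ z, ‖c z‖ ≤ 1 := fun z => by
    rw [Real.norm_eq_abs, abs_of_nonneg (condMass_nonneg _)]
    exact condMass_le_one hr (hr1 _)
  have iiB : Integrable iB P := (integrable_const _).indicator hBm
  have iiBC : Integrable iBC P := (integrable_const _).indicator hBCm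
  have iiBc : Integrable (iB * c) P :=
    iiB.mul_bdd hcm'.aestronglyMeasurable (ae_of_all _ hc1)
  set k : 𝒳 × 𝒜 × 𝒴 → ℝ := iBC - iB * c with hk
  have ik : Integrable k P := iiBC.sub iiBc
  set η := P[k | responseAlgebra 𝒳 𝒜 𝒴] with hη
  -- The conditional mass `c` is a function of `Y`, so it can be pulled out of the conditional
  -- expectation. The departure from independence is then `η`, whose integral over `Y ∈ E` is the
  -- difference of the two laws on `B ×ˢ C ×ˢ E`.
  have hae : (fun z => condProbY P {z | f z.1 ∈ B ∧ z.2.1 ∈ C} z -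
      condProbY P {z | f z.1 ∈ B} z * condProbY P {z | z.2.1 ∈ C} z) =ᵐ[P] η := by
    have h1 : η =ᵐ[P] P[iBC | responseAlgebra 𝒳 𝒜 𝒴] - P[iB * c | responseAlgebra 𝒳 𝒜 𝒴] :=
      condExp_sub iiBC iiBc _
    have h2 : P[iB * c | responseAlgebra 𝒳 𝒜 𝒴] =ᵐ[P] P[iB | responseAlgebra 𝒳 𝒜 𝒴] * c :=
      condExp_mul_of_stronglyMeasurable_right hcsm iiBc iiB
    filter_upwards [h1, h2, condProbY_attribute_ae_eq hr hr1 hR hC] with z e1 e2 e3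
    rw [e1, Pi.sub_apply, e2, e3]
    rfl
  have hset : ∀ E : Set 𝒴, MeasurableSet E →
      |∫ z in (fun z : 𝒳 × 𝒜 × 𝒴 => z.2.2) ⁻¹' E, η z ∂P| ≤ ε := by
    intro E hE
    have hEm : MeasurableSet ((fun z : 𝒳 × 𝒜 × 𝒴 => z.2.2) ⁻¹' E) := measurable_response hE
    rw [setIntegral_condExp responseAlgebra_le ik ⟨E, hE, rfl⟩]
    convert h E hE using 2
    rw [measureReal_trueLaw_prod_prod hf hB hC hE,
      measureReal_resampledLaw_prod_prod hr hr1 hf hB hC hE, hk]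
    have : ∫ z, (predEvent f B E).indicator (fun _ => (1 : ℝ)) z * condMass μ r C z.2.2 ∂P =
        ∫ z in (fun z : 𝒳 × 𝒜 × 𝒴 => z.2.2) ⁻¹' E, (iB * c) z ∂P := by
      rw [← integral_indicator hEm]
      refine integral_congr_ae (ae_of_all _ fun z => ?_)
      by_cases h1 : z.2.2 ∈ E <;> by_cases h2 : f z.1 ∈ B <;>
        simp [Set.indicator, h1, h2, predEvent, hiB, hc]
    rw [this, ← integral_sub iiBC.integrableOn iiBc.integrableOn]
    rfl
  have hηi : Integrable η P := integrable_condExp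
  have hηm : Measurable[responseAlgebra 𝒳 𝒜 𝒴] η := stronglyMeasurable_condExp.measurable
  refine ⟨hηi.congr hae.symm, ?_⟩
  -- The set where `η ≥ 0` is an event about `Y`, so the rectangle bound controls both the positive
  -- and the negative part. This is the source of `2 * ε`.
  obtain ⟨E, hE, hEη⟩ : ∃ E : Set 𝒴, MeasurableSet E ∧
      (fun z : 𝒳 × 𝒜 × 𝒴 => z.2.2) ⁻¹' E = {z | 0 ≤ η z} :=
    hηm measurableSet_Ici
  have hEm : MeasurableSet ((fun z : 𝒳 × 𝒜 × 𝒴 => z.2.2) ⁻¹' E) := measurable_response hE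
  have hpos : ∫ z in (fun z : 𝒳 × 𝒜 × 𝒴 => z.2.2) ⁻¹' E, |η z| ∂P ≤ ε := by
    rw [setIntegral_congr_fun hEm (g := η) fun z hz => by
      rw [hEη] at hz; exact abs_of_nonneg hz]
    exact (le_abs_self _).trans (hset E hE)
  have hneg : ∫ z in ((fun z : 𝒳 × 𝒜 × 𝒴 => z.2.2) ⁻¹' E)ᶜ, |η z| ∂P ≤ ε := by
    rw [setIntegral_congr_fun hEm.compl (g := fun z => -η z) fun z hz => by
      rw [hEη] at hz; exact abs_of_neg (not_le.1 hz), integral_neg]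
    exact (neg_le_abs _).trans (hset Eᶜ hE.compl)
  calc _ = ∫ z, |η z| ∂P := integral_congr_ae (by filter_upwards [hae] with z hz; rw [hz])
    _ ≤ 2 * ε := by
      rw [← integral_add_compl hEm hηi.abs]
      linarith

lemma asymptoticEqualizedOdds_of_trueLaw_eq_icpLaw {ν : Measure 𝒴} [SigmaFinite ν]
    {q : 𝒜 → 𝒴 → ℝ≥0} (hq : IsCondDensity P (fun z => z.2.1) (fun z => z.2.2) ν q)
    (hr : Measurable (Function.uncurry r))
    (hr1 : ∀ y, ∫⁻ a, r a y ∂(P.map Prod.snd).fst = 1)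
    (hR : P.map Prod.snd = ((P.map Prod.snd).fst.prod (P.map Prod.snd).snd).withDensity
      fun z => (r z.1 z.2 : ℝ≥0∞)) {f : ℕ → 𝒳 → Yhat} (hf : ∀ n, Measurable (f n))
    (h : ∀ n, trueLaw P (f n) = icpLaw P q n (f n)) : AsymptoticEqualizedOdds P f := by
  intro B C hB hC
  rw [Metric.tendsto_atTop]
  intro ε hε
  obtain ⟨N, hN⟩ := exists_abs_icpLaw_sub_resampledLaw_le (Yhat := Yhat) hq hr hr1 hR hC
    (show 0 < ε / 4 by positivity)
  refine ⟨N, fun n hn => ?_⟩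
  have := (integral_abs_condProbY_sub_le hr hr1 hR (hf n) hB hC (ε := ε / 4) fun E hE => by
    rw [h n]; exact hN n hn (f n) (hf n) B E hB hE).2
  rw [Real.dist_eq, sub_zero, abs_of_nonneg (integral_nonneg fun _ => abs_nonneg _)]
  linarith

lemma equalizedOdds_of_trueLaw_eq_resampledLaw [StandardBorelSpace (𝒳 × 𝒜 × 𝒴)]
    (hr : Measurable (Function.uncurry r))
    (hr1 : ∀ y, ∫⁻ a, r a y ∂(P.map Prod.snd).fst = 1)
    (hR : P.map Prod.snd = ((P.map Prod.snd).fst.prod (P.map Prod.snd).snd).withDensity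
      fun z => (r z.1 z.2 : ℝ≥0∞)) {f : 𝒳 → Yhat} (hf : Measurable f)
    (h : trueLaw P f = resampledLaw P (P.map Prod.snd).fst r f) : EqualizedOdds P f := by
  rw [EqualizedOdds, condIndepFun_iff_condExp_inter_preimage_eq_mul
    (show Measurable fun z : 𝒳 × 𝒜 × 𝒴 => f z.1 from hf.comp measurable_fst)
    (show Measurable fun z : 𝒳 × 𝒜 × 𝒴 => z.2.1 from measurable_fst.comp measurable_snd)]
  intro B C hB hC
  -- Equal laws allow `ε = 0`, so the difference of conditional probabilities vanishes almost
  -- surely.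
  obtain ⟨hi, hle⟩ := integral_abs_condProbY_sub_le hr hr1 hR hf hB hC (ε := 0) fun E hE => by
    simp [h]
  rw [mul_zero] at hle
  have h0 := (integral_eq_zero_iff_of_nonneg (fun _ => abs_nonneg _) hi.abs).1
    (le_antisymm hle (integral_nonneg fun _ => abs_nonneg _))
  filter_upwards [h0] with z hz
  exact sub_eq_zero.1 (abs_eq_zero.1 hz)

end odds

/-! ### Extended-real expectations and Gibbs' inequality -/

section expectation

variable {Ω : Type*} [MeasurableSpace Ω] {P : Measure Ω}

lemma eexp_coe {f : Ω → ℝ} (hf : Integrable f P) :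
    eexp P (fun ω => (f ω : EReal)) = ((∫ ω, f ω ∂P : ℝ) : EReal) := by
  have h₁ : ∫⁻ ω, ENNReal.ofReal (f ω) ∂P ≠ ∞ := hf.lintegral_lt_top.ne
  have h₂ : ∫⁻ ω, ENNReal.ofReal (-f ω) ∂P ≠ ∞ := hf.neg.lintegral_lt_top.ne
  rw [integral_eq_lintegral_pos_part_sub_lintegral_neg_part hf, EReal.coe_sub,
    EReal.coe_ennreal_toReal h₁, EReal.coe_ennreal_toReal h₂, eexp]
  simp_rw [← EReal.coe_neg, EReal.real_coe_toENNReal]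

lemma eexp_mono_ae {f g : Ω → EReal} (h : f ≤ᵐ[P] g) : eexp P f ≤ eexp P g := by
  refine EReal.sub_le_sub (EReal.coe_ennreal_le_coe_ennreal_iff.2 <| lintegral_mono_ae ?_)
    (EReal.coe_ennreal_le_coe_ennreal_iff.2 <| lintegral_mono_ae ?_)
  · filter_upwards [h] with ω hω using EReal.toENNReal_le_toENNReal hω
  · filter_upwards [h] with ω hω using EReal.toENNReal_le_toENNReal (EReal.neg_le_neg_iff.2 hω)

lemma eexp_nonneg {f : Ω → EReal} (h : ∀ ω, 0 ≤ f ω) : 0 ≤ eexp P f := by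
  have h0 : ∀ ω, (-f ω).toENNReal = 0 := fun ω =>
    EReal.toENNReal_of_nonpos (by simpa using EReal.neg_le_neg_iff.2 (h ω))
  simp [eexp, h0, EReal.coe_ennreal_nonneg]

lemma negLog_coe {x : ℝ≥0} (hx : x ≠ 0) : negLog (x : ℝ≥0∞) = ((-Real.log x : ℝ) : EReal) := by
  rw [negLog, ENNReal.log_of_nnreal hx, EReal.coe_neg]

lemma negLog_ofReal {x : ℝ} (hx : 0 < x) :
    negLog (ENNReal.ofReal x) = ((-Real.log x : ℝ) : EReal) := by
  rw [negLog, ENNReal.log_ofReal_of_pos hx, EReal.coe_neg]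

lemma negLog_nonneg {x : ℝ≥0∞} (hx : x ≤ 1) : 0 ≤ negLog x := by
  have h := ENNReal.log_le_log_iff.2 hx
  rw [ENNReal.log_one] at h
  rw [negLog, ← neg_zero]
  exact EReal.neg_le_neg_iff.2 h

/-- Pointwise form of Gibbs' inequality. -/
lemma neg_log_add_one_sub_div_le_negLog (u : ℝ≥0) {v : ℝ≥0} (hv : v ≠ 0) :
    ((-Real.log v + 1 - u / v : ℝ) : EReal) ≤ negLog (u : ℝ≥0∞) := by
  rcases eq_or_ne u 0 with rfl | hu
  · simp [negLog]
  · rw [negLog_coe hu, EReal.coe_le_coe_iff]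
    have hu' : (0 : ℝ) < u := by positivity
    have hv' : (0 : ℝ) < v := by positivity
    have h := Real.log_le_sub_one_of_pos (div_pos hu' hv')
    rw [Real.log_div hu'.ne' hv'.ne'] at h
    linarith

/-- **Gibbs' inequality**, with the density ratio integrating to at most one. -/
lemma integral_neg_log_le_eexp_negLog [IsProbabilityMeasure P] {u v : Ω → ℝ≥0}
    (hu : Measurable u) (hv : Measurable v) (hv0 : ∀ᵐ ω ∂P, v ω ≠ 0)
    (hlog : Integrable (fun ω => Real.log (v ω)) P)
    (h : ∫⁻ ω, ((u ω / v ω : ℝ≥0) : ℝ≥0∞) ∂P ≤ 1) :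
    ((∫ ω, -Real.log (v ω) ∂P : ℝ) : EReal) ≤ eexp P fun ω => negLog (u ω) := by
  have hw : Measurable fun ω => u ω / v ω := hu.div hv
  have hwi : Integrable (fun ω => ((u ω / v ω : ℝ≥0) : ℝ)) P := by
    refine ⟨hw.coe_nnreal_real.aestronglyMeasurable, ?_⟩
    simp only [HasFiniteIntegral, NNReal.enorm_eq]
    exact h.trans_lt ENNReal.one_lt_top
  have hw1 : ∫ ω, ((u ω / v ω : ℝ≥0) : ℝ) ∂P ≤ 1 := by
    rw [integral_eq_lintegral_of_nonneg_ae (.of_forall fun _ => NNReal.coe_nonneg _)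
      hw.coe_nnreal_real.aestronglyMeasurable]
    simp only [ENNReal.ofReal_coe_nnreal]
    exact ENNReal.toReal_mono ENNReal.one_ne_top h
  have hneg : Integrable (fun ω => -Real.log (v ω)) P := hlog.neg
  have hadd : Integrable (fun ω => -Real.log (v ω) + 1) P := hneg.add (integrable_const 1)
  have hi : Integrable (fun ω => -Real.log (v ω) + 1 - ((u ω / v ω : ℝ≥0) : ℝ)) P :=
    hadd.sub hwi
  calc ((∫ ω, -Real.log (v ω) ∂P : ℝ) : EReal)
      ≤ ((∫ ω, (-Real.log (v ω) + 1 - ((u ω / v ω : ℝ≥0) : ℝ)) ∂P : ℝ) : EReal) := by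
        rw [EReal.coe_le_coe_iff, integral_sub hadd hwi,
          integral_add hneg (integrable_const 1)]
        simp only [integral_const, probReal_univ, smul_eq_mul, mul_one]
        linarith
    _ = eexp P fun ω => ((-Real.log (v ω) + 1 - ((u ω / v ω : ℝ≥0) : ℝ) : ℝ) : EReal) :=
        (eexp_coe hi).symm
    _ ≤ eexp P fun ω => negLog (u ω) := by
        refine eexp_mono_ae ?_
        filter_upwards [hv0] with ω hω
        rw [NNReal.coe_div]
        exact neg_log_add_one_sub_div_le_negLog (u ω) hω

end expectation

/-- Gibbs' inequality for the ratio `p' / p`: the true density is almost surely nonzero, and the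
mean of the ratio is the mass that the model puts where `p` is nonzero, at most one. -/
lemma condEntropy_le_lossF {𝒳 𝒜 𝒴 : Type*} [MeasurableSpace 𝒳] [MeasurableSpace 𝒜]
    [MeasurableSpace 𝒴] {P : Measure (𝒳 × 𝒜 × 𝒴)} [IsProbabilityMeasure P] {ν : Measure 𝒴}
    [SigmaFinite ν] {p p' : 𝒳 → 𝒴 → ℝ≥0}
    (hp : IsCondDensity P (fun z => z.1) (fun z => z.2.2) ν p)
    (hlog : Integrable (fun z : 𝒳 × 𝒜 × 𝒴 => Real.log (p z.1 z.2.2)) P)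
    (hp' : Measurable (Function.uncurry p')) (hp'1 : ∀ x, ∫⁻ y, p' x y ∂ν = 1) :
    (condEntropy P p : EReal) ≤ lossF P p' := by
  obtain ⟨hpm, hpd⟩ := hp
  have hX : IsProbabilityMeasure (P.map fun z : 𝒳 × 𝒜 × 𝒴 => z.1) :=
    Measure.isProbabilityMeasure_map (by fun_prop)
  have hm : Measurable fun z : 𝒳 × 𝒜 × 𝒴 => (z.1, z.2.2) := by fun_prop
  have hp2 : Measurable fun w : 𝒳 × 𝒴 => p w.1 w.2 := hpm
  have hp2' : Measurable fun w : 𝒳 × 𝒴 => p' w.1 w.2 := hp'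
  have hpush (g : 𝒳 × 𝒴 → ℝ≥0∞) (hg : Measurable g) : ∫⁻ z, g (z.1, z.2.2) ∂P =
      ∫⁻ w, (p w.1 w.2 : ℝ≥0∞) * g w ∂((P.map fun z : 𝒳 × 𝒜 × 𝒴 => z.1).prod ν) := by
    rw [← lintegral_map hg hm, hpd, lintegral_withDensity_eq_lintegral_mul _
      hp2.coe_nnreal_ennreal hg]
    rfl
  have hS : MeasurableSet {w : 𝒳 × 𝒴 | p w.1 w.2 = 0} := hp2 (measurableSet_singleton 0)
  refine integral_neg_log_le_eexp_negLog (u := fun z : 𝒳 × 𝒜 × 𝒴 => p' z.1 z.2.2)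
    (v := fun z : 𝒳 × 𝒜 × 𝒴 => p z.1 z.2.2) (hp2'.comp hm) (hp2.comp hm) ?_ hlog ?_
  · have h0 := hpush ({w : 𝒳 × 𝒴 | p w.1 w.2 = 0}.indicator 1) (measurable_one.indicator hS)
    have h1 : ∀ w : 𝒳 × 𝒴, (p w.1 w.2 : ℝ≥0∞) *
        {w : 𝒳 × 𝒴 | p w.1 w.2 = 0}.indicator 1 w = 0 := fun w => by
      by_cases hw : p w.1 w.2 = 0 <;> simp [hw]
    simp only [h1, lintegral_zero] at h0
    rw [lintegral_eq_zero_iff (show Measurable fun z : 𝒳 × 𝒜 × 𝒴 =>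
      {w : 𝒳 × 𝒴 | p w.1 w.2 = 0}.indicator (1 : 𝒳 × 𝒴 → ℝ≥0∞) (z.1, z.2.2) from
      (measurable_one.indicator hS).comp hm)] at h0
    filter_upwards [h0] with z hz hz0
    simp [hz0] at hz
  · rw [hpush (fun w => ((p' w.1 w.2 / p w.1 w.2 : ℝ≥0) : ℝ≥0∞))
      (hp2'.div hp2).coe_nnreal_ennreal]
    calc _ ≤ ∫⁻ w, (p' w.1 w.2 : ℝ≥0∞) ∂((P.map fun z : 𝒳 × 𝒜 × 𝒴 => z.1).prod ν) := by
          refine lintegral_mono fun w => ?_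
          rw [← ENNReal.coe_mul, ENNReal.coe_le_coe]
          rcases eq_or_ne (p w.1 w.2) 0 with hw | hw
          · simp [hw]
          · rw [mul_div_cancel₀ _ hw]
      _ = 1 := by
          rw [lintegral_prod _ hp2'.coe_nnreal_ennreal.aemeasurable]
          simp [hp'1]

/-! ### Optimal discriminators -/

section discriminator

variable {𝒵 : Type*} [MeasurableSpace 𝒵] {R S : Measure 𝒵}

lemma lossD_nonneg (E : 𝒵 → unitInterval) : 0 ≤ lossD R S E :=
  add_nonneg
    (eexp_nonneg fun z => negLog_nonneg (ENNReal.ofReal_le_one.2 (E z).2.2))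
    (eexp_nonneg fun z => negLog_nonneg (ENNReal.ofReal_le_one.2 (by linarith [(E z).2.1])))

lemma eexp_const_negLog [IsProbabilityMeasure R] {x : ℝ} (hx : 0 < x) :
    eexp R (fun _ => negLog (ENNReal.ofReal x)) = ((-Real.log x : ℝ) : EReal) := by
  simp_rw [negLog_ofReal hx]
  rw [eexp_coe (integrable_const _)]
  simp

/-- The benchmark `log 4`: this discriminator has the same loss whatever the two laws are. -/
lemma lossD_half [IsProbabilityMeasure R] [IsProbabilityMeasure S] :
    lossD R S (fun _ => ⟨1 / 2, by norm_num, by norm_num⟩) = (Real.log 4 : EReal) := by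
  have h4 : Real.log 4 = 2 * Real.log 2 := by
    rw [show (4 : ℝ) = 2 ^ 2 by norm_num, Real.log_pow]; norm_num
  have h2 : Real.log (1 / 2) = -Real.log 2 := by rw [one_div, Real.log_inv]
  simp only [lossD]
  rw [eexp_const_negLog (by norm_num), eexp_const_negLog (by norm_num), ← EReal.coe_add,
    show (1 : ℝ) - 1 / 2 = 1 / 2 by norm_num, h2, h4]
  congr 1
  ring

lemma eexp_negLog_step [IsProbabilityMeasure R] {B : Set 𝒵} (hB : MeasurableSet B) {x y : ℝ}
    (hx : 0 < x) (hy : 0 < y) {g : 𝒵 → ℝ} (hg : ∀ z ∈ B, g z = x) (hg' : ∀ z ∉ B, g z = y) :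
    eexp R (fun z => negLog (ENNReal.ofReal (g z))) =
      ((-(R.real B * Real.log x + (1 - R.real B) * Real.log y) : ℝ) : EReal) := by
  have h : (fun z => negLog (ENNReal.ofReal (g z))) = fun z =>
      ((B.indicator (fun _ => -Real.log x + Real.log y) z + -Real.log y : ℝ) : EReal) := by
    ext z
    by_cases hz : z ∈ B
    · rw [hg z hz, negLog_ofReal hx]; simp [hz]
    · rw [hg' z hz, negLog_ofReal hy]; simp [hz]
  have hi : Integrable (B.indicator fun _ => -Real.log x + Real.log y) R :=
    (integrable_const _).indicator hB
  have hi' : Integrable (fun z => B.indicator (fun _ => -Real.log x + Real.log y) z + -Real.log y)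
      R := hi.add (integrable_const _)
  rw [h, eexp_coe hi', integral_add hi (integrable_const _),
    integral_indicator_const _ hB, integral_const, probReal_univ, smul_eq_mul, one_smul]
  congr 1
  ring

/-- A set on which `R` charges more than `S` gives a discriminator beating the constant `1 / 2`. -/
lemma measureReal_le_of_log_four_le_lossD [IsProbabilityMeasure R] [IsProbabilityMeasure S]
    (h : ∀ E : 𝒵 → unitInterval, Measurable E → (Real.log 4 : EReal) ≤ lossD R S E)
    {B : Set 𝒵} (hB : MeasurableSet B) : R.real B ≤ S.real B := by
  classical
  by_contra! hlt
  set a := R.real B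
  set b := S.real B
  have ha1 : a ≤ 1 := measureReal_le_one
  have hb0 : 0 ≤ b := measureReal_nonneg
  -- Raising the discriminator from `1/2` to `(1 + u) / 2` on `B` lowers the loss by `a log (1 + u)
  -- + b log (1 - u)`. By `log x ≥ 1 - 1 / x` this is at least a positive multiple of `a - b - u (a
  -- + b)`; since `a + b ≤ 2`, the choice of `u` keeps this positive.
  obtain ⟨u, hu⟩ : ∃ u, u = (a - b) / 4 := ⟨_, rfl⟩
  have hu0 : 0 < u := by linarith
  have hu1 : u ≤ 1 / 4 := by linarith
  let E : 𝒵 → unitInterval := fun z => if z ∈ B then ⟨(1 + u) / 2, by linarith, by linarith⟩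
    else ⟨1 / 2, by norm_num, by norm_num⟩
  have hE : Measurable E := Measurable.ite hB measurable_const measurable_const
  have hEB : ∀ z ∈ B, (E z : ℝ) = (1 + u) / 2 := fun z hz => by simp [E, hz]
  have hEB' : ∀ z ∉ B, (E z : ℝ) = 1 / 2 := fun z hz => by simp [E, hz]
  have key := h E hE
  rw [lossD, eexp_negLog_step hB (x := (1 + u) / 2) (y := 1 / 2) (by linarith) (by norm_num)
      hEB hEB',
    eexp_negLog_step hB (x := (1 - u) / 2) (y := 1 / 2) (by linarith) (by norm_num)
      (fun z hz => by rw [hEB z hz]; ring) (fun z hz => by rw [hEB' z hz]; ring),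
    ← EReal.coe_add, EReal.coe_le_coe_iff] at key
  have h4 : Real.log 4 = 2 * Real.log 2 := by
    rw [show (4 : ℝ) = 2 ^ 2 by norm_num, Real.log_pow]; norm_num
  rw [Real.log_div (show 1 + u ≠ 0 by linarith) (by norm_num),
    Real.log_div (show 1 - u ≠ 0 by linarith) (by norm_num),
    Real.log_div one_ne_zero (by norm_num), Real.log_one, h4] at key
  have hl₁ := Real.one_sub_inv_le_log_of_pos (show 0 < 1 + u by linarith)
  have hl₂ := Real.one_sub_inv_le_log_of_pos (show 0 < 1 - u by linarith)
  have hsum : a * Real.log (1 + u) + b * Real.log (1 - u) ≤ 0 := by linarith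
  have hpos : 0 < a * (1 - (1 + u)⁻¹) + b * (1 - (1 - u)⁻¹) := by
    have h₁ : (0 : ℝ) < 1 + u := by linarith
    have h₂ : (0 : ℝ) < 1 - u := by linarith
    have he : a * (1 - (1 + u)⁻¹) + b * (1 - (1 - u)⁻¹) =
        u * (a - b - u * (a + b)) / ((1 + u) * (1 - u)) := by
      field_simp
      ring
    rw [he]
    have hub : u * (a + b) ≤ u * 2 := by
      apply mul_le_mul_of_nonneg_left _ hu0.le
      linarith
    exact div_pos (mul_pos hu0 (by linarith)) (mul_pos h₁ h₂)
  have := mul_le_mul_of_nonneg_left hl₁ (hb0.trans hlt.le)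
  have := mul_le_mul_of_nonneg_left hl₂ hb0
  linarith

/-- The one-sided bound on a set and on its complement gives equality, both total masses being one.
-/
lemma eq_of_log_four_le_lossD [IsProbabilityMeasure R] [IsProbabilityMeasure S]
    (h : ∀ E : 𝒵 → unitInterval, Measurable E → (Real.log 4 : EReal) ≤ lossD R S E) : R = S := by
  refine Measure.ext fun B hB => ?_
  have h₁ := measureReal_le_of_log_four_le_lossD h hB
  have h₂ := measureReal_le_of_log_four_le_lossD h hB.compl
  rw [probReal_compl_eq_one_sub hB, probReal_compl_eq_one_sub hB] at h₂
  exact (measureReal_eq_measureReal_iff).1 (le_antisymm h₁ (by linarith))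

end discriminator

/-! ### Minimax solutions -/

/-- A finite objective forces both losses to be finite: `L = ⊤` would give `⊥` whatever `F` is, and
`F = ⊤` with `L` finite would give `⊤`. -/
lemma exists_coe_of_mul_sub_mul_eq_coe {μ v : ℝ} (hμ0 : 0 < μ) (hμ1 : μ < 1) {F L : EReal}
    (hF : F ≠ ⊥) (hL : L ≠ ⊥)
    (h : ((1 - μ : ℝ) : EReal) * F - (μ : EReal) * L = v) :
    ∃ x y : ℝ, F = x ∧ L = y ∧ (1 - μ) * x - μ * y = v := by
  have h1 : 0 < 1 - μ := by linarith
  induction L with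
  | bot => exact absurd rfl hL
  | top => simp [EReal.coe_mul_top_of_pos hμ0, EReal.sub_top] at h
  | coe y =>
    induction F with
    | bot => exact absurd rfl hF
    | top =>
      rw [EReal.coe_mul_top_of_pos h1, ← EReal.coe_mul, EReal.top_sub_coe] at h
      simp at h
    | coe x => exact ⟨x, y, rfl, rfl, by exact_mod_cast h⟩

theorem IsMinimaxSolution.minimizes_and_trueLaw_eq {𝒳 𝒜 𝒴 Yhat Θf Θd : Type*}
    [MeasurableSpace 𝒳] [MeasurableSpace 𝒜] [MeasurableSpace 𝒴] [MeasurableSpace Yhat]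
    {P : Measure (𝒳 × 𝒜 × 𝒴)} [IsProbabilityMeasure P] {ν : Measure 𝒴} [SigmaFinite ν]
    {p : 𝒳 → 𝒴 → ℝ≥0} (hp : IsCondDensity P (fun z => z.1) (fun z => z.2.2) ν p)
    (hlog : Integrable (fun z : 𝒳 × 𝒜 × 𝒴 => Real.log (p z.1 z.2.2)) P)
    {M : PredictionModel Θf 𝒳 𝒴 Yhat ν} {D : Θd → Yhat × 𝒜 × 𝒴 → unitInterval}
    {S : Θf → Measure (Yhat × 𝒜 × 𝒴)} {μ : ℝ} (hμ0 : 0 < μ) (hμ1 : μ < 1)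
    {θf : Θf} {θd : Θd} (hS : IsProbabilityMeasure (S θf))
    (hrich : IsRich D (trueLaw P (M.pred θf)) (S θf))
    (hsol : IsMinimaxSolution (objective P M D S μ) θf θd)
    (hval : objective P M D S μ θf θd =
      (((1 - μ) * condEntropy P p - μ * Real.log 4 : ℝ) : EReal)) :
    (∀ θ, lossF P (M.lik θf) ≤ lossF P (M.lik θ)) ∧ trueLaw P (M.pred θf) = S θf := by
  have hgibbs : ∀ θ, (condEntropy P p : EReal) ≤ lossF P (M.lik θ) := fun θ =>
    condEntropy_le_lossF hp hlog (M.measurable_lik θ) (M.lintegral_lik θ)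
  have hR : IsProbabilityMeasure (trueLaw P (M.pred θf)) := by
    have := M.measurable_pred θf
    exact Measure.isProbabilityMeasure_map (by fun_prop)
  obtain ⟨x, y, hx, hy, hxy⟩ := exists_coe_of_mul_sub_mul_eq_coe hμ0 hμ1
    (ne_bot_of_le_ne_bot (EReal.coe_ne_bot _) (hgibbs θf))
    (ne_bot_of_le_ne_bot EReal.zero_ne_bot (lossD_nonneg _)) hval
  have hHx : condEntropy P p ≤ x := by
    have := hgibbs θf
    rwa [hx, EReal.coe_le_coe_iff] at this
  -- Maximizing the objective over discriminators at fixed `θf` means minimizing the discriminator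
  -- loss, because `lossF` is a finite constant there. Richness then extends the bound to all
  -- measurable discriminators.
  have hinf : ∀ θ, (y : EReal) ≤ lossD (trueLaw P (M.pred θf)) (S θf) (D θ) := by
    intro θ
    have hle := hsol.1 θ
    rw [hval, ← hxy, objective, hx] at hle
    have h0 := lossD_nonneg (R := trueLaw P (M.pred θf)) (S := S θf) (D θ)
    generalize lossD (trueLaw P (M.pred θf)) (S θf) (D θ) = L at hle h0
    induction L with
    | bot => simp at h0
    | top => exact le_top
    | coe l =>
      have hle' : (1 - μ) * x - μ * l ≤ (1 - μ) * x - μ * y := by exact_mod_cast hle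
      rw [EReal.coe_le_coe_iff]
      exact le_of_mul_le_mul_left (by linarith) hμ0
  have hall : ∀ E : Yhat × 𝒜 × 𝒴 → unitInterval, Measurable E →
      (y : EReal) ≤ lossD (trueLaw P (M.pred θf)) (S θf) E := fun E hE =>
    (le_iInf hinf).trans (hrich E hE)
  have hy4 : y ≤ Real.log 4 := by
    have := hall _ (measurable_const (a := (⟨1 / 2, by norm_num, by norm_num⟩ : unitInterval)))
    rwa [lossD_half, EReal.coe_le_coe_iff] at this
  -- By the prescribed value these two nonnegative slacks sum to zero, so both vanish.
  have h₁ : 0 ≤ (1 - μ) * (x - condEntropy P p) := mul_nonneg (by linarith) (by linarith)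
  have h₂ : 0 ≤ μ * (Real.log 4 - y) := mul_nonneg hμ0.le (by linarith)
  have hxH : x = condEntropy P p := by
    have : (1 - μ) * (x - condEntropy P p) = 0 := by linarith
    rcases mul_eq_zero.1 this with h | h <;> linarith
  have hyl : y = Real.log 4 := by
    have : μ * (Real.log 4 - y) = 0 := by linarith
    rcases mul_eq_zero.1 this with h | h <;> linarith
  refine ⟨fun θ => ?_, eq_of_log_four_le_lossD (hyl ▸ hall)⟩
  rw [hx, hxH]
  exact hgibbs θ

end FairICP

/-! ### Assembly of the two mechanisms -/

theorem theorem2p2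
    {𝒳 𝒜 𝒴 Yhat Θf Θd : Type*}
    [MeasurableSpace 𝒳] [StandardBorelSpace 𝒳]
    [TopologicalSpace 𝒜] [PolishSpace 𝒜] [MeasurableSpace 𝒜] [BorelSpace 𝒜]
    [TopologicalSpace 𝒴] [PolishSpace 𝒴] [MeasurableSpace 𝒴] [BorelSpace 𝒴]
    [TopologicalSpace Yhat] [PolishSpace Yhat] [MeasurableSpace Yhat] [BorelSpace Yhat]
    -- the law of `(X, A, Y)`
    (P : Measure (𝒳 × 𝒜 × 𝒴)) [IsProbabilityMeasure P]
    -- `p(y ∣ x)` and `q(y ∣ a)`: conditional densities of `Y` given `X` and of `Y` given `A`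
    (ν : Measure 𝒴) [SigmaFinite ν] (p : 𝒳 → 𝒴 → ℝ≥0) (q : 𝒜 → 𝒴 → ℝ≥0)
    (hp : FairICP.IsCondDensity P (fun z => z.1) (fun z => z.2.2) ν p)
    (hq : FairICP.IsCondDensity P (fun z => z.2.1) (fun z => z.2.2) ν q)
    -- the conditional entropy `H(Y ∣ X)` is finite
    (hH : Integrable (fun z : 𝒳 × 𝒜 × 𝒴 => Real.log (p z.1 z.2.2)) P)
    -- the models for the predictor and the discriminator
    (M : FairICP.PredictionModel Θf 𝒳 𝒴 Yhat ν)
    (D : Θd → Yhat × 𝒜 × 𝒴 → unitInterval) (hD : ∀ θd, Measurable (D θd))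
    (μ : ℝ) (hμ0 : 0 < μ) (hμ1 : μ < 1) :
    -- the population law of `(Ŷ, Ã, Y)` exists
    (∀ θf, ∃ S, FairICP.IsPopulationICPLaw P q (M.pred θf) S) ∧
    -- population objective
    (∀ S : Θf → Measure (Yhat × 𝒜 × 𝒴),
      (∀ θf, FairICP.IsPopulationICPLaw P q (M.pred θf) (S θf)) →
      (∀ θf, FairICP.IsRich D (FairICP.trueLaw P (M.pred θf)) (S θf)) →
      ∀ (θf : Θf) (θd : Θd),
        FairICP.IsMinimaxSolution (FairICP.objective P M D S μ) θf θd →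
        FairICP.objective P M D S μ θf θd =
          (((1 - μ) * FairICP.condEntropy P p - μ * Real.log 4 : ℝ) : EReal) →
        (∀ θ, FairICP.lossF P (M.lik θf) ≤ FairICP.lossF P (M.lik θ)) ∧
          FairICP.EqualizedOdds P (M.pred θf)) ∧
    -- objectives formed with permuted copies from `n + 1` observations, for every `n`
    ((∀ n θf, FairICP.IsRich D (FairICP.trueLaw P (M.pred θf))
        (FairICP.icpLaw P q n (M.pred θf))) →
      ∀ (θf : ℕ → Θf) (θd : ℕ → Θd),
        (∀ n, FairICP.IsMinimaxSolution
          (FairICP.objective P M D (fun θ => FairICP.icpLaw P q n (M.pred θ)) μ) (θf n) (θd n)) →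
        (∀ n, FairICP.objective P M D (fun θ => FairICP.icpLaw P q n (M.pred θ)) μ (θf n) (θd n) =
          (((1 - μ) * FairICP.condEntropy P p - μ * Real.log 4 : ℝ) : EReal)) →
        (∀ n θ, FairICP.lossF P (M.lik (θf n)) ≤ FairICP.lossF P (M.lik θ)) ∧
          FairICP.AsymptoticEqualizedOdds P (fun n => M.pred (θf n))) := by
  have hRp : IsProbabilityMeasure (P.map Prod.snd) :=
    Measure.isProbabilityMeasure_map measurable_snd.aemeasurable
  obtain ⟨r, hr, hr1, hR⟩ := FairICP.exists_normalized_density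
    (FairICP.absolutelyContinuous_prod_marginals hq.1 (FairICP.map_snd_eq_of_isCondDensity hq))
  have hpop : ∀ θ, FairICP.IsPopulationICPLaw P q (M.pred θ)
      (FairICP.resampledLaw P (P.map Prod.snd).fst r (M.pred θ)) := fun θ =>
    FairICP.isPopulationICPLaw_resampledLaw hq hr hr1 hR (M.measurable_pred θ)
  refine ⟨fun θ => ⟨_, hpop θ⟩, fun S hS hrich θf θd hsol hval => ?_,
    fun hrich θf θd hsol hval => ?_⟩
  · obtain ⟨hmin, heq⟩ := hsol.minimizes_and_trueLaw_eq hp hH hμ0 hμ1 (hS θf).1 (hrich θf) hval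
    have := (hS θf).1
    have := (hpop θf).1
    -- Weak limits are unique, so any population law `S θf` is the resampled law.
    exact ⟨hmin, FairICP.equalizedOdds_of_trueLaw_eq_resampledLaw hr hr1 hR (M.measurable_pred θf)
      (heq.trans ((hS θf).2.unique (hpop θf).2))⟩
  · have hS : ∀ n θ, IsProbabilityMeasure (FairICP.icpLaw P q n (M.pred θ)) := fun n θ =>
      FairICP.isProbabilityMeasure_icpLaw hq n (M.measurable_pred θ)
    have h : ∀ n, (∀ θ, FairICP.lossF P (M.lik (θf n)) ≤ FairICP.lossF P (M.lik θ)) ∧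
        FairICP.trueLaw P (M.pred (θf n)) = FairICP.icpLaw P q n (M.pred (θf n)) := fun n =>
      (hsol n).minimizes_and_trueLaw_eq (S := fun θ => FairICP.icpLaw P q n (M.pred θ)) hp hH
        hμ0 hμ1 (hS n (θf n)) (hrich n (θf n)) (hval n)
    exact ⟨fun n => (h n).1, FairICP.asymptoticEqualizedOdds_of_trueLaw_eq_icpLaw hq hr hr1 hR
      (fun n => M.measurable_pred (θf n)) fun n => (h n).2⟩
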